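/- **Conventions.** All algebras are associative unital algebras over $\mathbb C$ and algebra maps are unital; $\mathbf 1$ denotes a unit. Let $(\mathcal G,\Delta,\epsilon,\phi,S,\alpha,\beta)$ be a finite dimensional quasi-Hopf algebra with invertible antipode. Thus $\Delta:\mathcal G\to\mathcal G\otimes\mathcal G$ and $\epsilon:\mathcal G\to\mathbb C$ are algebra maps and $\phi\in\mathcal G^{\otimes 3}$ is invertible, with $$(\mathrm{id}\otimes\Delta)(\Delta(a))\,\phi=\phi\,(\Delta\otimes\mathrm{id})(\Delta(a)),\qquad (\epsilon\otimes\mathrm{id})\Delta=\mathrm{id}=(\mathrm{id}\otimes\epsilon)\Delta,\qquad(\mathrm{id}\otimes\epsilon\otimes\mathrm{id})(\phi)=\mathbf 1\otimes\mathbf 1,$$ $$(\mathrm{id}\otimes\mathrm{id}\otimes\Delta)(\phi)\,(\Delta\otimes\mathrm{id}\otimes\mathrm{id})(\phi)=(\mathbf 1\otimes\phi)\,(\mathrm{id}\otimes\Delta\otimes\mathrm{id})(\phi)\,(\phi\otimes\mathbf 1);$$ $S:\mathcal G\to\mathcal G$ is a bijective linear unital anti-homomorphism and $\alpha,\beta\in\mathcal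 G$ satisfy $S(a_{(1)})\alpha a_{(2)}=\epsilon(a)\alpha$, $a_{(1)}\beta S(a_{(2)})=\epsilon(a)\beta$ and, writing $\phi=X\otimes Y\otimes Z$, $\phi^{-1}=P\otimes Q\otimes R$ (sums suppressed), $X\beta S(Y)\alpha Z=\mathbf 1=S(P)\alpha Q\beta S(R)$. Assume moreover the normalization $\epsilon(\alpha)=1$ (which implies $\epsilon(\beta)=1$). Let $(\delta,\Psi)$ be a two-sided coaction of $\mathcal G$ on an algebra $\mathcal M$: $\delta:\mathcal M\to\mathcal G\otimes\mathcal M\otimes\mathcal G$ is an algebra map and $\Psi\in\mathcal G\otimes\mathcal G\otimes\mathcal M\otimes\mathcal G\otimes\mathcal G$ is invertible, with $$(\mathrm{id}\otimes\delta\otimes\mathrm{id})(\delta(m))\,\Psi=\Psi\,(\Delta\otimes\mathrm{id}\otimes\Delta)(\delta(m)),\qquad(\epsilon\otimes\mathrm{id}\otimes\epsilon)\circ\delta=\mathrm{id},$$ $$(\mathbf 1\otimes\Psi\otimes\mathbf 1)\,(\mathrm{id}\otimes\Delta\otimes\mathrm{id}\otimes\Delta\otimes\mathrm{id})(\Psi)\,(\phi\otimes\mathbf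 1\otimes\phi^{-1})=(\mathrm{id}\otimes\mathrm{id}\otimes\delta\otimes\mathrm{id}\otimes\mathrm{id})(\Psi)\,(\Delta\otimes\mathrm{id}\otimes\mathrm{id}\otimes\mathrm{id}\otimes\Delta)(\Psi),$$ $$(\mathrm{id}\otimes\epsilon\otimes\mathrm{id}\otimes\epsilon\otimes\mathrm{id})(\Psi)=(\epsilon\otimes\mathrm{id}\otimes\mathrm{id}\otimes\mathrm{id}\otimes\epsilon)(\Psi)=\mathbf 1\otimes\mathbf 1\otimes\mathbf 1.$$ On the dual $\hat{\mathcal G}$ put $\langle\varphi\psi,a\rangle=\langle\varphi\otimes\psi,\Delta(a)\rangle$ (a product that need not be associative), with unit $\mathbf 1_{\hat{\mathcal G}}=\epsilon$; $\langle\varphi_{(1)}\otimes\varphi_{(2)},a\otimes b\rangle=\langle\varphi,ab\rangle$; $\hat S^{-1}(\varphi)=\varphi\circ S^{-1}$; $\langle a\rightharpoonup\varphi\leftharpoonup b,x\rangle=\langle\varphi,bxa\rangle$; and $\varphi\triangleright m\triangleleft\psi=(\psi\otimes\mathrm{id}\otimes\varphi)(\delta(m))$. Let $$\gamma=(S(U)\otimes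 S(T))(\alpha\otimes\alpha)(V\otimes W)\ \text{ with }\ T\otimes U\otimes V\otimes W=(\mathbf 1\otimes\phi^{-1})(\mathrm{id}\otimes\mathrm{id}\otimes\Delta)(\phi),$$ let $F=(S\otimes S)(\Delta^{op}(P))\,\gamma\,\Delta(Q\beta S(R))$ (Drinfel'd's twist, an invertible element of $\mathcal G\otimes\mathcal G$), $h=(S^{-1}\otimes S^{-1})(F^{21})$, and, with $\bar\Psi=\Psi^{-1}$, $$\Omega_L=(\mathrm{id}\otimes\mathrm{id}\otimes\mathrm{id}\otimes S^{-1}\otimes S^{-1})(\Psi^{-1})\cdot h^{54},\qquad\Omega_R=(h^{-1})^{21}\cdot(S^{-1}\otimes S^{-1}\otimes\mathrm{id}\otimes\mathrm{id}\otimes\mathrm{id})(\Psi),$$ $$p=\Psi^2S^{-1}(\Psi^1\beta)\otimes\Psi^3\otimes\Psi^4\beta S(\Psi^5),\qquad q=S(\bar\Psi^1)\alpha\bar\Psi^2\otimes\bar\Psi^3\otimes S^{-1}(\alpha\bar\Psi^5)\bar\Psi^4 .$$ The left diagonal crossed product $\hat{\mathcal G}\bowtie\mathcal M$ is the vector space $\hat{\mathcal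 G}\otimes\mathcal M$ with the product $$(\varphi\bowtie m)(\psi\bowtie n)=\big[(\Omega_L^1\rightharpoonup\varphi\leftharpoonup\Omega_L^5)(\Omega_L^2\rightharpoonup\psi_{(2)}\leftharpoonup\Omega_L^4)\big]\bowtie\big[\Omega_L^3\,(\hat S^{-1}(\psi_{(1)})\triangleright m\triangleleft\psi_{(3)})\,n\big],$$ and the right diagonal crossed product $\mathcal M\bowtie\hat{\mathcal G}$ is $\mathcal M\otimes\hat{\mathcal G}$ with the product $$(m\bowtie\varphi)(n\bowtie\psi)=\big[m\,(\varphi_{(1)}\triangleright n\triangleleft\hat S^{-1}(\varphi_{(3)}))\,\Omega_R^3\big]\bowtie\big[(\Omega_R^2\rightharpoonup\varphi_{(2)}\leftharpoonup\Omega_R^4)(\Omega_R^1\rightharpoonup\psi\leftharpoonup\Omega_R^5)\big].$$ **Theorem 10.2.** (i) $\hat{\mathcal G}\bowtie\mathcal M$ and $\mathcal M\bowtie\hat{\mathcal G}$ are associative algebras with units $\mathbf 1_{\hat{\mathcal G}}\bowtie\mathbf 1_{\mathcal M}$ and $\mathbf 1_{\mathcal M}\bowtie\mathbf 1_{\hat{\mathcal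 G}}$, respectively. (ii) The maps $m\mapsto\mathbf 1_{\hat{\mathcal G}}\bowtie m$ and $m\mapsto m\bowtie\mathbf 1_{\hat{\mathcal G}}$ are injective unital algebra maps from $\mathcal M$ into $\hat{\mathcal G}\bowtie\mathcal M$ and $\mathcal M\bowtie\hat{\mathcal G}$, respectively. (iii) These are equivalent extensions of $\mathcal M$: the linear map $$f:\hat{\mathcal G}\bowtie\mathcal M\to\mathcal M\bowtie\hat{\mathcal G},\qquad f(\varphi\bowtie m)=\big(q^2\bowtie(S^{-1}(q^1)\rightharpoonup\varphi\leftharpoonup q^3)\big)\cdot(m\bowtie\mathbf 1_{\hat{\mathcal G}})$$ is an isomorphism of unital algebras with $f(\mathbf 1_{\hat{\mathcal G}}\bowtie m)=m\bowtie\mathbf 1_{\hat{\mathcal G}}$ for all $m\in\mathcal M$, and its inverse is $$f^{-1}(m\bowtie\varphi)=(\mathbf 1_{\hat{\mathcal G}}\bowtie m)\cdot\big((p^1\rightharpoonup\varphi\leftharpoonup S^{-1}(p^3))\bowtie p^2\big).$$ -/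

import Mathlib

open scoped TensorProduct

set_option maxSynthPendingDepth 10

noncomputable section

namespace QuasiHopf

universe u v w

/-! ### Algebra maps acting on single tensor factors

All iterated tensor products are bracketed to the right, `A ⊗ (B ⊗ (C ⊗ ⋯))`. -/

section Legs

variable {k : Type u} [Field k]
variable {A A₁ A₂ A₃ B B' : Type*}
  [Ring A] [Algebra k A] [Ring A₁] [Algebra k A₁] [Ring A₂] [Algebra k A₂]
  [Ring A₃] [Algebra k A₃] [Ring B] [Algebra k B] [Ring B'] [Algebra k B']

/-- `id ⊗ g`. -/
def tail (A : Type*) [Ring A] [Algebra k A] (g : B →ₐ[k] B') : A ⊗[k] B →ₐ[k] A ⊗[k] B' :=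
  Algebra.TensorProduct.map (AlgHom.id k A) g

/-- `g ⊗ id` for `g : A → A₁ ⊗ A₂`, as a map `A ⊗ B → A₁ ⊗ (A₂ ⊗ B)`. -/
def head2 (B : Type*) [Ring B] [Algebra k B] (g : A →ₐ[k] A₁ ⊗[k] A₂) :
    A ⊗[k] B →ₐ[k] A₁ ⊗[k] (A₂ ⊗[k] B) :=
  (Algebra.TensorProduct.assoc k k k A₁ A₂ B).toAlgHom.comp
    (Algebra.TensorProduct.map g (AlgHom.id k B))

/-- `g ⊗ id` for `g : A → A₁ ⊗ (A₂ ⊗ A₃)`, as a map `A ⊗ B → A₁ ⊗ (A₂ ⊗ (A₃ ⊗ B))`. -/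
def head3 (B : Type*) [Ring B] [Algebra k B] (g : A →ₐ[k] A₁ ⊗[k] (A₂ ⊗[k] A₃)) :
    A ⊗[k] B →ₐ[k] A₁ ⊗[k] (A₂ ⊗[k] (A₃ ⊗[k] B)) :=
  (tail A₁ (Algebra.TensorProduct.assoc k k k A₂ A₃ B).toAlgHom).comp (head2 B g)

/-- `c ⊗ id` for a scalar valued `c`, as a map `A ⊗ B → B`. -/
def dropHead (B : Type*) [Ring B] [Algebra k B] (c : A →ₐ[k] k) : A ⊗[k] B →ₐ[k] B :=
  (Algebra.TensorProduct.lid k B).toAlgHom.comp (Algebra.TensorProduct.map c (AlgHom.id k B))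

/-- `id ⊗ c` for a scalar valued `c`, as a map `A ⊗ B → A`. -/
def dropTail (A : Type*) [Ring A] [Algebra k A] (c : B →ₐ[k] k) : A ⊗[k] B →ₐ[k] A :=
  (Algebra.TensorProduct.rid k k A).toAlgHom.comp (Algebra.TensorProduct.map (AlgHom.id k A) c)

/-- `a ↦ a ⊗ 1`. -/
def appendOne (A : Type*) [Ring A] [Algebra k A] (B : Type*) [Ring B] [Algebra k B] :
    A →ₐ[k] A ⊗[k] B :=
  Algebra.TensorProduct.includeLeft

end Legs

/-! ### Quasi-bialgebras and quasi-Hopf algebras -/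

/-- A quasi-bialgebra structure `(Δ, ε, φ)` on the algebra `G`. -/
structure QuasiBialgebra (k : Type u) [Field k] (G : Type v) [Ring G] [Algebra k G] where
  /-- the coproduct `Δ` -/
  comul : G →ₐ[k] G ⊗[k] G
  /-- the counit `ε` -/
  counit : G →ₐ[k] k
  /-- the reassociator `φ` -/
  phi : (G ⊗[k] (G ⊗[k] G))ˣ
  /-- `(id ⊗ Δ)(Δ(a)) φ = φ (Δ ⊗ id)(Δ(a))` -/
  quasi_coassoc : ∀ a : G,
    tail G comul (comul a) * phi.val = phi.val * head2 G comul (comul a)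
  /-- `(id ⊗ id ⊗ Δ)(φ) (Δ ⊗ id ⊗ id)(φ) = (1 ⊗ φ) (id ⊗ Δ ⊗ id)(φ) (φ ⊗ 1)` -/
  pentagon :
    tail G (tail G comul) phi.val * head2 (G ⊗[k] G) comul phi.val =
      ((1 : G) ⊗ₜ[k] phi.val) * tail G (head2 G comul) phi.val *
        tail G (tail G (appendOne G G)) phi.val
  /-- `(ε ⊗ id) ∘ Δ = id` -/
  counit_left : ∀ a : G, dropHead G counit (comul a) = a
  /-- `(id ⊗ ε) ∘ Δ = id` -/
  counit_right : ∀ a : G, dropTail G counit (comul a) = a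
  /-- `(id ⊗ ε ⊗ id)(φ) = 1 ⊗ 1` -/
  counit_phi : tail G (dropHead G counit) phi.val = 1

open LinearMap (mul' mulLeft mulRight)

/-- A quasi-Hopf algebra structure `(Δ, ε, φ, S, α, β)` on `G`, with invertible antipode `S`. -/
structure QuasiHopfAlgebra (k : Type u) [Field k] (G : Type v) [Ring G] [Algebra k G] extends
    QuasiBialgebra k G where
  /-- the antipode `S`, a linear bijection -/
  antipode : G ≃ₗ[k] G
  /-- the element `α` -/
  alpha : G
  /-- the element `β` -/
  beta : G
  antipode_one : antipode 1 = 1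
  antipode_mul : ∀ a b : G, antipode (a * b) = antipode b * antipode a
  /-- `S(a₍₁₎) α a₍₂₎ = ε(a) α` -/
  antipode_alpha : ∀ a : G,
    mul' k G (TensorProduct.map antipode.toLinearMap (mulLeft k alpha) (comul a)) =
      counit a • alpha
  /-- `a₍₁₎ β S(a₍₂₎) = ε(a) β` -/
  antipode_beta : ∀ a : G,
    mul' k G (TensorProduct.map (mulRight k beta) antipode.toLinearMap (comul a)) =
      counit a • beta
  /-- `∑ Xʲ β S(Yʲ) α Zʲ = 1` where `φ = ∑ Xʲ ⊗ Yʲ ⊗ Zʲ` -/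
  antipode_phi :
    (mul' k G ∘ₗ TensorProduct.map (mulRight k beta)
      (mul' k G ∘ₗ TensorProduct.map (mulRight k alpha ∘ₗ antipode.toLinearMap) LinearMap.id))
        phi.val = 1
  /-- `∑ S(Pʲ) α Qʲ β S(Rʲ) = 1` where `φ⁻¹ = ∑ Pʲ ⊗ Qʲ ⊗ Rʲ` -/
  antipode_phi_inv :
    (mul' k G ∘ₗ TensorProduct.map (mulRight k alpha ∘ₗ antipode.toLinearMap)
      (mul' k G ∘ₗ TensorProduct.map (mulRight k beta) antipode.toLinearMap))
        (phi⁻¹).val = 1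

/-! ### Two-sided coactions -/

/-- A two-sided coaction `(δ, Ψ)` of the quasi-bialgebra `G` on the algebra `M`. -/
structure TwoSidedCoaction {k : Type u} [Field k] {G : Type v} [Ring G] [Algebra k G]
    (H : QuasiBialgebra k G) (M : Type w) [Ring M] [Algebra k M] where
  /-- the algebra map `δ : M → G ⊗ M ⊗ G` -/
  delta : M →ₐ[k] G ⊗[k] (M ⊗[k] G)
  /-- the reassociator `Ψ` -/
  Psi : (G ⊗[k] (G ⊗[k] (M ⊗[k] (G ⊗[k] G))))ˣ
  /-- `(id ⊗ δ ⊗ id)(δ(m)) Ψ = Ψ (Δ ⊗ id ⊗ Δ)(δ(m))` -/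
  quasi_coassoc : ∀ m : M,
    tail G (head3 G delta) (delta m) * Psi.val =
      Psi.val * head2 (M ⊗[k] (G ⊗[k] G)) H.comul (tail G (tail M H.comul) (delta m))
  /-- `(1 ⊗ Ψ ⊗ 1) (id ⊗ Δ ⊗ id ⊗ Δ ⊗ id)(Ψ) (φ ⊗ 1 ⊗ φ⁻¹)
    = (id ⊗ id ⊗ δ ⊗ id ⊗ id)(Ψ) (Δ ⊗ id ⊗ id ⊗ id ⊗ Δ)(Ψ)` -/
  pentagon :
    ((1 : G) ⊗ₜ[k] tail G (tail G (tail M (tail G (appendOne G G)))) Psi.val) *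
        tail G (head2 (M ⊗[k] (G ⊗[k] (G ⊗[k] G))) H.comul)
          (tail G (tail G (tail M (head2 G H.comul))) Psi.val) *
        head3 (M ⊗[k] (G ⊗[k] (G ⊗[k] G))) (AlgHom.id k (G ⊗[k] (G ⊗[k] G)))
          (H.phi.val ⊗ₜ[k] ((1 : M) ⊗ₜ[k] (H.phi⁻¹).val)) =
      tail G (tail G (head3 (G ⊗[k] G) delta)) Psi.val *
        head2 (G ⊗[k] (M ⊗[k] (G ⊗[k] (G ⊗[k] G)))) H.comul
          (tail G (tail G (tail M (tail G H.comul))) Psi.val)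
  /-- `(ε ⊗ id ⊗ ε) ∘ δ = id` -/
  counit_delta : ∀ m : M,
    dropTail M H.counit (dropHead (M ⊗[k] G) H.counit (delta m)) = m
  /-- `(id ⊗ ε ⊗ id ⊗ ε ⊗ id)(Ψ) = 1 ⊗ 1 ⊗ 1` -/
  counit_Psi_inner :
    tail G (dropHead (M ⊗[k] G) H.counit)
      (tail G (tail G (tail M (dropHead G H.counit))) Psi.val) = 1
  /-- `(ε ⊗ id ⊗ id ⊗ id ⊗ ε)(Ψ) = 1 ⊗ 1 ⊗ 1` -/
  counit_Psi_outer :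
    dropHead (G ⊗[k] (M ⊗[k] G)) H.counit
      (tail G (tail G (tail M (dropTail G H.counit))) Psi.val) = 1

/-! ### Drinfel'd's twists -/

namespace QuasiHopfAlgebra

variable {k : Type u} [Field k] {G : Type v} [Ring G] [Algebra k G] (H : QuasiHopfAlgebra k G)

/-- the antipode as a linear map -/
def S : G →ₗ[k] G := H.antipode.toLinearMap

/-- the inverse antipode as a linear map -/
def Sinv : G →ₗ[k] G := H.antipode.symm.toLinearMap

/-- `a ⊗ b ↦ S(b) ⊗ S(a)` -/
def flipS : G ⊗[k] G →ₗ[k] G ⊗[k] G :=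
  TensorProduct.map H.S H.S ∘ₗ (TensorProduct.comm k G G).toLinearMap

/-- `a ⊗ b ↦ S⁻¹(b) ⊗ S⁻¹(a)` -/
def flipSinv : G ⊗[k] G →ₗ[k] G ⊗[k] G :=
  TensorProduct.map H.Sinv H.Sinv ∘ₗ (TensorProduct.comm k G G).toLinearMap

/-- `γ = ∑ (S(U) ⊗ S(T)) (α ⊗ α) (V ⊗ W)`, where
`∑ T ⊗ U ⊗ V ⊗ W = (1 ⊗ φ⁻¹) (id ⊗ id ⊗ Δ)(φ)`. -/
def gamma : G ⊗[k] G :=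
  (mul' k (G ⊗[k] G) ∘ₗ
      TensorProduct.map (mulRight k (H.alpha ⊗ₜ[k] H.alpha) ∘ₗ H.flipS) LinearMap.id ∘ₗ
      (TensorProduct.assoc k G G (G ⊗[k] G)).symm.toLinearMap)
    (((1 : G) ⊗ₜ[k] (H.phi⁻¹).val) * tail G (tail G H.comul) H.phi.val)

/-- Drinfel'd's twist `f = ∑ (S ⊗ S)(Δᵒᵖ(P)) γ Δ(Q β S(R))`, where `φ⁻¹ = ∑ P ⊗ Q ⊗ R`. -/
def twistF : G ⊗[k] G :=
  (mul' k (G ⊗[k] G) ∘ₗ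
      TensorProduct.map
        (mulRight k H.gamma ∘ₗ H.flipS ∘ₗ H.comul.toLinearMap)
        (H.comul.toLinearMap ∘ₗ mul' k G ∘ₗ TensorProduct.map (mulRight k H.beta) H.S))
    (H.phi⁻¹).val

/-- `h = (S⁻¹ ⊗ S⁻¹)(f²¹)` -/
def twistH : G ⊗[k] G := H.flipSinv H.twistF

/-- `h⁻¹` -/
def twistHInv : G ⊗[k] G := Ring.inverse H.twistH

end QuasiHopfAlgebra

/-! ### The dual `Ĝ` -/

section Dual

variable {k : Type u} [Field k] {G : Type v} [Ring G] [Algebra k G]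

/-- The (not necessarily associative) product on the dual: `⟨φψ, a⟩ = ⟨φ ⊗ ψ, Δ(a)⟩`. -/
def dualMul (H : QuasiBialgebra k G) :
    Module.Dual k G ⊗[k] Module.Dual k G →ₗ[k] Module.Dual k G :=
  H.comul.toLinearMap.dualMap ∘ₗ TensorProduct.dualDistrib k G G

/-- The unit of the dual, i.e. the counit of `G` as a linear functional. -/
def dualOne (H : QuasiBialgebra k G) : Module.Dual k G := H.counit.toLinearMap

/-- The coproduct on the dual: `⟨φ₍₁₎ ⊗ φ₍₂₎, a ⊗ b⟩ = ⟨φ, ab⟩`. -/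
def dualComul [FiniteDimensional k G] :
    Module.Dual k G →ₗ[k] Module.Dual k G ⊗[k] Module.Dual k G :=
  (TensorProduct.dualDistribEquiv k G G).symm.toLinearMap ∘ₗ (mul' k G).dualMap

/-- `φ ↦ φ₍₁₎ ⊗ φ₍₂₎ ⊗ φ₍₃₎` -/
def dualComul₂ [FiniteDimensional k G] :
    Module.Dual k G →ₗ[k] Module.Dual k G ⊗[k] (Module.Dual k G ⊗[k] Module.Dual k G) :=
  dualComul.lTensor (Module.Dual k G) ∘ₗ dualComul

/-- `Ŝ⁻¹(φ) = φ ∘ S⁻¹` -/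
def dualSinv (H : QuasiHopfAlgebra k G) : Module.Dual k G →ₗ[k] Module.Dual k G :=
  H.Sinv.dualMap

/-- `a ⇀ φ = φ₍₁₎ ⟨φ₍₂₎, a⟩`, i.e. `x ↦ φ(x a)`, as a linear map `a ↦ (φ ↦ a ⇀ φ)`. -/
def leftHit : G →ₗ[k] Module.End k (Module.Dual k G) :=
  Module.Dual.transpose ∘ₗ (LinearMap.mul k G).flip

/-- `φ ↼ b = ⟨φ₍₁₎, b⟩ φ₍₂₎`, i.e. `x ↦ φ(b x)`, as a linear map `b ↦ (φ ↦ φ ↼ b)`. -/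
def rightHit : G →ₗ[k] Module.End k (Module.Dual k G) :=
  Module.Dual.transpose ∘ₗ LinearMap.mul k G

/-- `a ⊗ b ↦ (φ ↦ a ⇀ φ ↼ b)` -/
def hit : G ⊗[k] G →ₗ[k] Module.End k (Module.Dual k G) :=
  TensorProduct.lift ((LinearMap.mul k (Module.End k (Module.Dual k G))).compl₁₂ leftHit rightHit)

end Dual

/-! ### The diagonal crossed products -/

namespace TwoSidedCoaction

variable {k : Type u} [Field k] {G : Type v} [Ring G] [Algebra k G]
variable {M : Type w} [Ring M] [Algebra k M]

/-- `(ψ, φ) ↦ ψ ⊗ id ⊗ φ`, as maps `G ⊗ M ⊗ G → M`. -/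
def outerEval : Module.Dual k G →ₗ[k] Module.Dual k G →ₗ[k] (G ⊗[k] (M ⊗[k] G) →ₗ[k] M) :=
  LinearMap.mk₂ k
    (fun ψ φ => (TensorProduct.lid k M).toLinearMap ∘ₗ
      TensorProduct.map ψ ((TensorProduct.rid k M).toLinearMap ∘ₗ φ.lTensor M))
    (fun _ _ _ => by ext; simp [add_smul])
    (fun c _ _ => by ext; simp [mul_smul, smul_comm c])
    (fun _ _ _ => by ext; simp [smul_smul, mul_comm])
    (fun c _ _ => by ext; simp [smul_comm c])

/-- `a ⊗ b ⊗ m ⊗ c ⊗ d ↦ ((a ⊗ d) ⊗ (b ⊗ c)) ⊗ m` -/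
def nest : G ⊗[k] (G ⊗[k] (M ⊗[k] (G ⊗[k] G))) →ₗ[k]
    ((G ⊗[k] G) ⊗[k] (G ⊗[k] G)) ⊗[k] M :=
  ((TensorProduct.assoc k G G (G ⊗[k] G)).symm.toLinearMap ∘ₗ
      ((TensorProduct.comm k (G ⊗[k] G) G).toLinearMap ∘ₗ
        (TensorProduct.assoc k G G G).symm.toLinearMap).lTensor G).rTensor M ∘ₗ
    (TensorProduct.assoc k G (G ⊗[k] (G ⊗[k] G)) M).symm.toLinearMap ∘ₗ
    ((TensorProduct.assoc k G (G ⊗[k] G) M).symm.toLinearMap ∘ₗ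
      (TensorProduct.comm k M (G ⊗[k] G)).toLinearMap.lTensor G).lTensor G

theorem nest_tmul (a b c d : G) (m : M) :
    nest (a ⊗ₜ[k] (b ⊗ₜ[k] (m ⊗ₜ[k] (c ⊗ₜ[k] d)))) = ((a ⊗ₜ d) ⊗ₜ (b ⊗ₜ c)) ⊗ₜ m := by
  simp [nest]

/-- For `Ω = ∑ Ω¹ ⊗ Ω² ⊗ Ω³ ⊗ Ω⁴ ⊗ Ω⁵` the operator
`(φ ⊗ ψ) ⊗ m ↦ ∑ ((Ω¹ ⇀ φ ↼ Ω⁵) ⊗ (Ω² ⇀ ψ ↼ Ω⁴)) ⊗ Ω³ m`. -/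
def leftOp : G ⊗[k] (G ⊗[k] (M ⊗[k] (G ⊗[k] G))) →ₗ[k]
    Module.End k ((Module.Dual k G ⊗[k] Module.Dual k G) ⊗[k] M) :=
  TensorProduct.homTensorHomMap (RingHom.id k) _ _ _ _ ∘ₗ
    TensorProduct.map (TensorProduct.homTensorHomMap (RingHom.id k) _ _ _ _ ∘ₗ TensorProduct.map hit hit)
      (LinearMap.mul k M) ∘ₗ nest

/-- For `Ω = ∑ Ω¹ ⊗ Ω² ⊗ Ω³ ⊗ Ω⁴ ⊗ Ω⁵` the operator
`m ⊗ (φ ⊗ ψ) ↦ ∑ m Ω³ ⊗ ((Ω² ⇀ φ ↼ Ω⁴) ⊗ (Ω¹ ⇀ ψ ↼ Ω⁵))`. -/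
def rightOp : G ⊗[k] (G ⊗[k] (M ⊗[k] (G ⊗[k] G))) →ₗ[k]
    Module.End k (M ⊗[k] (Module.Dual k G ⊗[k] Module.Dual k G)) :=
  TensorProduct.homTensorHomMap (RingHom.id k) _ _ _ _ ∘ₗ
    TensorProduct.map (LinearMap.mul k M).flip
      (TensorProduct.homTensorHomMap (RingHom.id k) _ _ _ _ ∘ₗ TensorProduct.map hit hit ∘ₗ
        (TensorProduct.comm k (G ⊗[k] G) (G ⊗[k] G)).toLinearMap) ∘ₗ
    (TensorProduct.comm k ((G ⊗[k] G) ⊗[k] (G ⊗[k] G)) M).toLinearMap ∘ₗ nest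

/-- `a ⊗ m ⊗ b ↦ (φ ↦ m ⊗ (a ⇀ φ ↼ b))` -/
def spread : G ⊗[k] (M ⊗[k] G) →ₗ[k] (Module.Dual k G →ₗ[k] M ⊗[k] Module.Dual k G) :=
  TensorProduct.lift
      ((LinearMap.llcomp k (Module.Dual k G) (Module.Dual k G) (M ⊗[k] Module.Dual k G)).compl₁₂
        (TensorProduct.mk k M (Module.Dual k G)) hit) ∘ₗ
    (TensorProduct.leftComm k G M G).toLinearMap

variable {H : QuasiHopfAlgebra k G} (D : TwoSidedCoaction H.toQuasiBialgebra M)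

/-- `Ω_L = (id ⊗ id ⊗ id ⊗ S⁻¹ ⊗ S⁻¹)(Ψ⁻¹) · h⁵⁴` -/
def OmegaL : G ⊗[k] (G ⊗[k] (M ⊗[k] (G ⊗[k] G))) :=
  ((((TensorProduct.map H.Sinv H.Sinv).lTensor M).lTensor G).lTensor G) (D.Psi⁻¹).val *
    ((1 : G) ⊗ₜ[k] ((1 : G) ⊗ₜ[k] ((1 : M) ⊗ₜ[k] TensorProduct.comm k G G H.twistH)))

/-- `Ω_R = (h⁻¹)²¹ · (S⁻¹ ⊗ S⁻¹ ⊗ id ⊗ id ⊗ id)(Ψ)` -/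
def OmegaR : G ⊗[k] (G ⊗[k] (M ⊗[k] (G ⊗[k] G))) :=
  TensorProduct.assoc k G G (M ⊗[k] (G ⊗[k] G))
      (TensorProduct.comm k G G H.twistHInv ⊗ₜ[k] (1 : M ⊗[k] (G ⊗[k] G))) *
    TensorProduct.map H.Sinv (H.Sinv.rTensor (M ⊗[k] (G ⊗[k] G))) D.Psi.val

/-- `m ⊗ (φ ⊗ ψ) ↦ φ ▷ m ◁ ψ = (ψ ⊗ id ⊗ φ)(δ(m))` -/
def act : M ⊗[k] (Module.Dual k G ⊗[k] Module.Dual k G) →ₗ[k] M :=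
  TensorProduct.lift ((TensorProduct.lift outerEval.flip).flip ∘ₗ D.delta.toLinearMap)

/-- `m ⊗ ψ ↦ ψ₍₂₎ ⊗ (Ŝ⁻¹(ψ₍₁₎) ▷ m ◁ ψ₍₃₎)` -/
def leftCross [FiniteDimensional k G] :
    M ⊗[k] Module.Dual k G →ₗ[k] Module.Dual k G ⊗[k] M :=
  (D.act ∘ₗ ((dualSinv H).rTensor (Module.Dual k G)).lTensor M).lTensor (Module.Dual k G) ∘ₗ
    (TensorProduct.leftComm k M (Module.Dual k G) _).toLinearMap ∘ₗ
    ((TensorProduct.leftComm k (Module.Dual k G) (Module.Dual k G)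
      (Module.Dual k G)).toLinearMap ∘ₗ dualComul₂).lTensor M

/-- `φ ⊗ n ↦ (φ₍₁₎ ▷ n ◁ Ŝ⁻¹(φ₍₃₎)) ⊗ φ₍₂₎` -/
def rightCross [FiniteDimensional k G] :
    Module.Dual k G ⊗[k] M →ₗ[k] M ⊗[k] Module.Dual k G :=
  (TensorProduct.comm k (Module.Dual k G) M).toLinearMap ∘ₗ
    (D.act ∘ₗ ((dualSinv H).lTensor (Module.Dual k G)).lTensor M).lTensor (Module.Dual k G) ∘ₗ
    (TensorProduct.leftComm k M (Module.Dual k G) _).toLinearMap ∘ₗ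
    ((TensorProduct.leftComm k (Module.Dual k G) (Module.Dual k G)
      (Module.Dual k G)).toLinearMap ∘ₗ dualComul₂).lTensor M ∘ₗ
    (TensorProduct.comm k (Module.Dual k G) M).toLinearMap

/-- The product of the left diagonal crossed product on `Ĝ ⊗ M`:
`(φ ⋈ m)(ψ ⋈ n) = (Ω_L¹ ⇀ φ ↼ Ω_L⁵)(Ω_L² ⇀ ψ₍₂₎ ↼ Ω_L⁴) ⋈ Ω_L³ (Ŝ⁻¹(ψ₍₁₎) ▷ m ◁ ψ₍₃₎) n`. -/
def leftMul [FiniteDimensional k G] :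
    (Module.Dual k G ⊗[k] M) →ₗ[k] (Module.Dual k G ⊗[k] M) →ₗ[k] (Module.Dual k G ⊗[k] M) :=
  TensorProduct.curry <|
    (dualMul H.toQuasiBialgebra).rTensor M ∘ₗ
    leftOp D.OmegaL ∘ₗ
    (TensorProduct.assoc k (Module.Dual k G) (Module.Dual k G) M).symm.toLinearMap ∘ₗ
    ((mul' k M).lTensor (Module.Dual k G) ∘ₗ
      (TensorProduct.assoc k (Module.Dual k G) M M).toLinearMap ∘ₗ
      D.leftCross.rTensor M ∘ₗ
      (TensorProduct.assoc k M (Module.Dual k G) M).symm.toLinearMap).lTensor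
        (Module.Dual k G) ∘ₗ
    (TensorProduct.assoc k (Module.Dual k G) M (Module.Dual k G ⊗[k] M)).toLinearMap

/-- The product of the right diagonal crossed product on `M ⊗ Ĝ`:
`(m ⋈ φ)(n ⋈ ψ) = m (φ₍₁₎ ▷ n ◁ Ŝ⁻¹(φ₍₃₎)) Ω_R³ ⋈ (Ω_R² ⇀ φ₍₂₎ ↼ Ω_R⁴)(Ω_R¹ ⇀ ψ ↼ Ω_R⁵)`. -/
def rightMul [FiniteDimensional k G] :
    (M ⊗[k] Module.Dual k G) →ₗ[k] (M ⊗[k] Module.Dual k G) →ₗ[k] (M ⊗[k] Module.Dual k G) :=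
  TensorProduct.curry <|
    (dualMul H.toQuasiBialgebra).lTensor M ∘ₗ
    rightOp D.OmegaR ∘ₗ
    (mul' k M).rTensor (Module.Dual k G ⊗[k] Module.Dual k G) ∘ₗ
    (TensorProduct.assoc k M M (Module.Dual k G ⊗[k] Module.Dual k G)).symm.toLinearMap ∘ₗ
    ((TensorProduct.assoc k M (Module.Dual k G) (Module.Dual k G)).toLinearMap ∘ₗ
      D.rightCross.rTensor (Module.Dual k G) ∘ₗ
      (TensorProduct.assoc k (Module.Dual k G) M (Module.Dual k G)).symm.toLinearMap).lTensor M ∘ₗ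
    (TensorProduct.assoc k M (Module.Dual k G) (M ⊗[k] Module.Dual k G)).toLinearMap

/-- `m ↦ 1_Ĝ ⋈ m` -/
def leftIncl (_D : TwoSidedCoaction H.toQuasiBialgebra M) : M →ₗ[k] Module.Dual k G ⊗[k] M :=
  TensorProduct.mk k (Module.Dual k G) M (dualOne H.toQuasiBialgebra)

/-- `m ↦ m ⋈ 1_Ĝ` -/
def rightIncl (_D : TwoSidedCoaction H.toQuasiBialgebra M) : M →ₗ[k] M ⊗[k] Module.Dual k G :=
  (TensorProduct.mk k M (Module.Dual k G)).flip (dualOne H.toQuasiBialgebra)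

/-- `p_δ = Ψ² S⁻¹(Ψ¹ β) ⊗ Ψ³ ⊗ Ψ⁴ β S(Ψ⁵)` -/
def pElt : G ⊗[k] (M ⊗[k] G) :=
  (TensorProduct.map
      (mul' k G ∘ₗ (TensorProduct.comm k G G).toLinearMap ∘ₗ
        TensorProduct.map (H.Sinv ∘ₗ mulRight k H.beta) LinearMap.id)
      ((mul' k G ∘ₗ TensorProduct.map (mulRight k H.beta) H.S).lTensor M) ∘ₗ
    (TensorProduct.assoc k G G (M ⊗[k] (G ⊗[k] G))).symm.toLinearMap) D.Psi.val

/-- `q_δ = S(Ψ̄¹) α Ψ̄² ⊗ Ψ̄³ ⊗ S⁻¹(α Ψ̄⁵) Ψ̄⁴`, where `Ψ̄ = Ψ⁻¹` -/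
def qElt : G ⊗[k] (M ⊗[k] G) :=
  (TensorProduct.map
      (mul' k G ∘ₗ TensorProduct.map (mulRight k H.alpha ∘ₗ H.S) LinearMap.id)
      ((mul' k G ∘ₗ (TensorProduct.comm k G G).toLinearMap ∘ₗ
        TensorProduct.map LinearMap.id (H.Sinv ∘ₗ mulLeft k H.alpha)).lTensor M) ∘ₗ
    (TensorProduct.assoc k G G (M ⊗[k] (G ⊗[k] G))).symm.toLinearMap) (D.Psi⁻¹).val

/-- `φ ⋈ m ↦ (q² ⋈ (S⁻¹(q¹) ⇀ φ ↼ q³)) · (m ⋈ 1_Ĝ)`, with `q = q_δ` and the product of the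
right diagonal crossed product -/
def leftToRight [FiniteDimensional k G] :
    Module.Dual k G ⊗[k] M →ₗ[k] M ⊗[k] Module.Dual k G :=
  TensorProduct.lift
    (D.rightMul.compl₁₂ (spread (H.Sinv.rTensor (M ⊗[k] G) D.qElt)) D.rightIncl)

/-- `m ⋈ φ ↦ (1_Ĝ ⋈ m) · ((p¹ ⇀ φ ↼ S⁻¹(p³)) ⋈ p²)`, with `p = p_δ` and the product of the
left diagonal crossed product -/
def rightToLeft [FiniteDimensional k G] :
    M ⊗[k] Module.Dual k G →ₗ[k] Module.Dual k G ⊗[k] M :=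
  TensorProduct.lift
    (D.leftMul.compl₁₂ D.leftIncl
      ((TensorProduct.comm k M (Module.Dual k G)).toLinearMap ∘ₗ
        spread ((H.Sinv.lTensor M).lTensor G D.pElt)))

end TwoSidedCoaction

/-! ### Algebras given by a bilinear product on a vector space -/

section BilinearProducts

variable {k : Type u} [Field k] {A B : Type*}
  [AddCommGroup A] [Module k A] [AddCommGroup B] [Module k B]

/-- The bilinear product `mul` makes the vector space `A` an associative algebra with
unit `one`. -/
structure IsUnitalAssocAlgebra (mul : A →ₗ[k] A →ₗ[k] A) (one : A) : Prop where
  assoc : ∀ x y z : A, mul (mul x y) z = mul x (mul y z)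
  one_mul : ∀ x : A, mul one x = x
  mul_one : ∀ x : A, mul x one = x

/-- The linear map `f` is a unital algebra map from `(A, mulA, oneA)` to `(B, mulB, oneB)`. -/
structure IsUnitalAlgebraMap (mulA : A →ₗ[k] A →ₗ[k] A) (oneA : A)
    (mulB : B →ₗ[k] B →ₗ[k] B) (oneB : B) (f : A →ₗ[k] B) : Prop where
  map_mul : ∀ x y : A, f (mulA x y) = mulB (f x) (f y)
  map_one : f oneA = oneB

end BilinearProducts

end QuasiHopf

end

/-! The two-sided problem is reduced to a one-sided one. Put `Q = G ⊗ Gᶜᵒᵖ`, a quasi-Hopf algebra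
with antipode `S ⊗ S⁻¹`. Gathering the outer legs of `(δ, Ψ)` in pairs gives a left coaction `λ : M
→ Q ⊗ M` with reassociator `Φ` (`toLeft`). On the other side, `G` is a right `Q`-module through `x ·
(a ⊗ b) = S⁻¹(b) x a`, and with the coproduct `x ↦ h Δ(x)` it is a coalgebra among right `Q`-modules
(`twistedCoalgebra`). An element of `Ĝ ⊗ M` is a linear map `G → M`. Evaluated in this way, the left
product becomes a generalized smash product: `φ ⊗ ψ` is paired with `h Δ(x)` acted on by the
`Q`-legs of `Φ⁻¹ (1 ⊗ λ(m)(1 ⊗ n))`. Its associativity is then formal. The coassociativity defect of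
the coalgebra is `φ⁻¹` of `Q`, and the inverse pentagon of `Φ` together with quasi-coassociativity
of `λ` compensates it (`IsLeftSmash.assoc`).

Two elements govern the comparison with the right product: `q`, the contraction of `Φ⁻¹` by `α`, and
`p`, the contraction of `Φ` by `β`. They satisfy commutation relations with `λ(m)` (`act_q`,
`coAct_p`) and two inversion relations (`act_p_q`, `coAct_q_p`). These four relations say that `f`
and its proposed inverse are mutually inverse.

The explicit formula of Drinfel'd's twist `F` serves to establish the two identities of `IsTwist`
and, separately, its normalization under the counit. For every `F` with these two identities, two
pentagons give the central formula `twist_mul_comul_q`. Written with `Φ = Φ¹ ⊗ Φ² ⊗ Φ³`, it says `F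
Δ(q) = (S(Φ²) ⊗ S(Φ¹) ⊗ 1) q₂ λ₂(Φ³) Φ`, where `q₂ = (1 ⊗ q)(id ⊗ λ)(q)` and `λ₂ = (id ⊗ λ)λ`. This
formula is used three times. Sandwiched with `p`, it gives a left inverse of `F`. Iterated in the
two possible ways, it gives the cocycle identity of `F`, hence that of `h`, which is the
coassociativity of `h Δ`. Applied to the twist of `Q`, it is the multiplicativity of `f`.

The right product uses the coproduct `Δ(x) h⁻¹`, which the twist of `Q` carries to `h Δ(x)`. Its
associativity and unit laws are transported along `f`. The normalization `ε(α) = 1` makes `ε`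
invariant under `S` and makes `h` trivial under `ε` on either leg, so that `ε` is a two-sided
counit. -/

noncomputable section

namespace QuasiHopf

universe u v w

open LinearMap (mul' mulLeft mulRight)

/-! ### Shortcuts for instance search on iterated tensor products -/

section HomClassShortcuts

variable {R A B : Type*} [CommSemiring R]

instance (priority := 2000) linearMap_addHomClass [AddCommMonoid A] [AddCommMonoid B]
    [Module R A] [Module R B] : AddHomClass (A →ₗ[R] B) A B := inferInstance

instance (priority := 2000) linearEquiv_addHomClass [AddCommMonoid A] [AddCommMonoid B]
    [Module R A] [Module R B] : AddHomClass (A ≃ₗ[R] B) A B := inferInstance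

variable [Semiring A] [Semiring B] [Algebra R A] [Algebra R B]

instance (priority := 2000) algHom_addHomClass : AddHomClass (A →ₐ[R] B) A B := inferInstance

instance (priority := 2000) algHom_mulHomClass : MulHomClass (A →ₐ[R] B) A B := inferInstance

instance (priority := 2000) algHom_zeroHomClass : ZeroHomClass (A →ₐ[R] B) A B := inferInstance

instance (priority := 2000) algHom_oneHomClass : OneHomClass (A →ₐ[R] B) A B := inferInstance

end HomClassShortcuts

/-! ### Reduction of identities to pure tensors. -/

section Induction

variable {k : Type u} [Field k] {A B C D E : Type*}
  [AddCommGroup A] [Module k A] [AddCommGroup B] [Module k B] [AddCommGroup C] [Module k C]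
  [AddCommGroup D] [Module k D] [AddCommGroup E] [Module k E]

-- No separate zero case is needed, because `0 = 0 ⊗ 0` is itself a pure tensor.
@[elab_as_elim]
theorem tensor_induction₂ {P : A ⊗[k] B → Prop} (tmul : ∀ a b, P (a ⊗ₜ[k] b))
    (add : ∀ x y, P x → P y → P (x + y)) (x : A ⊗[k] B) : P x := by
  induction x using TensorProduct.induction_on with
  | zero => simpa using tmul 0 0
  | add x y hx hy => exact add x y hx hy
  | tmul a b => exact tmul a b

@[elab_as_elim]
theorem tensor_induction₃ {P : A ⊗[k] (B ⊗[k] C) → Prop}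
    (tmul : ∀ a b c, P (a ⊗ₜ[k] (b ⊗ₜ[k] c))) (add : ∀ x y, P x → P y → P (x + y))
    (x : A ⊗[k] (B ⊗[k] C)) : P x := by
  refine tensor_induction₂ (P := P) (fun a x => ?_) add x
  refine tensor_induction₂ (P := fun x => P (a ⊗ₜ[k] x)) (fun b c => tmul a b c) ?_ x
  intro x y hx hy
  rw [TensorProduct.tmul_add]
  exact add _ _ hx hy

@[elab_as_elim]
theorem tensor_induction₄ {P : A ⊗[k] (B ⊗[k] (C ⊗[k] D)) → Prop}
    (tmul : ∀ a b c d, P (a ⊗ₜ[k] (b ⊗ₜ[k] (c ⊗ₜ[k] d)))) (add : ∀ x y, P x → P y → P (x + y))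
    (x : A ⊗[k] (B ⊗[k] (C ⊗[k] D))) : P x := by
  refine tensor_induction₂ (P := P) (fun a x => ?_) add x
  refine tensor_induction₃ (P := fun x => P (a ⊗ₜ[k] x)) (fun b c d => tmul a b c d) ?_ x
  intro x y hx hy
  rw [TensorProduct.tmul_add]
  exact add _ _ hx hy

@[elab_as_elim]
theorem tensor_induction₅ {P : A ⊗[k] (B ⊗[k] (C ⊗[k] (D ⊗[k] E))) → Prop}
    (tmul : ∀ a b c d e, P (a ⊗ₜ[k] (b ⊗ₜ[k] (c ⊗ₜ[k] (d ⊗ₜ[k] e)))))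
    (add : ∀ x y, P x → P y → P (x + y))
    (x : A ⊗[k] (B ⊗[k] (C ⊗[k] (D ⊗[k] E)))) : P x := by
  refine tensor_induction₂ (P := P) (fun a x => ?_) add x
  refine tensor_induction₄ (P := fun x => P (a ⊗ₜ[k] x)) (fun b c d e => tmul a b c d e) ?_ x
  intro x y hx hy
  rw [TensorProduct.tmul_add]
  exact add _ _ hx hy

end Induction

/-! ### Algebra maps acting on single tensor legs. -/

section LegLemmas

variable {k : Type u} [Field k]
variable {A A₁ A₂ A₃ B B' C C' : Type*}
  [Ring A] [Algebra k A] [Ring A₁] [Algebra k A₁] [Ring A₂] [Algebra k A₂]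
  [Ring A₃] [Algebra k A₃] [Ring B] [Algebra k B] [Ring B'] [Algebra k B']
  [Ring C] [Algebra k C] [Ring C'] [Algebra k C']

@[simp] theorem tail_tmul (g : B →ₐ[k] B') (a : A) (b : B) :
    tail A g (a ⊗ₜ[k] b) = a ⊗ₜ[k] g b := rfl

theorem head2_tmul (g : A →ₐ[k] A₁ ⊗[k] A₂) (a : A) (b : B) :
    head2 B g (a ⊗ₜ[k] b) = TensorProduct.assoc k A₁ A₂ B (g a ⊗ₜ[k] b) := rfl

@[simp] theorem dropHead_tmul (c : A →ₐ[k] k) (a : A) (b : B) :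
    dropHead B c (a ⊗ₜ[k] b) = c a • b := by simp [dropHead]

@[simp] theorem dropTail_tmul (c : B →ₐ[k] k) (a : A) (b : B) :
    dropTail A c (a ⊗ₜ[k] b) = c b • a := by simp [dropTail]

@[simp] theorem appendOne_apply (a : A) : appendOne A B a = a ⊗ₜ[k] (1 : B) := rfl

theorem tail_tail_apply {D : Type*} [Ring D] [Algebra k D] (g : B' →ₐ[k] D) (f : B →ₐ[k] B')
    (x : A ⊗[k] B) : tail A g (tail A f x) = tail A (g.comp f) x := by
  induction x using tensor_induction₂ with
  | add x y hx hy => simp only [map_add, hx, hy]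
  | tmul a b => rfl

theorem tail_comp {D : Type*} [Ring D] [Algebra k D] (g : B' →ₐ[k] D) (f : B →ₐ[k] B') :
    (tail A g).comp (tail A f) = tail A (g.comp f) := by
  ext1
  · ext; simp
  · ext; simp [tail]

theorem head2_one_tmul (g : A →ₐ[k] A₁ ⊗[k] A₂) (b : B) :
    head2 B g ((1 : A) ⊗ₜ[k] b) = 1 ⊗ₜ[k] (1 ⊗ₜ[k] b) := by
  rw [head2_tmul, map_one]; rfl

variable (k) in
/-- reassociation as an algebra isomorphism -/
abbrev asc (A₁ A₂ B : Type*) [Ring A₁] [Algebra k A₁] [Ring A₂] [Algebra k A₂]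
    [Ring B] [Algebra k B] : (A₁ ⊗[k] A₂) ⊗[k] B ≃ₐ[k] A₁ ⊗[k] (A₂ ⊗[k] B) :=
  Algebra.TensorProduct.assoc k k k A₁ A₂ B

theorem head2_tmul' (g : A →ₐ[k] A₁ ⊗[k] A₂) (a : A) (b : B) :
    head2 B g (a ⊗ₜ[k] b) = asc k A₁ A₂ B (g a ⊗ₜ[k] b) := rfl

@[simp] theorem asc_tmul (a : A₁) (b : A₂) (c : B) :
    asc k A₁ A₂ B ((a ⊗ₜ[k] b) ⊗ₜ[k] c) = a ⊗ₜ[k] (b ⊗ₜ[k] c) := rfl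

theorem asc_mul (x y : (A₁ ⊗[k] A₂)) (b c : B) :
    asc k A₁ A₂ B (x ⊗ₜ[k] b) * asc k A₁ A₂ B (y ⊗ₜ[k] c) =
      asc k A₁ A₂ B ((x * y) ⊗ₜ[k] (b * c)) := by
  rw [← map_mul, Algebra.TensorProduct.tmul_mul_tmul]

theorem tail_tail_asc (g : B →ₐ[k] B') (y : A₁ ⊗[k] A₂) (b : B) :
    tail A₁ (tail A₂ g) (asc k A₁ A₂ B (y ⊗ₜ[k] b)) =
      asc k A₁ A₂ B' (y ⊗ₜ[k] g b) := by
  induction y using tensor_induction₂ with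
  | add x y hx hy => simp only [map_add, TensorProduct.add_tmul, hx, hy]
  | tmul a c => rfl

/-- Naturality of `head2` in the untouched factor. -/
theorem tail_tail_head2 (g : B →ₐ[k] B') (f : A →ₐ[k] A₁ ⊗[k] A₂) (x : A ⊗[k] B) :
    tail A₁ (tail A₂ g) (head2 B f x) = head2 B' f (tail A g x) := by
  induction x using tensor_induction₂ with
  | add x y hx hy => simp only [map_add, hx, hy]
  | tmul a c => rw [head2_tmul', tail_tail_asc, tail_tmul, head2_tmul']

variable (k) in
/-- reassociation `(A₁ ⊗ (A₂ ⊗ A₃)) ⊗ B → A₁ ⊗ (A₂ ⊗ (A₃ ⊗ B))` -/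
def asc3 (A₁ A₂ A₃ B : Type*) [Ring A₁] [Algebra k A₁] [Ring A₂] [Algebra k A₂]
    [Ring A₃] [Algebra k A₃] [Ring B] [Algebra k B] :
    (A₁ ⊗[k] (A₂ ⊗[k] A₃)) ⊗[k] B →ₐ[k] A₁ ⊗[k] (A₂ ⊗[k] (A₃ ⊗[k] B)) :=
  (tail A₁ (asc k A₂ A₃ B).toAlgHom).comp (asc k A₁ (A₂ ⊗[k] A₃) B).toAlgHom

@[simp] theorem asc3_tmul (a : A₁) (b : A₂) (c : A₃) (d : B) :
    asc3 k A₁ A₂ A₃ B ((a ⊗ₜ[k] (b ⊗ₜ[k] c)) ⊗ₜ[k] d) =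
      a ⊗ₜ[k] (b ⊗ₜ[k] (c ⊗ₜ[k] d)) := rfl

theorem head3_tmul' (g : A →ₐ[k] A₁ ⊗[k] (A₂ ⊗[k] A₃)) (a : A) (b : B) :
    head3 B g (a ⊗ₜ[k] b) = asc3 k A₁ A₂ A₃ B (g a ⊗ₜ[k] b) := rfl

theorem asc3_tmul_one (t : A₁ ⊗[k] (A₂ ⊗[k] A₃)) :
    asc3 k A₁ A₂ A₃ B (t ⊗ₜ[k] 1) = tail A₁ (tail A₂ (appendOne A₃ B)) t := by
  induction t using tensor_induction₃ with
  | tmul a b c => rfl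
  | add x y hx hy => simp only [map_add, TensorProduct.add_tmul, hx, hy]

/-- Together with `head3_eq'` this expresses both iterated coproducts on the first leg as one
threefold splitting, so that quasi-coassociativity can be applied beside a spectator factor. -/
theorem head3_eq (f : A₂ →ₐ[k] A₃ ⊗[k] B') (g : A →ₐ[k] A₁ ⊗[k] A₂) (x : A ⊗[k] B) :
    tail A₁ (head2 B f) (head2 B g x) = head3 B ((tail A₁ f).comp g) x := by
  induction x using tensor_induction₂ with
  | add x y hx hy => simp only [map_add, hx, hy]
  | tmul a c =>
    rw [head2_tmul', head3_tmul', AlgHom.comp_apply]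
    generalize g a = y
    induction y using tensor_induction₂ with
    | add x y hx hy => simp only [map_add, TensorProduct.add_tmul, hx, hy]
    | tmul a b => rfl

theorem head3_eq' (f : A₁ →ₐ[k] A₃ ⊗[k] B') (g : A →ₐ[k] A₁ ⊗[k] A₂) (x : A ⊗[k] B) :
    head2 (A₂ ⊗[k] B) f (head2 B g x) = head3 B ((head2 A₂ f).comp g) x := by
  induction x using tensor_induction₂ with
  | add x y hx hy => simp only [map_add, hx, hy]
  | tmul a c =>
    rw [head2_tmul', head3_tmul', AlgHom.comp_apply]
    generalize g a = y
    induction y using tensor_induction₂ with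
    | add x y hx hy => simp only [map_add, TensorProduct.add_tmul, hx, hy]
    | tmul a b =>
      rw [asc_tmul, head2_tmul', head2_tmul']
      generalize f a = y
      induction y using tensor_induction₂ with
      | add x y hx hy => simp only [map_add, TensorProduct.add_tmul, hx, hy]
      | tmul a b => rfl

/-- An intertwiner on three legs remains one after the spectator `B` is attached, since `t ⊗ 1`
commutes with everything in `B`. -/
theorem head3_conj (t : A₁ ⊗[k] (A₂ ⊗[k] A₃)) (g g' : A →ₐ[k] A₁ ⊗[k] (A₂ ⊗[k] A₃))
    (h : ∀ a, g a * t = t * g' a) (x : A ⊗[k] B) :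
    head3 B g x * tail A₁ (tail A₂ (appendOne A₃ B)) t =
      tail A₁ (tail A₂ (appendOne A₃ B)) t * head3 B g' x := by
  induction x using tensor_induction₂ with
  | add x y hx hy => simp only [map_add, add_mul, mul_add, hx, hy]
  | tmul a c =>
    rw [← asc3_tmul_one, head3_tmul', head3_tmul', ← map_mul, ← map_mul,
      Algebra.TensorProduct.tmul_mul_tmul, Algebra.TensorProduct.tmul_mul_tmul, h, one_mul, mul_one]

/-- Elements on disjoint factors commute. -/
theorem tail_tail_mul_comm (X : A ⊗[k] (B ⊗[k] A₁)) (j j' : A₁ →ₐ[k] C) (t : C)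
    (h : ∀ a, t * j a = j' a * t) :
    ((1 : A) ⊗ₜ[k] ((1 : B) ⊗ₜ[k] t)) * tail A (tail B j) X =
      tail A (tail B j') X * ((1 : A) ⊗ₜ[k] ((1 : B) ⊗ₜ[k] t)) := by
  induction X using tensor_induction₃ with
  | tmul a b c => simp [h]
  | add x y hx hy => simp only [map_add, mul_add, add_mul, hx, hy]

end LegLemmas

/-! ### One-sided coactions. -/

/-- The part of the structure of a quasi-Hopf algebra which enters the construction of crossed
products by comodule algebras. -/
structure QuasiHopfCore (k : Type u) [Field k] (Q : Type v) [Ring Q] [Algebra k Q] where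
  comul : Q →ₐ[k] Q ⊗[k] Q
  counit : Q →ₐ[k] k
  phi : (Q ⊗[k] (Q ⊗[k] Q))ˣ
  quasi_coassoc : ∀ a : Q,
    tail Q comul (comul a) * phi.val = phi.val * head2 Q comul (comul a)
  counit_left : ∀ a : Q, dropHead Q counit (comul a) = a
  antipode : Q ≃ₗ[k] Q
  alpha : Q
  beta : Q
  antipode_one : antipode 1 = 1
  antipode_mul : ∀ a b : Q, antipode (a * b) = antipode b * antipode a
  antipode_alpha : ∀ a : Q,
    mul' k Q (TensorProduct.map antipode.toLinearMap (mulLeft k alpha) (comul a)) =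
      counit a • alpha
  antipode_beta : ∀ a : Q,
    mul' k Q (TensorProduct.map (mulRight k beta) antipode.toLinearMap (comul a)) =
      counit a • beta
  antipode_phi :
    (mul' k Q ∘ₗ TensorProduct.map (mulRight k beta)
      (mul' k Q ∘ₗ TensorProduct.map (mulRight k alpha ∘ₗ antipode.toLinearMap) LinearMap.id))
        phi.val = 1
  antipode_phi_inv :
    (mul' k Q ∘ₗ TensorProduct.map (mulRight k alpha ∘ₗ antipode.toLinearMap)
      (mul' k Q ∘ₗ TensorProduct.map (mulRight k beta) antipode.toLinearMap))
        (phi⁻¹).val = 1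

/-- `φ ⊗ 1` -/
abbrev padOne {k : Type u} [Field k] {A B C : Type*} [Ring A] [Algebra k A] [Ring B] [Algebra k B]
    [Ring C] [Algebra k C] (M : Type*) [Ring M] [Algebra k M] :
    A ⊗[k] (B ⊗[k] C) →ₐ[k] A ⊗[k] (B ⊗[k] (C ⊗[k] M)) :=
  tail A (tail B (appendOne C M))

/-- A left comodule algebra `(M, λ, Φ)`. -/
structure LeftCoaction {k : Type u} [Field k] {Q : Type v} [Ring Q] [Algebra k Q]
    (H : QuasiHopfCore k Q) (M : Type w) [Ring M] [Algebra k M] where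
  coact : M →ₐ[k] Q ⊗[k] M
  Phi : (Q ⊗[k] (Q ⊗[k] M))ˣ
  quasi_coassoc : ∀ m : M,
    tail Q coact (coact m) * Phi.val = Phi.val * head2 M H.comul (coact m)
  pentagon :
    ((1 : Q) ⊗ₜ[k] Phi.val) * tail Q (head2 M H.comul) Phi.val * padOne M H.phi.val =
      tail Q (tail Q coact) Phi.val * head2 (Q ⊗[k] M) H.comul Phi.val
  counit_coact : ∀ m : M, dropHead M H.counit (coact m) = m
  counit_inner : tail Q (dropHead M H.counit) Phi.val = 1
  counit_outer : dropHead (Q ⊗[k] M) H.counit Phi.val = 1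

/-! ### Contractions of two legs against `α`. -/

namespace QuasiHopfCore

variable {k : Type u} [Field k] {Q : Type v} [Ring Q] [Algebra k Q] (H : QuasiHopfCore k Q)
variable (M : Type w) [Ring M] [Algebra k M]

def S : Q →ₗ[k] Q := H.antipode.toLinearMap

def Sinv : Q →ₗ[k] Q := H.antipode.symm.toLinearMap

theorem S_mul (a b : Q) : H.S (a * b) = H.S b * H.S a := H.antipode_mul a b

@[simp] theorem S_one : H.S 1 = 1 := H.antipode_one

@[simp] theorem S_Sinv (a : Q) : H.S (H.Sinv a) = a := H.antipode.apply_symm_apply a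

@[simp] theorem Sinv_S (a : Q) : H.Sinv (H.S a) = a := H.antipode.symm_apply_apply a

theorem Sinv_mul (a b : Q) : H.Sinv (a * b) = H.Sinv b * H.Sinv a := by
  apply H.antipode.injective
  change H.S (H.Sinv (a * b)) = H.S _
  rw [S_mul]; simp

@[simp] theorem Sinv_one : H.Sinv 1 = 1 := by
  apply H.antipode.injective
  change H.S (H.Sinv 1) = H.S _
  simp

/-- `a ⊗ b ↦ S(a) α b` -/
def ev : Q ⊗[k] Q →ₗ[k] Q :=
  mul' k Q ∘ₗ TensorProduct.map (mulRight k H.alpha ∘ₗ H.S) LinearMap.id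

@[simp] theorem ev_tmul (a b : Q) : H.ev (a ⊗ₜ[k] b) = H.S a * H.alpha * b := by
  simp [ev]

theorem ev_comul (a : Q) : H.ev (H.comul a) = H.counit a • H.alpha := by
  rw [← H.antipode_alpha]
  generalize H.comul a = y
  induction y using tensor_induction₂ with
  | add x y hx hy => simp only [map_add, hx, hy]
  | tmul a b => simp [S, mul_assoc]

theorem ev_mul_tmul (y : Q ⊗[k] Q) (a b : Q) :
    H.ev (y * (a ⊗ₜ[k] b)) = H.S a * H.ev y * b := by
  induction y using tensor_induction₂ with
  | add x y hx hy => simp only [map_add, hx, hy, add_mul, mul_add]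
  | tmul a b => simp [S_mul, mul_assoc]

/-- `a ⊗ b ⊗ m ↦ S(a) α b ⊗ m` -/
def contract : Q ⊗[k] (Q ⊗[k] M) →ₗ[k] Q ⊗[k] M :=
  H.ev.rTensor M ∘ₗ (TensorProduct.assoc k Q Q M).symm.toLinearMap

variable {M}

@[simp] theorem contract_tmul (a b : Q) (m : M) :
    H.contract M (a ⊗ₜ[k] (b ⊗ₜ[k] m)) = (H.S a * H.alpha * b) ⊗ₜ[k] m := by
  simp [contract]

theorem contract_asc (y : Q ⊗[k] Q) (m : M) :
    H.contract M (asc k Q Q M (y ⊗ₜ[k] m)) = H.ev y ⊗ₜ[k] m := by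
  induction y using tensor_induction₂ with
  | add x y hx hy => simp only [map_add, hx, hy, TensorProduct.add_tmul]
  | tmul a b => simp

theorem contract_mul (t : Q ⊗[k] (Q ⊗[k] M)) (a : Q) (y : Q ⊗[k] M) :
    H.contract M (t * (a ⊗ₜ[k] y)) = (H.S a ⊗ₜ[k] 1) * H.contract M t * y := by
  induction t using tensor_induction₃ with
  | tmul b c m =>
    induction y using tensor_induction₂ with
    | add x y hx hy => simp only [map_add, hx, hy, mul_add, TensorProduct.tmul_add]
    | tmul d n => simp [S_mul, mul_assoc]
  | add x y hx hy => simp only [map_add, hx, hy, add_mul, mul_add]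

/-- Since `S` reverses products, the legs of `Δ(a)` standing on the left of `t` end up next to `α`,
where `S(a₁) α a₂ = ε(a) α` removes them. -/
theorem contract_comul_mul (s : Q ⊗[k] M) (t : Q ⊗[k] (Q ⊗[k] M)) :
    H.contract M (head2 M H.comul s * t) =
      ((1 : Q) ⊗ₜ[k] dropHead M H.counit s) * H.contract M t := by
  induction s using tensor_induction₂ with
  | add x y hx hy => simp only [map_add, hx, hy, add_mul, TensorProduct.tmul_add]
  | tmul a m =>
    induction t using tensor_induction₃ with
    | tmul b c n =>
      rw [← asc_tmul, head2_tmul', ← map_mul, Algebra.TensorProduct.tmul_mul_tmul, contract_asc,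
        contract_asc, ev_mul_tmul, ev_comul, ev_tmul]
      simp [TensorProduct.smul_tmul]
    | add x y hx hy => simp only [map_add, hx, hy, mul_add]

variable (M)

/-- `a ⊗ b ⊗ c ⊗ d ⊗ m ↦ S(b) α c ⊗ S(a) α d ⊗ m` -/
def contract₂ : Q ⊗[k] (Q ⊗[k] (Q ⊗[k] (Q ⊗[k] M))) →ₗ[k] Q ⊗[k] (Q ⊗[k] M) :=
  (H.contract M).lTensor Q ∘ₗ (TensorProduct.leftComm k Q Q (Q ⊗[k] M)).toLinearMap ∘ₗ
    (H.contract (Q ⊗[k] M)).lTensor Q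

variable {M}

theorem contract₂_tmul (a : Q) (t : Q ⊗[k] (Q ⊗[k] (Q ⊗[k] M))) :
    H.contract₂ M (a ⊗ₜ[k] t) = (H.contract M).lTensor Q
      (TensorProduct.leftComm k Q Q (Q ⊗[k] M) (a ⊗ₜ[k] H.contract (Q ⊗[k] M) t)) := rfl

@[simp] theorem contract₂_tmul' (a b c d : Q) (m : M) :
    H.contract₂ M (a ⊗ₜ[k] (b ⊗ₜ[k] (c ⊗ₜ[k] (d ⊗ₜ[k] m)))) =
      (H.S b * H.alpha * c) ⊗ₜ[k] ((H.S a * H.alpha * d) ⊗ₜ[k] m) := by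
  simp [contract₂_tmul]

theorem contract₂_tmul'' (a b c : Q) (y : Q ⊗[k] M) :
    H.contract₂ M (a ⊗ₜ[k] (b ⊗ₜ[k] (c ⊗ₜ[k] y))) =
      (H.S b * H.alpha * c) ⊗ₜ[k] H.contract M (a ⊗ₜ[k] y) := by
  simp [contract₂_tmul]

theorem contract₂_mul (t : Q ⊗[k] (Q ⊗[k] (Q ⊗[k] (Q ⊗[k] M)))) (a b : Q)
    (y : Q ⊗[k] (Q ⊗[k] M)) :
    H.contract₂ M (t * (a ⊗ₜ[k] (b ⊗ₜ[k] y))) =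
      (H.S b ⊗ₜ[k] (H.S a ⊗ₜ[k] 1)) * H.contract₂ M t * y := by
  induction t using tensor_induction₂ with
  | add x y hx hy => simp only [map_add, hx, hy, add_mul, mul_add]
  | tmul a' t =>
    rw [Algebra.TensorProduct.tmul_mul_tmul, contract₂_tmul, contract₂_tmul, contract_mul]
    generalize H.contract (Q ⊗[k] M) t = s
    induction s using tensor_induction₂ with
    | add x y hx hy => simp only [map_add, hx, hy, add_mul, mul_add, TensorProduct.tmul_add]
    | tmul c s =>
      induction y using tensor_induction₂ with
      | add x y hx hy => simp only [map_add, hx, hy, mul_add, TensorProduct.tmul_add]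
      | tmul d n =>
        simp [← contract_mul]

/-- `a ⊗ y ↦ a ⊗ 1 ⊗ 1 ⊗ y` -/
def insertOnes (Q : Type v) [Ring Q] [Algebra k Q] (N : Type*) [Ring N] [Algebra k N] :
    Q ⊗[k] N →ₐ[k] Q ⊗[k] (Q ⊗[k] (Q ⊗[k] N)) :=
  tail Q ((Algebra.TensorProduct.includeRight (R := k) (A := Q) (B := Q ⊗[k] N)).comp
    (Algebra.TensorProduct.includeRight (R := k) (A := Q) (B := N)))

@[simp] theorem insertOnes_tmul (a : Q) {N : Type*} [Ring N] [Algebra k N] (y : N) :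
    insertOnes (k := k) Q N (a ⊗ₜ[k] y) = a ⊗ₜ[k] (1 ⊗ₜ[k] (1 ⊗ₜ[k] y)) := rfl

/-- The coproduct occupies legs two and three, which `contract₂` contracts with each other; it
therefore collapses to the counit, and units take its place. -/
theorem contract₂_comul_mul (r : Q ⊗[k] (Q ⊗[k] (Q ⊗[k] M)))
    (t : Q ⊗[k] (Q ⊗[k] (Q ⊗[k] (Q ⊗[k] M)))) :
    H.contract₂ M (tail Q (head2 (Q ⊗[k] M) H.comul) r * t) =
      H.contract₂ M (insertOnes Q (Q ⊗[k] M) (tail Q (dropHead (Q ⊗[k] M) H.counit) r) * t) := by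
  induction r using tensor_induction₂ with
  | add x y hx hy => simp only [map_add, hx, hy, add_mul]
  | tmul a r =>
    induction t using tensor_induction₂ with
    | add x y hx hy => simp only [map_add, hx, hy, mul_add]
    | tmul b t =>
      simp only [tail_tmul, insertOnes_tmul, Algebra.TensorProduct.tmul_mul_tmul, contract₂_tmul,
        contract_comul_mul]
      congr 3
      generalize dropHead (Q ⊗[k] M) H.counit r = s
      induction t using tensor_induction₃ with
      | tmul c d n => simp
      | add x y hx hy => simp only [map_add, hx, hy, mul_add]

end QuasiHopfCore

/-! ### Two-sided multiplication operators. -/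

section Sandwich

variable {k : Type u} [Field k] {T M R R' : Type*} [Ring T] [Algebra k T] [Ring M] [Algebra k M]
  [Ring R] [Algebra k R] [Ring R'] [Algebra k R']

/-- `t ⊗ m ↦ (W ↦ σ(t) W j(m))` -/
def sandwich (σ : T →ₗ[k] R) (j : M →ₐ[k] R) : T ⊗[k] M →ₗ[k] R →ₗ[k] R :=
  TensorProduct.lift (LinearMap.mk₂ k (fun t m => mulRight k (j m) ∘ₗ mulLeft k (σ t))
    (fun _ _ _ => by ext; simp [add_mul]) (fun _ _ _ => by ext; simp)
    (fun _ _ _ => by ext; simp [mul_add]) (fun _ _ _ => by ext; simp))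

@[simp] theorem sandwich_tmul (σ : T →ₗ[k] R) (j : M →ₐ[k] R) (t : T) (m : M) (W : R) :
    sandwich σ j (t ⊗ₜ[k] m) W = σ t * W * j m := rfl

/-- An anti-multiplicative left factor and a multiplicative right factor combine into a right action
of `T ⊗ M`. -/
theorem sandwich_mul (σ : T →ₗ[k] R) (hσ : ∀ a b, σ (a * b) = σ b * σ a) (j : M →ₐ[k] R)
    (s t : T ⊗[k] M) (W : R) :
    sandwich σ j (s * t) W = sandwich σ j t (sandwich σ j s W) := by
  induction s using tensor_induction₂ with
  | add x y hx hy => simp only [map_add, hx, hy, add_mul, LinearMap.add_apply]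
  | tmul a m =>
    induction t using tensor_induction₂ with
    | add x y hx hy => simp only [map_add, hx, hy, mul_add, LinearMap.add_apply]
    | tmul b n => simp [hσ, mul_assoc]

/-- An element intertwining two embeddings of `M` can be pulled out on the right, at the price of
exchanging the embeddings. In the applications the intertwiner is built from `Φ`. -/
theorem sandwich_mul_right (σ : T →ₗ[k] R) (j j' : M →ₐ[k] R) (X : R)
    (h : ∀ m, X * j' m = j m * X) (t : T ⊗[k] M) (W : R) :
    sandwich σ j' t (W * X) = sandwich σ j t W * X := by
  induction t using tensor_induction₂ with
  | add x y hx hy => simp only [map_add, hx, hy, add_mul, LinearMap.add_apply]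
  | tmul b n => simp [mul_assoc, h]

end Sandwich

namespace QuasiHopfCore

variable {k : Type u} [Field k] {Q : Type v} [Ring Q] [Algebra k Q] (H : QuasiHopfCore k Q)
variable {M : Type w} [Ring M] [Algebra k M]

/-- `a ⊗ b ↦ S(b) ⊗ S(a)` -/
def flipS : Q ⊗[k] Q →ₗ[k] Q ⊗[k] Q :=
  TensorProduct.map H.S H.S ∘ₗ (TensorProduct.comm k Q Q).toLinearMap

@[simp] theorem flipS_tmul (a b : Q) : H.flipS (a ⊗ₜ[k] b) = H.S b ⊗ₜ[k] H.S a := rfl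

theorem flipS_mul (x y : Q ⊗[k] Q) : H.flipS (x * y) = H.flipS y * H.flipS x := by
  induction x using tensor_induction₂ with
  | add x y hx hy => simp only [map_add, hx, hy, add_mul, mul_add]
  | tmul a m =>
    induction y using tensor_induction₂ with
    | add x y hx hy => simp only [map_add, hx, hy, mul_add, add_mul]
    | tmul b n => simp [S_mul]

@[simp] theorem flipS_one : H.flipS 1 = 1 := by
  rw [Algebra.TensorProduct.one_def, flipS_tmul, S_one]

/-- `a ⊗ b ⊗ c ↦ S(c) ⊗ S(b) ⊗ S(a)` -/
def flipS₃ : Q ⊗[k] (Q ⊗[k] Q) →ₗ[k] Q ⊗[k] (Q ⊗[k] Q) :=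
  (TensorProduct.assoc k Q Q Q).toLinearMap ∘ₗ TensorProduct.map H.flipS H.S ∘ₗ
    (TensorProduct.comm k Q (Q ⊗[k] Q)).toLinearMap

theorem flipS₃_tmul (a : Q) (y : Q ⊗[k] Q) :
    H.flipS₃ (a ⊗ₜ[k] y) = asc k Q Q Q (H.flipS y ⊗ₜ[k] H.S a) := rfl

@[simp] theorem flipS₃_tmul' (a b c : Q) :
    H.flipS₃ (a ⊗ₜ[k] (b ⊗ₜ[k] c)) = H.S c ⊗ₜ[k] (H.S b ⊗ₜ[k] H.S a) := rfl

theorem flipS₃_mul (x y : Q ⊗[k] (Q ⊗[k] Q)) :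
    H.flipS₃ (x * y) = H.flipS₃ y * H.flipS₃ x := by
  induction x using tensor_induction₂ with
  | add x y hx hy => simp only [map_add, hx, hy, add_mul, mul_add]
  | tmul a m =>
    induction y using tensor_induction₂ with
    | add x y hx hy => simp only [map_add, hx, hy, mul_add, add_mul]
    | tmul b n =>
      rw [Algebra.TensorProduct.tmul_mul_tmul, flipS₃_tmul, flipS₃_tmul, flipS₃_tmul, asc_mul,
        S_mul, flipS_mul]

/-- `(a ⊗ m, W) ↦ (S(a) ⊗ 1) W j(m)` -/
def act₁ (j : M →ₐ[k] Q ⊗[k] M) : Q ⊗[k] M →ₗ[k] Q ⊗[k] M →ₗ[k] Q ⊗[k] M :=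
  sandwich ((Algebra.TensorProduct.includeLeft (R := k) (S := k) (A := Q) (B := M)).toLinearMap ∘ₗ
    H.S) j

@[simp] theorem act₁_tmul (j : M →ₐ[k] Q ⊗[k] M) (a : Q) (m : M) (W : Q ⊗[k] M) :
    H.act₁ j (a ⊗ₜ[k] m) W = (H.S a ⊗ₜ[k] 1) * W * j m := rfl

/-- `x ↦ flipS(x) ⊗ 1` -/
def leg₂ (M : Type w) [Ring M] [Algebra k M] : Q ⊗[k] Q →ₗ[k] Q ⊗[k] (Q ⊗[k] M) :=
  (tail Q (appendOne Q M)).toLinearMap ∘ₗ H.flipS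

theorem leg₂_mul (x y : Q ⊗[k] Q) : H.leg₂ M (x * y) = H.leg₂ M y * H.leg₂ M x := by
  simp [leg₂, flipS_mul]

/-- `(a ⊗ b ⊗ m, W) ↦ (S(b) ⊗ S(a) ⊗ 1) W j(m)` -/
def act₂ (j : M →ₐ[k] Q ⊗[k] (Q ⊗[k] M)) :
    Q ⊗[k] (Q ⊗[k] M) →ₗ[k] Q ⊗[k] (Q ⊗[k] M) →ₗ[k] Q ⊗[k] (Q ⊗[k] M) :=
  sandwich (H.leg₂ M) j ∘ₗ (asc k Q Q M).symm.toLinearMap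

@[simp] theorem act₂_tmul (j : M →ₐ[k] Q ⊗[k] (Q ⊗[k] M)) (a b : Q) (m : M)
    (W : Q ⊗[k] (Q ⊗[k] M)) :
    H.act₂ j (a ⊗ₜ[k] (b ⊗ₜ[k] m)) W =
      (H.S b ⊗ₜ[k] (H.S a ⊗ₜ[k] 1)) * W * j m := rfl

theorem act₂_mul (j : M →ₐ[k] Q ⊗[k] (Q ⊗[k] M)) (s t W : Q ⊗[k] (Q ⊗[k] M)) :
    H.act₂ j (s * t) W = H.act₂ j t (H.act₂ j s W) := by
  simp only [act₂, LinearMap.comp_apply, AlgEquiv.toLinearMap_apply, map_mul]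
  exact sandwich_mul _ H.leg₂_mul _ _ _ _

theorem act₂_mul_right (j j' : M →ₐ[k] Q ⊗[k] (Q ⊗[k] M)) (X : Q ⊗[k] (Q ⊗[k] M))
    (h : ∀ m, X * j' m = j m * X) (t W : Q ⊗[k] (Q ⊗[k] M)) :
    H.act₂ j' t (W * X) = H.act₂ j t W * X :=
  sandwich_mul_right _ _ _ _ h _ _

/-- `x ↦ flipS₃(x) ⊗ 1` -/
def leg₃ (M : Type w) [Ring M] [Algebra k M] :
    Q ⊗[k] (Q ⊗[k] Q) →ₗ[k] Q ⊗[k] (Q ⊗[k] (Q ⊗[k] M)) :=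
  (padOne M).toLinearMap ∘ₗ H.flipS₃

theorem leg₃_mul (x y : Q ⊗[k] (Q ⊗[k] Q)) : H.leg₃ M (x * y) = H.leg₃ M y * H.leg₃ M x := by
  simp [leg₃, flipS₃_mul]

/-- `(Q ⊗ (Q ⊗ Q)) ⊗ M ≃ Q ⊗ (Q ⊗ (Q ⊗ M))` -/
def ascEquiv₃ (k : Type u) [Field k] (Q : Type v) [Ring Q] [Algebra k Q] (M : Type w) [Ring M]
    [Algebra k M] : (Q ⊗[k] (Q ⊗[k] Q)) ⊗[k] M ≃ₐ[k] Q ⊗[k] (Q ⊗[k] (Q ⊗[k] M)) :=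
  (asc k Q (Q ⊗[k] Q) M).trans
    (Algebra.TensorProduct.congr AlgEquiv.refl (asc k Q Q M))

theorem ascEquiv₃_apply (x : (Q ⊗[k] (Q ⊗[k] Q)) ⊗[k] M) :
    ascEquiv₃ k Q M x = asc3 k Q Q Q M x := rfl

/-- `(a ⊗ b ⊗ c ⊗ m, W) ↦ (S(c) ⊗ S(b) ⊗ S(a) ⊗ 1) W j(m)` -/
def act₃ (j : M →ₐ[k] Q ⊗[k] (Q ⊗[k] (Q ⊗[k] M))) :
    Q ⊗[k] (Q ⊗[k] (Q ⊗[k] M)) →ₗ[k]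
      Q ⊗[k] (Q ⊗[k] (Q ⊗[k] M)) →ₗ[k] Q ⊗[k] (Q ⊗[k] (Q ⊗[k] M)) :=
  sandwich (H.leg₃ M) j ∘ₗ (ascEquiv₃ k Q M).symm.toLinearMap

theorem act₃_asc (j : M →ₐ[k] Q ⊗[k] (Q ⊗[k] (Q ⊗[k] M))) (x : Q ⊗[k] (Q ⊗[k] Q)) (m : M)
    (W : Q ⊗[k] (Q ⊗[k] (Q ⊗[k] M))) :
    H.act₃ j (asc3 k Q Q Q M (x ⊗ₜ[k] m)) W = padOne M (H.flipS₃ x) * W * j m := by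
  rw [← ascEquiv₃_apply]
  simp [act₃, leg₃]

@[simp] theorem act₃_tmul (j : M →ₐ[k] Q ⊗[k] (Q ⊗[k] (Q ⊗[k] M))) (a b c : Q) (m : M)
    (W : Q ⊗[k] (Q ⊗[k] (Q ⊗[k] M))) :
    H.act₃ j (a ⊗ₜ[k] (b ⊗ₜ[k] (c ⊗ₜ[k] m))) W =
      (H.S c ⊗ₜ[k] (H.S b ⊗ₜ[k] (H.S a ⊗ₜ[k] 1))) * W * j m := by
  rw [← asc3_tmul, act₃_asc]; simp

theorem act₃_mul (j : M →ₐ[k] Q ⊗[k] (Q ⊗[k] (Q ⊗[k] M)))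
    (s t W : Q ⊗[k] (Q ⊗[k] (Q ⊗[k] M))) :
    H.act₃ j (s * t) W = H.act₃ j t (H.act₃ j s W) := by
  simp only [act₃, LinearMap.comp_apply, AlgEquiv.toLinearMap_apply, map_mul]
  exact sandwich_mul _ H.leg₃_mul _ _ _ _

theorem act₃_mul_right (j j' : M →ₐ[k] Q ⊗[k] (Q ⊗[k] (Q ⊗[k] M)))
    (X : Q ⊗[k] (Q ⊗[k] (Q ⊗[k] M)))
    (h : ∀ m, X * j' m = j m * X) (t W : Q ⊗[k] (Q ⊗[k] (Q ⊗[k] M))) :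
    H.act₃ j' t (W * X) = H.act₃ j t W * X :=
  sandwich_mul_right _ _ _ _ h _ _

end QuasiHopfCore

/-! ### The element `q` and its coproduct. -/

namespace LeftCoaction

variable {k : Type u} [Field k] {Q : Type v} [Ring Q] [Algebra k Q] {H : QuasiHopfCore k Q}
variable {M : Type w} [Ring M] [Algebra k M] (L : LeftCoaction H M)

/-- `(id ⊗ λ) λ` -/
def coact₂ : M →ₐ[k] Q ⊗[k] (Q ⊗[k] M) := (tail Q L.coact).comp L.coact

theorem coact₂_apply (m : M) : L.coact₂ m = tail Q L.coact (L.coact m) := rfl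

/-- `(id ⊗ id ⊗ λ) (id ⊗ λ) λ` -/
def coact₃ : M →ₐ[k] Q ⊗[k] (Q ⊗[k] (Q ⊗[k] M)) := (tail Q L.coact₂).comp L.coact

theorem coact₃_apply (m : M) : L.coact₃ m = tail Q L.coact₂ (L.coact m) := rfl

theorem coact₃_apply' (m : M) : L.coact₃ m = tail Q (tail Q L.coact) (L.coact₂ m) := by
  rw [coact₃_apply, coact₂_apply, tail_tail_apply, coact₂]

/-- `(Δ ⊗ id) λ` -/
def comulCoact : M →ₐ[k] Q ⊗[k] (Q ⊗[k] M) := (head2 M H.comul).comp L.coact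

theorem comulCoact_apply (m : M) : L.comulCoact m = head2 M H.comul (L.coact m) := rfl

theorem coact₂_mul_Phi (m : M) : L.coact₂ m * L.Phi.val = L.Phi.val * L.comulCoact m :=
  L.quasi_coassoc m

theorem Phi_inv_mul_coact₂ (m : M) :
    L.Phi⁻¹.val * L.coact₂ m = L.comulCoact m * L.Phi⁻¹.val := by
  rw [Units.inv_mul_eq_iff_eq_mul, ← mul_assoc, ← coact₂_mul_Phi, mul_assoc, Units.mul_inv, mul_one]

@[simp] theorem Phi_mul_inv : L.Phi.val * L.Phi⁻¹.val = 1 := Units.mul_inv _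
@[simp] theorem Phi_inv_mul : L.Phi⁻¹.val * L.Phi.val = 1 := Units.inv_mul _

theorem pentagon_inv :
    head2 (Q ⊗[k] M) H.comul L.Phi⁻¹.val * tail Q (tail Q L.coact) L.Phi⁻¹.val =
      padOne M H.phi⁻¹.val * tail Q (head2 M H.comul) L.Phi⁻¹.val * ((1 : Q) ⊗ₜ[k] L.Phi⁻¹.val) := by
  -- The pentagon is read in the group of units, so that inverting it only reverses the factors.
  have e : Units.map (MonoidHomClass.toMonoidHom (Algebra.TensorProduct.includeRight (R := k)
        (A := Q) (B := Q ⊗[k] (Q ⊗[k] M)))) L.Phi *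
      Units.map (MonoidHomClass.toMonoidHom (tail Q (head2 M H.comul))) L.Phi *
      Units.map (MonoidHomClass.toMonoidHom (padOne M)) H.phi =
      Units.map (MonoidHomClass.toMonoidHom (tail Q (tail Q L.coact))) L.Phi *
      Units.map (MonoidHomClass.toMonoidHom (head2 (Q ⊗[k] M) H.comul)) L.Phi := by
    ext1
    exact L.pentagon
  have e' := congrArg (fun x => (x⁻¹).val) e
  simp only [mul_inv_rev, Units.val_mul, Units.coe_map_inv] at e'
  rw [mul_assoc]
  exact e'.symm

theorem counit_inner_inv : tail Q (dropHead M H.counit) L.Phi⁻¹.val = 1 := by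
  have := congrArg (tail Q (dropHead M H.counit)) L.Phi_mul_inv
  rwa [map_mul, L.counit_inner, one_mul, map_one] at this

theorem counit_outer_inv : dropHead (Q ⊗[k] M) H.counit L.Phi⁻¹.val = 1 := by
  have := congrArg (dropHead (Q ⊗[k] M) H.counit) L.Phi_mul_inv
  rwa [map_mul, L.counit_outer, one_mul, map_one] at this

/-- `q = S(Φ̄¹) α Φ̄² ⊗ Φ̄³`, where `Φ̄ = Φ⁻¹` -/
def q : Q ⊗[k] M := H.contract M L.Phi⁻¹.val

/-- `W ↦ S(a) W λ(m)` -/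
def act : Q ⊗[k] M →ₗ[k] Q ⊗[k] M →ₗ[k] Q ⊗[k] M := H.act₁ L.coact

/-- The outer factor `S(a)` is absorbed into the first leg, because `S(a) S(b) α = S(b a) α`. -/
theorem act_contract (s : Q ⊗[k] M) (t : Q ⊗[k] (Q ⊗[k] M)) :
    L.act s (H.contract M t) = H.contract M (t * tail Q L.coact s) := by
  induction s using tensor_induction₂ with
  | add x y hx hy => simp only [map_add, hx, hy, mul_add, LinearMap.add_apply]
  | tmul a m => simp [act, H.contract_mul]

/-- Inside the contraction `Φ⁻¹` is followed by `(id ⊗ λ)λ(m)`. Quasi-coassociativity moves this to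
the left as `(Δ ⊗ id)λ(m)`, where `α` reduces the coproduct to the counit and leaves `m`. -/
theorem act_q (m : M) : L.act (L.coact m) L.q = ((1 : Q) ⊗ₜ[k] m) * L.q := by
  rw [q, act_contract, ← coact₂_apply, Phi_inv_mul_coact₂, comulCoact_apply,
    H.contract_comul_mul, L.counit_coact]

/-- `(1 ⊗ q) (id ⊗ λ)(q)` -/
def q₂ : Q ⊗[k] (Q ⊗[k] M) := ((1 : Q) ⊗ₜ[k] L.q) * tail Q L.coact L.q

/-- With `s = t = Φ⁻¹` this presents `q₂` as a single double contraction: the outer pair of legs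
belongs to `s` and the inner pair to `t`. -/
theorem contract₂_insertOnes (s t : Q ⊗[k] (Q ⊗[k] M)) :
    H.contract₂ M (QuasiHopfCore.insertOnes Q (Q ⊗[k] M) s *
        ((1 : Q) ⊗ₜ[k] tail Q (tail Q L.coact) t)) =
      ((1 : Q) ⊗ₜ[k] H.contract M s) * tail Q L.coact (H.contract M t) := by
  induction s using tensor_induction₂ with
  | add x y hx hy => simp only [map_add, hx, hy, add_mul, TensorProduct.tmul_add]
  | tmul a s =>
    induction t using tensor_induction₃ with
    | tmul b c m =>
      simp only [QuasiHopfCore.insertOnes_tmul, tail_tmul, Algebra.TensorProduct.tmul_mul_tmul,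
        one_mul, mul_one, QuasiHopfCore.contract₂_tmul'', QuasiHopfCore.contract_tmul]
      have := H.contract_mul (a ⊗ₜ[k] s) 1 (L.coact m)
      rw [Algebra.TensorProduct.tmul_mul_tmul, mul_one] at this
      rw [this]
      simp [← Algebra.TensorProduct.one_def]
    | add x y hx hy => simp only [map_add, hx, hy, mul_add, TensorProduct.tmul_add]

theorem act₂_contract₂ (j : M →ₐ[k] Q ⊗[k] (Q ⊗[k] M)) (s : Q ⊗[k] (Q ⊗[k] M))
    (t : Q ⊗[k] (Q ⊗[k] (Q ⊗[k] (Q ⊗[k] M)))) :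
    H.act₂ j s (H.contract₂ M t) = H.contract₂ M (t * tail Q (tail Q j) s) := by
  induction s using tensor_induction₃ with
  | tmul a b m => simp [H.contract₂_mul]
  | add x y hx hy => simp only [map_add, hx, hy, mul_add, LinearMap.add_apply]

theorem dropHead_comp_head2 :
    (dropHead (Q ⊗[k] M) H.counit).comp (head2 M H.comul) = AlgHom.id k (Q ⊗[k] M) := by
  have h : ∀ (y : Q ⊗[k] Q) (m : M), dropHead (Q ⊗[k] M) H.counit (asc k Q Q M (y ⊗ₜ[k] m)) =
      dropHead Q H.counit y ⊗ₜ[k] m := by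
    intro y m
    induction y using tensor_induction₂ with
    | add x y hx hy => simp only [map_add, hx, hy, TensorProduct.add_tmul]
    | tmul a b => simp [TensorProduct.smul_tmul']
  ext a
  · simp [head2_tmul', h, H.counit_left]
  · rw [AlgHom.comp_apply]
    simp [head2_one_tmul]

theorem padOne_phi_mul_inv : padOne M H.phi.val * padOne M H.phi⁻¹.val = 1 := by
  rw [← map_mul, Units.mul_inv, map_one]

theorem padOne_phi_inv_mul : padOne M H.phi⁻¹.val * padOne M H.phi.val = 1 := by
  rw [← map_mul, Units.inv_mul, map_one]

theorem comul_comul_mul_phi (x : Q ⊗[k] M) :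
    tail Q (head2 M H.comul) (head2 M H.comul x) * padOne M H.phi.val =
      padOne M H.phi.val * head2 (Q ⊗[k] M) H.comul (head2 M H.comul x) := by
  rw [head3_eq, head3_eq']
  exact head3_conj _ _ _ H.quasi_coassoc x

theorem comul_comul_mul_phi_inv (x : Q ⊗[k] M) :
    head2 (Q ⊗[k] M) H.comul (head2 M H.comul x) * padOne M H.phi⁻¹.val =
      padOne M H.phi⁻¹.val * tail Q (head2 M H.comul) (head2 M H.comul x) := by
  calc _ = (padOne M H.phi⁻¹.val * padOne M H.phi.val) *
        head2 (Q ⊗[k] M) H.comul (head2 M H.comul x) * padOne M H.phi⁻¹.val := by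
          rw [padOne_phi_inv_mul, one_mul]
    _ = padOne M H.phi⁻¹.val * (tail Q (head2 M H.comul) (head2 M H.comul x) *
          padOne M H.phi.val) * padOne M H.phi⁻¹.val := by
          rw [comul_comul_mul_phi]; simp only [mul_assoc]
    _ = _ := by rw [mul_assoc, mul_assoc, padOne_phi_mul_inv, mul_one]

theorem tail_comul_comul_mul_phi_inv (s : Q ⊗[k] (Q ⊗[k] M)) :
    tail Q (head2 (Q ⊗[k] M) H.comul) (tail Q (head2 M H.comul) s) *
      ((1 : Q) ⊗ₜ[k] padOne M H.phi⁻¹.val) =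
    ((1 : Q) ⊗ₜ[k] padOne M H.phi⁻¹.val) *
      tail Q (tail Q (head2 M H.comul)) (tail Q (head2 M H.comul) s) := by
  induction s using tensor_induction₂ with
  | add x y hx hy => simp only [map_add, hx, hy, mul_add, add_mul]
  | tmul a x => simp only [tail_tmul, Algebra.TensorProduct.tmul_mul_tmul, one_mul, mul_one,
      comul_comul_mul_phi_inv]

theorem pentagon_inv' :
    tail Q (head2 M H.comul) L.Phi⁻¹.val * ((1 : Q) ⊗ₜ[k] L.Phi⁻¹.val) *
      tail Q (tail Q L.coact) L.Phi.val =
      padOne M H.phi.val * head2 (Q ⊗[k] M) H.comul L.Phi⁻¹.val := by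
  have h2 : tail Q (tail Q L.coact) L.Phi⁻¹.val * tail Q (tail Q L.coact) L.Phi.val = 1 := by
    rw [← map_mul, Units.inv_mul, map_one]
  calc _ = (padOne M H.phi.val * padOne M H.phi⁻¹.val) * (tail Q (head2 M H.comul) L.Phi⁻¹.val *
        ((1 : Q) ⊗ₜ[k] L.Phi⁻¹.val) * tail Q (tail Q L.coact) L.Phi.val) := by
        rw [padOne_phi_mul_inv, one_mul]
    _ = padOne M H.phi.val * (padOne M H.phi⁻¹.val * tail Q (head2 M H.comul) L.Phi⁻¹.val *
        ((1 : Q) ⊗ₜ[k] L.Phi⁻¹.val)) * tail Q (tail Q L.coact) L.Phi.val := by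
          simp only [mul_assoc]
    _ = _ := by
      rw [← L.pentagon_inv, mul_assoc, mul_assoc, h2, mul_one]

theorem coact₂_Phi_comm :
    tail Q (tail Q L.coact₂) L.Phi.val * ((1 : Q) ⊗ₜ[k] ((1 : Q) ⊗ₜ[k] L.Phi.val)) =
      ((1 : Q) ⊗ₜ[k] ((1 : Q) ⊗ₜ[k] L.Phi.val)) * tail Q (tail Q L.comulCoact) L.Phi.val :=
  (tail_tail_mul_comm L.Phi.val L.comulCoact L.coact₂ L.Phi.val
    (fun m => (L.coact₂_mul_Phi m).symm)).symm

/-- A consequence of two pentagon identities. -/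
theorem pentagon_square :
    tail Q (head2 (Q ⊗[k] M) H.comul) (tail Q (head2 M H.comul) L.Phi⁻¹.val *
        ((1 : Q) ⊗ₜ[k] L.Phi⁻¹.val)) *
      ((1 : Q) ⊗ₜ[k] tail Q (tail Q L.coact) L.Phi⁻¹.val) *
      tail Q (tail Q L.coact₂) L.Phi.val * ((1 : Q) ⊗ₜ[k] ((1 : Q) ⊗ₜ[k] L.Phi.val)) =
    ((1 : Q) ⊗ₜ[k] padOne M H.phi⁻¹.val) * tail Q (tail Q (head2 M H.comul)) (padOne M H.phi.val) *
      head2 (Q ⊗[k] (Q ⊗[k] M)) H.comul (tail Q (head2 M H.comul) L.Phi⁻¹.val) := by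
  have h1 : ((1 : Q) ⊗ₜ[k] head2 (Q ⊗[k] M) H.comul L.Phi⁻¹.val) *
      ((1 : Q) ⊗ₜ[k] tail Q (tail Q L.coact) L.Phi⁻¹.val) =
      ((1 : Q) ⊗ₜ[k] padOne M H.phi⁻¹.val) *
          ((1 : Q) ⊗ₜ[k] tail Q (head2 M H.comul) L.Phi⁻¹.val) *
          ((1 : Q) ⊗ₜ[k] ((1 : Q) ⊗ₜ[k] L.Phi⁻¹.val)) := by
    simp only [Algebra.TensorProduct.tmul_mul_tmul, one_mul, pentagon_inv]
  have h3 : ((1 : Q) ⊗ₜ[k] ((1 : Q) ⊗ₜ[k] L.Phi⁻¹.val)) * ((1 : Q) ⊗ₜ[k] ((1 : Q) ⊗ₜ[k] L.Phi.val))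
      = 1 := by
    simp only [Algebra.TensorProduct.tmul_mul_tmul, one_mul, Units.inv_mul,
      ← Algebra.TensorProduct.one_def]
  have h4 : tail Q (tail Q L.comulCoact) L.Phi.val =
      tail Q (tail Q (head2 M H.comul)) (tail Q (tail Q L.coact) L.Phi.val) := by
    rw [tail_tail_apply, tail_comp]
    rfl
  have h6 := congrArg (tail Q (tail Q (head2 M H.comul))) L.pentagon_inv'
  rw [map_mul, map_mul, map_mul, tail_tail_head2, ← h4, tail_tmul] at h6
  rw [map_mul, tail_tmul, mul_assoc, mul_assoc, mul_assoc, coact₂_Phi_comm,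
    ← mul_assoc (1 ⊗ₜ[k] head2 (Q ⊗[k] M) H.comul L.Phi⁻¹.val), h1, mul_assoc (_ * _),
    ← mul_assoc (1 ⊗ₜ[k] (1 ⊗ₜ[k] L.Phi⁻¹.val)), h3, one_mul,
    ← mul_assoc (tail Q _ _), ← mul_assoc (tail Q _ _), tail_comul_comul_mul_phi_inv,
    mul_assoc _ _ (head2 _ _ _), ← h6]
  simp only [mul_assoc]

/-- By hypothesis `F Δ(q)` is a double contraction of the right side of `pentagon_square`. On the
left side of that identity the leading factor carries `Δ` on legs two and three, so the contraction
replaces it by its counit image, which is `Φ⁻¹`. What remains is the double contraction producing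
`q₂`, sandwiched by `Φ`, with one more `Φ` on the right. -/
theorem twist_comul_q (F : Q ⊗[k] Q)
    (hF : tail Q (appendOne Q M) F * head2 M H.comul L.q =
      H.contract₂ M (((1 : Q) ⊗ₜ[k] padOne M H.phi⁻¹.val) *
        tail Q (tail Q (head2 M H.comul)) (padOne M H.phi.val) *
      head2 (Q ⊗[k] (Q ⊗[k] M)) H.comul (tail Q (head2 M H.comul) L.Phi⁻¹.val))) :
    tail Q (appendOne Q M) F * head2 M H.comul L.q =
      H.act₂ L.coact₂ L.Phi.val L.q₂ * L.Phi.val := by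
  -- Of the two copies of `Φ⁻¹`, the one shifted by `1 ⊗` dies under the counit, and the one
  -- carrying `Δ` is restored to `Φ⁻¹`.
  have hr : tail Q (dropHead (Q ⊗[k] M) H.counit) (tail Q (head2 M H.comul) L.Phi⁻¹.val *
      ((1 : Q) ⊗ₜ[k] L.Phi⁻¹.val)) = L.Phi⁻¹.val := by
    rw [map_mul, tail_tmul, L.counit_outer_inv, ← Algebra.TensorProduct.one_def, mul_one,
      tail_tail_apply, dropHead_comp_head2]
    simp [tail]
  rw [hF, ← pentagon_square, mul_assoc, mul_assoc, QuasiHopfCore.contract₂_comul_mul, hr,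
    ← mul_assoc, ← mul_assoc]
  have := H.contract₂_mul (M := M) (QuasiHopfCore.insertOnes Q (Q ⊗[k] M) L.Phi⁻¹.val *
    ((1 : Q) ⊗ₜ[k] tail Q (tail Q L.coact) L.Phi⁻¹.val) * tail Q (tail Q L.coact₂) L.Phi.val) 1 1
      L.Phi.val
  rw [this, H.S_one, ← Algebra.TensorProduct.one_def, ← Algebra.TensorProduct.one_def, one_mul,
    ← act₂_contract₂, contract₂_insertOnes]
  rfl

end LeftCoaction

/-! ### Contractions against `β` and mixed contractions. -/

namespace QuasiHopfCore

variable {k : Type u} [Field k] {Q : Type v} [Ring Q] [Algebra k Q] (H : QuasiHopfCore k Q)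

/-- `a ⊗ b ↦ a β S(b)` -/
def coev : Q ⊗[k] Q →ₗ[k] Q := mul' k Q ∘ₗ TensorProduct.map (mulRight k H.beta) H.S

@[simp] theorem coev_tmul (a b : Q) : H.coev (a ⊗ₜ[k] b) = a * H.beta * H.S b := by
  simp [coev]

theorem coev_comul (a : Q) : H.coev (H.comul a) = H.counit a • H.beta := H.antipode_beta a

theorem tmul_mul_coev (y : Q ⊗[k] Q) (a b : Q) :
    H.coev ((a ⊗ₜ[k] b) * y) = a * H.coev y * H.S b := by
  induction y using tensor_induction₂ with
  | add x y hx hy => simp only [map_add, hx, hy, add_mul, mul_add]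
  | tmul c d => simp [S_mul, mul_assoc]

variable (M : Type w) [Ring M] [Algebra k M]

/-- `a ⊗ b ⊗ m ↦ a β S(b) ⊗ m` -/
def cocontract : Q ⊗[k] (Q ⊗[k] M) →ₗ[k] Q ⊗[k] M :=
  H.coev.rTensor M ∘ₗ (TensorProduct.assoc k Q Q M).symm.toLinearMap

variable {M}

@[simp] theorem cocontract_tmul (a b : Q) (m : M) :
    H.cocontract M (a ⊗ₜ[k] (b ⊗ₜ[k] m)) = (a * H.beta * H.S b) ⊗ₜ[k] m := by
  simp [cocontract]

theorem cocontract_asc (y : Q ⊗[k] Q) (m : M) :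
    H.cocontract M (asc k Q Q M (y ⊗ₜ[k] m)) = H.coev y ⊗ₜ[k] m := by
  induction y using tensor_induction₂ with
  | add x y hx hy => simp only [map_add, hx, hy, TensorProduct.add_tmul]
  | tmul a b => simp

theorem cocontract_mul_comul (s : Q ⊗[k] M) (t : Q ⊗[k] (Q ⊗[k] M)) :
    H.cocontract M (t * head2 M H.comul s) =
      H.cocontract M t * ((1 : Q) ⊗ₜ[k] dropHead M H.counit s) := by
  induction s using tensor_induction₂ with
  | add x y hx hy => simp only [map_add, hx, hy, mul_add, TensorProduct.tmul_add]
  | tmul a m =>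
    induction t using tensor_induction₃ with
    | tmul b c n =>
      rw [← asc_tmul, head2_tmul', ← map_mul, Algebra.TensorProduct.tmul_mul_tmul, cocontract_asc,
        cocontract_asc, tmul_mul_coev, coev_comul, coev_tmul]
      simp [TensorProduct.smul_tmul]
    | add x y hx hy => simp only [map_add, hx, hy, add_mul]

variable (M)

/-- `a ⊗ b ⊗ c ⊗ m ↦ a β S(b) α c ⊗ m` -/
def zigzag : Q ⊗[k] (Q ⊗[k] (Q ⊗[k] M)) →ₗ[k] Q ⊗[k] M :=
  mul' k (Q ⊗[k] M) ∘ₗ TensorProduct.map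
    ((Algebra.TensorProduct.includeLeft (R := k) (S := k) (A := Q) (B := M)).toLinearMap ∘ₗ
      mulRight k H.beta) (H.contract M)

variable {M}

theorem zigzag_tmul (a : Q) (t : Q ⊗[k] (Q ⊗[k] M)) :
    H.zigzag M (a ⊗ₜ[k] t) = ((a * H.beta) ⊗ₜ[k] 1) * H.contract M t := by
  simp [zigzag]

/-- In `a β S(b) α c` the middle leg meets both `β` and `α`. A coproduct on legs two and three
arriving from the left is absorbed by `α`; one on legs one and two arriving from the right is
absorbed by `β`, which is `zigzag_mul_comul`. -/
theorem zigzag_comul_mul (r : Q ⊗[k] (Q ⊗[k] M)) (t : Q ⊗[k] (Q ⊗[k] (Q ⊗[k] M))) :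
    H.zigzag M (tail Q (head2 M H.comul) r * t) =
      H.zigzag M (insertOnes Q M (tail Q (dropHead M H.counit) r) * t) := by
  induction r using tensor_induction₂ with
  | add x y hx hy => simp only [map_add, hx, hy, add_mul]
  | tmul a r =>
    induction t using tensor_induction₂ with
    | add x y hx hy => simp only [map_add, hx, hy, mul_add]
    | tmul b t =>
      simp only [tail_tmul, insertOnes_tmul, Algebra.TensorProduct.tmul_mul_tmul, zigzag_tmul,
        contract_comul_mul]
      congr 1
      generalize dropHead M H.counit r = s
      induction t using tensor_induction₃ with
      | tmul c d n => simp
      | add x y hx hy => simp only [map_add, hx, hy, mul_add]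

theorem zigzag_mul_comul (t : Q ⊗[k] (Q ⊗[k] (Q ⊗[k] M))) (s : Q ⊗[k] (Q ⊗[k] M)) :
    H.zigzag M (t * head2 (Q ⊗[k] M) H.comul s) =
      H.zigzag M t * dropHead (Q ⊗[k] M) H.counit s := by
  induction s using tensor_induction₂ with
  | add x y hx hy => simp only [map_add, hx, hy, mul_add]
  | tmul a s =>
    induction t using tensor_induction₂ with
    | add x y hx hy => simp only [map_add, hx, hy, add_mul]
    | tmul b t =>
      have key : ∀ z : Q ⊗[k] Q, H.zigzag M ((b ⊗ₜ[k] t) * asc k Q Q (Q ⊗[k] M) (z ⊗ₜ[k] s)) =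
          ((b * H.coev z) ⊗ₜ[k] 1) * H.contract M t * s := by
        intro z
        induction z using tensor_induction₂ with
        | add x y hx hy =>
          simp only [map_add, hx, hy, mul_add, add_mul, TensorProduct.add_tmul]
        | tmul c d =>
          simp only [asc_tmul, Algebra.TensorProduct.tmul_mul_tmul, zigzag_tmul, contract_mul,
            coev_tmul, ← mul_assoc, mul_one]
      rw [head2_tmul', key, coev_comul, zigzag_tmul, mul_smul_comm, ← TensorProduct.smul_tmul',
        smul_mul_assoc, smul_mul_assoc, dropHead_tmul, mul_smul_comm]

theorem zigzag_padOne (t : Q ⊗[k] (Q ⊗[k] Q)) : H.zigzag M (padOne M t) =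
    (mul' k Q ∘ₗ TensorProduct.map (mulRight k H.beta)
      (mul' k Q ∘ₗ TensorProduct.map (mulRight k H.alpha ∘ₗ H.S) LinearMap.id)) t ⊗ₜ[k] 1 := by
  induction t using tensor_induction₃ with
  | tmul a b c => simp [zigzag_tmul, mul_assoc]
  | add x y hx hy => simp only [map_add, hx, hy, TensorProduct.add_tmul]

theorem zigzag_phi : H.zigzag M (padOne M H.phi.val) = 1 := by
  rw [zigzag_padOne]
  erw [H.antipode_phi]
  rfl

theorem cocontract_contract_padOne (t : Q ⊗[k] (Q ⊗[k] Q)) :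
    H.cocontract M (H.contract (Q ⊗[k] M) (padOne M t)) =
      (mul' k Q ∘ₗ TensorProduct.map (mulRight k H.alpha ∘ₗ H.S)
      (mul' k Q ∘ₗ TensorProduct.map (mulRight k H.beta) H.S)) t ⊗ₜ[k] 1 := by
  induction t using tensor_induction₃ with
  | tmul a b c => simp [mul_assoc]
  | add x y hx hy => simp only [map_add, hx, hy, TensorProduct.add_tmul]

theorem cocontract_contract_phi_inv :
    H.cocontract M (H.contract (Q ⊗[k] M) (padOne M H.phi⁻¹.val)) = 1 := by
  rw [cocontract_contract_padOne]
  erw [H.antipode_phi_inv]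
  rfl

/-- In the opposite zigzag `S(a) α b β S(c)` the last two legs meet at `β`, which absorbs a
coproduct arriving from the right. -/
theorem contract_mul_comul (t : Q ⊗[k] (Q ⊗[k] (Q ⊗[k] M))) (r : Q ⊗[k] (Q ⊗[k] M)) :
    H.cocontract M (H.contract (Q ⊗[k] M) (t * tail Q (head2 M H.comul) r)) =
      H.cocontract M (H.contract (Q ⊗[k] M)
        (t * insertOnes Q M (tail Q (dropHead M H.counit) r))) := by
  induction r using tensor_induction₂ with
  | add x y hx hy => simp only [map_add, hx, hy, mul_add]
  | tmul a r =>
    rw [tail_tmul, tail_tmul, insertOnes_tmul, contract_mul, contract_mul, cocontract_mul_comul]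
    have := H.cocontract_mul_comul ((1 : Q) ⊗ₜ[k] dropHead M H.counit r)
      (H.S a ⊗ₜ[k] 1 * H.contract (Q ⊗[k] M) t)
    rw [head2_one_tmul] at this
    rw [this]
    simp

end QuasiHopfCore

/-! ### The element `p` and the inversion relations between `p` and `q`. -/

namespace LeftCoaction

variable {k : Type u} [Field k] {Q : Type v} [Ring Q] [Algebra k Q] {H : QuasiHopfCore k Q}
variable {M : Type w} [Ring M] [Algebra k M] (L : LeftCoaction H M)

/-- `p = Φ² S⁻¹(Φ¹ β) ⊗ Φ³` -/
def p : Q ⊗[k] M := H.Sinv.rTensor M (H.cocontract M L.Phi.val)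

theorem act_Sinv_cocontract (s t : Q ⊗[k] (Q ⊗[k] M)) :
    L.act (H.Sinv.rTensor M (H.cocontract M t)) (H.contract M s) =
      H.zigzag M (((1 : Q) ⊗ₜ[k] s) * tail Q (tail Q L.coact) t) := by
  induction t using tensor_induction₃ with
  | tmul a b m =>
    simp only [QuasiHopfCore.cocontract_tmul, LinearMap.rTensor_tmul, act,
      QuasiHopfCore.act₁_tmul, QuasiHopfCore.S_Sinv, tail_tmul,
      Algebra.TensorProduct.tmul_mul_tmul, QuasiHopfCore.zigzag_tmul, one_mul,
      QuasiHopfCore.contract_mul, ← mul_assoc, mul_one]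
  | add x y hx hy => simp only [map_add, hx, hy, mul_add, LinearMap.add_apply]

/-- The left side is the zigzag of `(1 ⊗ Φ⁻¹)(id ⊗ id ⊗ λ)(Φ)`. By the pentagon this product is `(id
⊗ Δ ⊗ id)(Φ) (φ ⊗ 1) (Δ ⊗ id ⊗ id)(Φ⁻¹)`. The outer factors are absorbed by `α` and `β` and vanish
by normalization of `Φ`; the middle one gives `X β S(Y) α Z = 1`. -/
theorem act_p_q : L.act L.p L.q = 1 := by
  have h1 : tail Q (tail Q L.coact) L.Phi.val =
      ((1 : Q) ⊗ₜ[k] L.Phi.val) * tail Q (head2 M H.comul) L.Phi.val * padOne M H.phi.val *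
        head2 (Q ⊗[k] M) H.comul L.Phi⁻¹.val := by
    rw [L.pentagon, mul_assoc, ← map_mul, Phi_mul_inv, map_one, mul_one]
  have h2 : ((1 : Q) ⊗ₜ[k] L.Phi⁻¹.val) * ((1 : Q) ⊗ₜ[k] L.Phi.val) = 1 := by
    rw [Algebra.TensorProduct.tmul_mul_tmul, Phi_inv_mul, one_mul]
    rfl
  rw [p, q, act_Sinv_cocontract, h1, ← mul_assoc, ← mul_assoc, ← mul_assoc, h2, one_mul,
    H.zigzag_mul_comul, L.counit_outer_inv, mul_one, H.zigzag_comul_mul, L.counit_inner, map_one,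
    one_mul, H.zigzag_phi]

/-- `(a ⊗ m, W) ↦ λ(m) W (S⁻¹(a) ⊗ 1)` -/
def coAct (s W : Q ⊗[k] M) : Q ⊗[k] M :=
  mul' k (Q ⊗[k] M) (TensorProduct.map (mulRight k W ∘ₗ L.coact.toLinearMap)
    ((Algebra.TensorProduct.includeLeft (R := k) (S := k) (A := Q) (B := M)).toLinearMap ∘ₗ
      H.Sinv) (TensorProduct.comm k Q M s))

@[simp] theorem coAct_tmul (a : Q) (m : M) (W : Q ⊗[k] M) :
    L.coAct (a ⊗ₜ[k] m) W = L.coact m * W * (H.Sinv a ⊗ₜ[k] 1) := by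
  simp [coAct]

theorem coAct_add (s t W : Q ⊗[k] M) : L.coAct (s + t) W = L.coAct s W + L.coAct t W := by
  simp [coAct]

theorem coAct_add_right (s W X : Q ⊗[k] M) : L.coAct s (W + X) = L.coAct s W + L.coAct s X := by
  induction s using tensor_induction₂ with
  | add x y hx hy => simp only [hx, hy, coAct_add]; abel
  | tmul a m => simp [mul_add, add_mul]

theorem coAct_mul (s t W : Q ⊗[k] M) : L.coAct (s * t) W = L.coAct s (L.coAct t W) := by
  induction s using tensor_induction₂ with
  | add x y hx hy => simp only [coAct_add, hx, hy, add_mul]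
  | tmul a m =>
    induction t using tensor_induction₂ with
    | add x y hx hy => simp only [coAct_add, hx, hy, mul_add, coAct_add_right]
    | tmul b n => simp [H.Sinv_mul, mul_assoc]

theorem coAct_mul_right (s W : Q ⊗[k] M) (m : M) :
    L.coAct s (W * ((1 : Q) ⊗ₜ[k] m)) = L.coAct s W * ((1 : Q) ⊗ₜ[k] m) := by
  induction s using tensor_induction₂ with
  | add x y hx hy => simp only [coAct_add, hx, hy, add_mul]
  | tmul a n => simp [mul_assoc]

theorem coAct_Sinv_cocontract (s : Q ⊗[k] M) (t : Q ⊗[k] (Q ⊗[k] M)) :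
    L.coAct s (H.Sinv.rTensor M (H.cocontract M t)) =
      H.Sinv.rTensor M (H.cocontract M (tail Q L.coact s * t)) := by
  induction s using tensor_induction₂ with
  | add x y hx hy => simp only [map_add, hx, hy, add_mul, coAct_add]
  | tmul a n =>
    simp only [coAct_tmul, tail_tmul]
    generalize L.coact n = y
    induction y using tensor_induction₂ with
    | add x y hx hy => simp only [map_add, hx, hy, add_mul, TensorProduct.tmul_add]
    | tmul b m =>
      induction t using tensor_induction₃ with
      | tmul c d m' => simp [H.Sinv_mul, H.S_mul, mul_assoc]
      | add x y hx hy => simp only [map_add, hx, hy, mul_add, add_mul]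

/-- This is the counterpart of `act_q`: quasi-coassociativity moves `(id ⊗ λ)λ(m)` to the right of
`Φ`, where `β` absorbs the resulting coproduct. -/
theorem coAct_p (m : M) : L.coAct (L.coact m) L.p = L.p * ((1 : Q) ⊗ₜ[k] m) := by
  rw [p, coAct_Sinv_cocontract, ← coact₂_apply, coact₂_mul_Phi, comulCoact_apply,
    H.cocontract_mul_comul, L.counit_coact]
  generalize H.cocontract M L.Phi.val = s
  induction s using tensor_induction₂ with
  | add x y hx hy => simp only [map_add, hx, hy, add_mul]
  | tmul a n => simp

theorem tail_coact_contract_mul (s t : Q ⊗[k] (Q ⊗[k] M)) :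
    tail Q L.coact (H.contract M s) * t =
      H.contract (Q ⊗[k] M) (tail Q (tail Q L.coact) s * ((1 : Q) ⊗ₜ[k] t)) := by
  rw [H.contract_mul, H.S_one, ← Algebra.TensorProduct.one_def, one_mul]
  congr 1
  induction s using tensor_induction₃ with
  | tmul a b m => simp
  | add x y hx hy => simp only [map_add, hx, hy]

/-- The argument mirrors `act_p_q`, with the inverse pentagon in place of the pentagon and `S(P) α Q
β S(R) = 1` as the surviving identity. -/
theorem coAct_q_p : L.coAct L.q L.p = 1 := by
  have h1 : tail Q (tail Q L.coact) L.Phi⁻¹.val =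
      head2 (Q ⊗[k] M) H.comul L.Phi.val * (padOne M H.phi⁻¹.val *
        tail Q (head2 M H.comul) L.Phi⁻¹.val * ((1 : Q) ⊗ₜ[k] L.Phi⁻¹.val)) := by
    rw [← L.pentagon_inv, ← mul_assoc, ← map_mul, Phi_mul_inv, map_one, one_mul]
  have h2 : ((1 : Q) ⊗ₜ[k] L.Phi⁻¹.val) * ((1 : Q) ⊗ₜ[k] L.Phi.val) = 1 := by
    rw [Algebra.TensorProduct.tmul_mul_tmul, Phi_inv_mul, one_mul]
    rfl
  rw [p, coAct_Sinv_cocontract, q, tail_coact_contract_mul, h1, mul_assoc, mul_assoc, h2, mul_one,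
    H.contract_comul_mul, L.counit_outer, ← Algebra.TensorProduct.one_def, one_mul,
    H.contract_mul_comul, L.counit_inner_inv, map_one, mul_one, H.cocontract_contract_phi_inv]
  simp [Algebra.TensorProduct.one_def]

end LeftCoaction

/-! ### Drinfel'd's twist, characterized by two identities. -/

namespace QuasiHopfCore

variable {k : Type u} [Field k] {Q : Type v} [Ring Q] [Algebra k Q] (H : QuasiHopfCore k Q)

/-- `a ⊗ b ⊗ c ⊗ d ↦ S(b) α c ⊗ S(a) α d` -/
def contractPair : Q ⊗[k] (Q ⊗[k] (Q ⊗[k] Q)) →ₗ[k] Q ⊗[k] Q :=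
  mul' k (Q ⊗[k] Q) ∘ₗ
      TensorProduct.map (mulRight k (H.alpha ⊗ₜ[k] H.alpha) ∘ₗ H.flipS) LinearMap.id ∘ₗ
      (TensorProduct.assoc k Q Q (Q ⊗[k] Q)).symm.toLinearMap

@[simp] theorem contractPair_tmul (a b : Q) (z : Q ⊗[k] Q) :
    H.contractPair (a ⊗ₜ[k] (b ⊗ₜ[k] z)) =
      (H.S b ⊗ₜ[k] H.S a) * (H.alpha ⊗ₜ[k] H.alpha) * z := by
  simp [contractPair]

theorem contractPair_mul (t : Q ⊗[k] (Q ⊗[k] (Q ⊗[k] Q))) (a b : Q) (z : Q ⊗[k] Q) :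
    H.contractPair (t * (a ⊗ₜ[k] (b ⊗ₜ[k] z))) =
      (H.S b ⊗ₜ[k] H.S a) * H.contractPair t * z := by
  induction t using tensor_induction₃ with
  | tmul a' b' y =>
    simp only [Algebra.TensorProduct.tmul_mul_tmul, contractPair_tmul, S_mul, ← mul_assoc]
  | add x y hx hy => simp only [map_add, hx, hy, add_mul, mul_add]

/-- `(1 ⊗ φ⁻¹) (id ⊗ id ⊗ Δ)(φ)` -/
def theta : Q ⊗[k] (Q ⊗[k] (Q ⊗[k] Q)) :=
  ((1 : Q) ⊗ₜ[k] H.phi⁻¹.val) * tail Q (tail Q H.comul) H.phi.val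

def gamma : Q ⊗[k] Q := H.contractPair H.theta

/-- The two properties which characterize Drinfel'd's twist. -/
structure IsTwist (F : Q ⊗[k] Q) : Prop where
  mul_comul_S : ∀ a, F * H.comul (H.S a) = H.flipS (H.comul a) * F
  mul_comul_alpha : F * H.comul H.alpha = H.gamma

variable (M : Type w) [Ring M] [Algebra k M]

/-- `t ⊗ 1` for fourfold tensors `t` -/
abbrev padOne₄ : Q ⊗[k] (Q ⊗[k] (Q ⊗[k] Q)) →ₐ[k] Q ⊗[k] (Q ⊗[k] (Q ⊗[k] (Q ⊗[k] M))) :=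
  tail Q (padOne M)

variable {M}

theorem contract₂_padOne₄ (t : Q ⊗[k] (Q ⊗[k] (Q ⊗[k] Q))) :
    H.contract₂ M (padOne₄ M t) = tail Q (appendOne Q M) (H.contractPair t) := by
  induction t using tensor_induction₄ with
  | tmul a b c d => simp
  | add x y hx hy => simp only [map_add, hx, hy]

theorem asc_tmul_one (y : Q ⊗[k] Q) :
    asc k Q Q M (y ⊗ₜ[k] 1) = tail Q (appendOne Q M) y := by
  induction y using tensor_induction₂ with
  | add x y hx hy => simp only [map_add, hx, hy, TensorProduct.add_tmul]
  | tmul a b => simp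

theorem contract₂_padOne₄_mul (t : Q ⊗[k] (Q ⊗[k] (Q ⊗[k] Q))) (y z : Q ⊗[k] Q) (m : M) :
    H.contract₂ M (padOne₄ M t * asc k Q Q (Q ⊗[k] (Q ⊗[k] M))
      (y ⊗ₜ[k] asc k Q Q M (z ⊗ₜ[k] m))) =
      asc k Q Q M ((H.flipS y * H.contractPair t * z) ⊗ₜ[k] m) := by
  induction y using tensor_induction₂ with
  | add x y hx hy => simp only [map_add, hx, hy, add_mul, mul_add, TensorProduct.add_tmul]
  | tmul a b =>
    rw [asc_tmul, contract₂_mul, contract₂_padOne₄, flipS_tmul, ← asc_tmul_one, ← asc_tmul,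
      asc_mul, asc_mul, one_mul, one_mul]

theorem padOne₄_theta : padOne₄ M H.theta =
    ((1 : Q) ⊗ₜ[k] padOne M H.phi⁻¹.val) *
      tail Q (tail Q (head2 M H.comul)) (padOne M H.phi.val) := by
  rw [theta, map_mul, tail_tmul, tail_tail_apply, tail_tail_apply, tail_comp, tail_comp]
  congr 4
  ext a
  rw [AlgHom.comp_apply, AlgHom.comp_apply, appendOne_apply, head2_tmul', asc_tmul_one]

/-- The two twist identities carry `F` through `Δ(S(a) α b)`: first past `Δ(S(a))`, then into `F
Δ(α) = γ`, whose definition supplies the two factors built from `φ`. -/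
theorem IsTwist.mul_comul_contract {F : Q ⊗[k] Q} (hF : H.IsTwist F) (s : Q ⊗[k] (Q ⊗[k] M)) :
    tail Q (appendOne Q M) F * head2 M H.comul (H.contract M s) =
      H.contract₂ M (((1 : Q) ⊗ₜ[k] padOne M H.phi⁻¹.val) *
        tail Q (tail Q (head2 M H.comul)) (padOne M H.phi.val) *
      head2 (Q ⊗[k] (Q ⊗[k] M)) H.comul (tail Q (head2 M H.comul) s)) := by
  rw [← padOne₄_theta]
  induction s using tensor_induction₃ with
  | tmul a b m =>
    rw [tail_tmul, head2_tmul', head2_tmul', contract₂_padOne₄_mul, contract_tmul, head2_tmul',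
      ← asc_tmul_one, asc_mul, one_mul, map_mul, map_mul, ← mul_assoc, ← mul_assoc,
      hF.mul_comul_S, mul_assoc _ F, hF.mul_comul_alpha]
    rfl
  | add x y hx hy => simp only [map_add, hx, hy, mul_add]

theorem IsTwist.mul_comul {F : Q ⊗[k] Q} (hF : H.IsTwist F) (a : Q) :
    F * H.comul a = H.flipS (H.comul (H.Sinv a)) * F := by
  rw [← hF.mul_comul_S, S_Sinv]

end QuasiHopfCore

/-! ### Left invertibility of the twist. -/

namespace LeftCoaction

variable {k : Type u} [Field k] {Q : Type v} [Ring Q] [Algebra k Q] {H : QuasiHopfCore k Q}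
variable {M : Type w} [Ring M] [Algebra k M] (L : LeftCoaction H M)

theorem twist_mul_comul_q {F : Q ⊗[k] Q} (hF : H.IsTwist F) :
    tail Q (appendOne Q M) F * head2 M H.comul L.q =
      H.act₂ L.coact₂ L.Phi.val L.q₂ * L.Phi.val :=
  L.twist_comul_q F (hF.mul_comul_contract H _)

theorem act₂_tmul_q₂ (a : Q) (r : Q ⊗[k] M) :
    H.act₂ L.coact₂ (a ⊗ₜ[k] r) L.q₂ =
      ((1 : Q) ⊗ₜ[k] ((H.S a ⊗ₜ[k] 1) * L.q)) * tail Q L.coact (L.act r L.q) := by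
  induction r using tensor_induction₂ with
  | add x y hx hy => simp only [map_add, hx, hy, mul_add, TensorProduct.tmul_add,
      LinearMap.add_apply]
  | tmul b m =>
    rw [H.act₂_tmul, q₂, act, H.act₁_tmul, map_mul, map_mul, tail_tmul, map_one, coact₂_apply]
    simp only [← mul_assoc, Algebra.TensorProduct.tmul_mul_tmul, mul_one, one_mul]

theorem act₂_tail_coact_q₂ (s : Q ⊗[k] M) :
    H.act₂ L.coact₂ (tail Q L.coact s) L.q₂ =
      ((1 : Q) ⊗ₜ[k] L.act s L.q) * tail Q L.coact L.q := by
  induction s using tensor_induction₂ with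
  | add x y hx hy => simp only [map_add, hx, hy, add_mul, TensorProduct.tmul_add,
      LinearMap.add_apply]
  | tmul a m =>
    rw [tail_tmul, act₂_tmul_q₂, act_q, map_mul, tail_tmul, ← mul_assoc,
      Algebra.TensorProduct.tmul_mul_tmul, one_mul, act, H.act₁_tmul]

theorem act₂_one_tmul (s W : Q ⊗[k] M) :
    H.act₂ L.coact₂ ((1 : Q) ⊗ₜ[k] s) (tail Q L.coact W) = tail Q L.coact (L.act s W) := by
  induction s using tensor_induction₂ with
  | add x y hx hy => simp only [map_add, hx, hy, TensorProduct.tmul_add, LinearMap.add_apply]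
  | tmul a m =>
    rw [H.act₂_tmul, act, H.act₁_tmul, map_mul, map_mul, tail_tmul, map_one L.coact,
      coact₂_apply, H.S_one]
    rfl

/-- The two copies of `p` cancel the two copies of `q` in turn: `(id ⊗ λ)(p)` removes the left
factor of `q₂`, and `1 ⊗ p` then removes the other. -/
theorem act₂_p_q₂ :
    H.act₂ L.coact₂ (tail Q L.coact L.p * ((1 : Q) ⊗ₜ[k] L.p)) L.q₂ = 1 := by
  rw [H.act₂_mul, act₂_tail_coact_q₂, act_p_q, ← Algebra.TensorProduct.one_def, one_mul,
    act₂_one_tmul, act_p_q, map_one]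

/-- The central formula in its usable form. The trailing `Φ` exchanges `(Δ ⊗ id)λ` for `(id ⊗ λ)λ`,
and the `Φ` in the sandwich cancels the prefixed `Φ⁻¹`. Both the invertibility of `F` and the
multiplicativity of `f` start here. -/
theorem act₂_comulCoact_twist {F : Q ⊗[k] Q} (hF : H.IsTwist F) (t : Q ⊗[k] (Q ⊗[k] M)) :
    H.act₂ L.comulCoact (L.Phi⁻¹.val * t)
      (tail Q (appendOne Q M) F * head2 M H.comul L.q) =
      H.act₂ L.coact₂ t L.q₂ * L.Phi.val := by
  rw [L.twist_mul_comul_q hF, H.act₂_mul_right _ _ _ (fun m => (L.coact₂_mul_Phi m).symm),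
    ← H.act₂_mul, ← mul_assoc, Phi_mul_inv, one_mul]

/-- As `S` is bijective, `F` passes every coproduct: `F Δ(a) = (S ⊗ S)(Δᵒᵖ(S⁻¹(a))) F`. Hence the
whole sandwich is a left multiple of `F`. -/
theorem exists_act₂_comulCoact_eq_mul {F : Q ⊗[k] Q} (hF : H.IsTwist F)
    (t : Q ⊗[k] (Q ⊗[k] M)) :
    ∃ Y, H.act₂ L.comulCoact t (tail Q (appendOne Q M) F * head2 M H.comul L.q) =
      Y * tail Q (appendOne Q M) F := by
  have key : ∀ s : Q ⊗[k] M, ∃ Y, tail Q (appendOne Q M) F * head2 M H.comul s =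
      Y * tail Q (appendOne Q M) F := by
    intro s
    induction s using TensorProduct.induction_on with
    | zero => exact ⟨0, by simp⟩
    | add x y hx hy =>
      obtain ⟨X, hX⟩ := hx
      obtain ⟨Y, hY⟩ := hy
      exact ⟨X + Y, by rw [map_add, mul_add, hX, hY, add_mul]⟩
    | tmul a m =>
      refine ⟨asc k Q Q M (H.flipS (H.comul (H.Sinv a)) ⊗ₜ[k] m), ?_⟩
      rw [head2_tmul', ← QuasiHopfCore.asc_tmul_one, asc_mul, asc_mul, hF.mul_comul, one_mul,
        mul_one]
  induction t using TensorProduct.induction_on with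
  | zero => exact ⟨0, by simp⟩
  | add x y hx hy =>
    obtain ⟨X, hX⟩ := hx
    obtain ⟨Y, hY⟩ := hy
    exact ⟨X + Y, by rw [map_add, LinearMap.add_apply, hX, hY, add_mul]⟩
  | tmul a t =>
    induction t using TensorProduct.induction_on with
    | zero => exact ⟨0, by simp⟩
    | add x y hx hy =>
      obtain ⟨X, hX⟩ := hx
      obtain ⟨Y, hY⟩ := hy
      exact ⟨X + Y, by rw [TensorProduct.tmul_add, map_add, LinearMap.add_apply, hX, hY, add_mul]⟩
    | tmul b m =>
      obtain ⟨Y, hY⟩ := key (L.q * L.coact m)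
      refine ⟨(H.S b ⊗ₜ[k] (H.S a ⊗ₜ[k] 1)) * Y, ?_⟩
      rw [H.act₂_tmul, comulCoact_apply, mul_assoc, mul_assoc, ← map_mul, hY, mul_assoc]

theorem exists_mul_twist_eq_one (L : LeftCoaction H M) {F : Q ⊗[k] Q} (hF : H.IsTwist F) (χ : M →ₐ[k] k) :
    ∃ Y, Y * F = 1 := by
  -- With this argument the sandwich equals `Φ` by `act₂_p_q₂`, so `Φ = Y (F ⊗ 1)`; multiplying by
  -- `Φ⁻¹` and applying the character `χ` to the `M`-leg leaves a left inverse of `F`.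
  obtain ⟨Y, hY⟩ := L.exists_act₂_comulCoact_eq_mul hF
    (L.Phi⁻¹.val * (tail Q L.coact L.p * ((1 : Q) ⊗ₜ[k] L.p)))
  rw [L.act₂_comulCoact_twist hF, act₂_p_q₂, one_mul] at hY
  have hd : ∀ z : Q ⊗[k] Q, tail Q (dropTail Q χ) (tail Q (appendOne Q M) z) = z := by
    intro z
    induction z using tensor_induction₂ with
    | add x y hx hy => simp only [map_add, hx, hy]
    | tmul a b => simp
  have h := congrArg (fun x => tail Q (dropTail Q χ) (L.Phi⁻¹.val * x)) hY
  simp only [Phi_inv_mul, map_mul, map_one, hd] at h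
  exact ⟨_, by rw [mul_assoc]; exact h.symm⟩

end LeftCoaction

/-! ### The cocycle identity of the twist. -/

namespace QuasiHopfCore

variable {k : Type u} [Field k] {Q : Type v} [Ring Q] [Algebra k Q] (H : QuasiHopfCore k Q)
variable {M : Type w} [Ring M] [Algebra k M]

theorem act₃_tmul_asc (j : M →ₐ[k] Q ⊗[k] (Q ⊗[k] (Q ⊗[k] M))) (a : Q) (y : Q ⊗[k] Q) (m : M)
    (W : Q ⊗[k] (Q ⊗[k] (Q ⊗[k] M))) :
    H.act₃ j (a ⊗ₜ[k] asc k Q Q M (y ⊗ₜ[k] m)) W =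
      asc k Q Q (Q ⊗[k] M) (H.flipS y ⊗ₜ[k] (H.S a ⊗ₜ[k] 1)) * W * j m := by
  induction y using tensor_induction₂ with
  | add x y hx hy => simp only [map_add, TensorProduct.add_tmul, TensorProduct.tmul_add, add_mul,
      LinearMap.add_apply, hx, hy]
  | tmul b c => simp

theorem act₃_asc_tmul (j : M →ₐ[k] Q ⊗[k] (Q ⊗[k] (Q ⊗[k] M))) (b : Q) (y : Q ⊗[k] Q) (m : M)
    (W : Q ⊗[k] (Q ⊗[k] (Q ⊗[k] M))) :
    H.act₃ j (asc k Q Q (Q ⊗[k] M) (y ⊗ₜ[k] (b ⊗ₜ[k] m))) W =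
      (H.S b ⊗ₜ[k] asc k Q Q M (H.flipS y ⊗ₜ[k] 1)) * W * j m := by
  induction y using tensor_induction₂ with
  | add x y hx hy => simp only [map_add, TensorProduct.add_tmul, TensorProduct.tmul_add, add_mul,
      LinearMap.add_apply, hx, hy]
  | tmul b c => simp

variable {H}

/-- `F` turns `Δ(S(b))` into the flipped image of `Δ(b)`. Since the sandwich reverses legs, a
coproduct on the first leg of the result is a coproduct on the second leg of `t`; in
`mul_tail_head2_act₂` the roles are exchanged. -/
theorem IsTwist.mul_head2_act₂ {F : Q ⊗[k] Q} (hF : H.IsTwist F)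
    (j : M →ₐ[k] Q ⊗[k] (Q ⊗[k] M)) (t W : Q ⊗[k] (Q ⊗[k] M)) :
    asc k Q Q (Q ⊗[k] M) (F ⊗ₜ[k] 1) * head2 (Q ⊗[k] M) H.comul (H.act₂ j t W) =
      H.act₃ ((head2 (Q ⊗[k] M) H.comul).comp j) (tail Q (head2 M H.comul) t)
        (asc k Q Q (Q ⊗[k] M) (F ⊗ₜ[k] 1) * head2 (Q ⊗[k] M) H.comul W) := by
  induction t using tensor_induction₃ with
  | tmul a b m =>
    rw [H.act₂_tmul, tail_tmul, head2_tmul', act₃_tmul_asc, map_mul, map_mul, head2_tmul',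
      ← mul_assoc, ← mul_assoc, ← mul_assoc, asc_mul, asc_mul, hF.mul_comul_S, one_mul, mul_one]
    rfl
  | add x y hx hy => simp only [map_add, mul_add, LinearMap.add_apply, hx, hy]

theorem IsTwist.mul_tail_head2_act₂ {F : Q ⊗[k] Q} (hF : H.IsTwist F)
    (j : M →ₐ[k] Q ⊗[k] (Q ⊗[k] M)) (t W : Q ⊗[k] (Q ⊗[k] M)) :
    ((1 : Q) ⊗ₜ[k] asc k Q Q M (F ⊗ₜ[k] 1)) * tail Q (head2 M H.comul) (H.act₂ j t W) =
      H.act₃ ((tail Q (head2 M H.comul)).comp j) (head2 (Q ⊗[k] M) H.comul t)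
        (((1 : Q) ⊗ₜ[k] asc k Q Q M (F ⊗ₜ[k] 1)) * tail Q (head2 M H.comul) W) := by
  induction t using tensor_induction₃ with
  | tmul a b m =>
    rw [H.act₂_tmul, head2_tmul', act₃_asc_tmul, map_mul, map_mul, tail_tmul, head2_tmul',
      ← mul_assoc, ← mul_assoc, ← mul_assoc, Algebra.TensorProduct.tmul_mul_tmul,
      Algebra.TensorProduct.tmul_mul_tmul, asc_mul, asc_mul, hF.mul_comul_S, one_mul, mul_one,
      mul_one]
    rfl
  | add x y hx hy => simp only [map_add, mul_add, LinearMap.add_apply, hx, hy]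

end QuasiHopfCore

namespace LeftCoaction

variable {k : Type u} [Field k] {Q : Type v} [Ring Q] [Algebra k Q] {H : QuasiHopfCore k Q}
variable {M : Type w} [Ring M] [Algebra k M] (L : LeftCoaction H M)

/-- `(1 ⊗ q₂) (id ⊗ (id ⊗ λ)λ)(q)` -/
def q₃ : Q ⊗[k] (Q ⊗[k] (Q ⊗[k] M)) := ((1 : Q) ⊗ₜ[k] L.q₂) * tail Q L.coact₂ L.q

theorem q₃_eq : L.q₃ = ((1 : Q) ⊗ₜ[k] ((1 : Q) ⊗ₜ[k] L.q)) * tail Q (tail Q L.coact) L.q₂ := by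
  rw [q₃, q₂, map_mul, tail_tmul, tail_tail_apply, ← mul_assoc,
    Algebra.TensorProduct.tmul_mul_tmul, one_mul]
  rfl

theorem mul_tail_tail_act₂ (t : Q ⊗[k] (Q ⊗[k] M)) :
    ((1 : Q) ⊗ₜ[k] ((1 : Q) ⊗ₜ[k] L.q)) * tail Q (tail Q L.coact) (H.act₂ L.coact₂ t L.q₂) =
      H.act₃ L.coact₃ ((1 : Q) ⊗ₜ[k] t) L.q₃ := by
  induction t using tensor_induction₃ with
  | tmul a b m =>
    rw [H.act₂_tmul, H.act₃_tmul, q₃_eq, map_mul, map_mul, coact₃_apply', tail_tmul, tail_tmul,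
      map_one L.coact, H.S_one, ← Algebra.TensorProduct.one_def]
    simp only [← mul_assoc, Algebra.TensorProduct.tmul_mul_tmul, mul_one, one_mul]
  | add x y hx hy =>
    simp only [map_add, mul_add, LinearMap.add_apply, TensorProduct.tmul_add, hx, hy]

theorem act₃_tmul_q₃ (a b : Q) (y : Q ⊗[k] M) :
    H.act₃ L.coact₃ (a ⊗ₜ[k] (b ⊗ₜ[k] y)) L.q₃ =
      ((1 : Q) ⊗ₜ[k] ((H.S b ⊗ₜ[k] (H.S a ⊗ₜ[k] 1)) * L.q₂)) *
        tail Q L.coact₂ (L.act y L.q) := by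
  induction y using tensor_induction₂ with
  | add x y hx hy =>
    simp only [map_add, mul_add, LinearMap.add_apply, TensorProduct.tmul_add, hx, hy]
  | tmul c m =>
    rw [H.act₃_tmul, q₃, act, H.act₁_tmul, map_mul, map_mul, tail_tmul, map_one L.coact₂,
      coact₃_apply]
    simp only [← mul_assoc, Algebra.TensorProduct.tmul_mul_tmul, mul_one, one_mul]

theorem one_tmul_act₂_mul (t : Q ⊗[k] (Q ⊗[k] M)) :
    ((1 : Q) ⊗ₜ[k] H.act₂ L.coact₂ t L.q₂) * tail Q L.coact₂ L.q =
      H.act₃ L.coact₃ (tail Q (tail Q L.coact) t) L.q₃ := by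
  induction t using tensor_induction₃ with
  | tmul a b m =>
    rw [H.act₂_tmul, tail_tmul, tail_tmul, act₃_tmul_q₃, act_q, map_mul, tail_tmul, ← mul_assoc,
      Algebra.TensorProduct.tmul_mul_tmul, one_mul]
  | add x y hx hy =>
    simp only [map_add, add_mul, LinearMap.add_apply, TensorProduct.tmul_add, hx, hy]

theorem one_tmul_Phi_mul (x : Q ⊗[k] M) :
    ((1 : Q) ⊗ₜ[k] L.Phi.val) * tail Q L.comulCoact x =
      tail Q L.coact₂ x * ((1 : Q) ⊗ₜ[k] L.Phi.val) := by
  induction x using tensor_induction₂ with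
  | add x y hx hy => simp only [map_add, add_mul, mul_add, hx, hy]
  | tmul a m => simp [coact₂_mul_Phi]

theorem tail_tail_coact_asc_one (F : Q ⊗[k] Q) :
    asc k Q Q (Q ⊗[k] M) (F ⊗ₜ[k] 1) =
      tail Q (tail Q L.coact) (tail Q (appendOne Q M) F) := by
  rw [← QuasiHopfCore.asc_tmul_one, tail_tail_asc, map_one]

theorem asc_one_mul_comm (F : Q ⊗[k] Q) (y : Q ⊗[k] M) :
    asc k Q Q (Q ⊗[k] M) (F ⊗ₜ[k] 1) * ((1 : Q) ⊗ₜ[k] ((1 : Q) ⊗ₜ[k] y)) =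
      ((1 : Q) ⊗ₜ[k] ((1 : Q) ⊗ₜ[k] y)) * asc k Q Q (Q ⊗[k] M) (F ⊗ₜ[k] 1) := by
  rw [← asc_tmul, asc_mul, asc_mul, ← Algebra.TensorProduct.one_def, one_mul, one_mul, mul_one,
    mul_one]

/-- the first bracketing of the pentagon -/
def pent₁ : Q ⊗[k] (Q ⊗[k] (Q ⊗[k] M)) :=
  ((1 : Q) ⊗ₜ[k] L.Phi.val) * tail Q (head2 M H.comul) L.Phi.val

/-- the second bracketing of the pentagon -/
def pent₂ : Q ⊗[k] (Q ⊗[k] (Q ⊗[k] M)) :=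
  tail Q (tail Q L.coact) L.Phi.val * head2 (Q ⊗[k] M) H.comul L.Phi.val

theorem pent₁_mul : L.pent₁ * padOne M H.phi.val = L.pent₂ := L.pentagon

/-- The central formula is used once for the inner twist and once for the outer one. The factors `Φ`
produced inside the sandwich form one side of the pentagon, and those produced on the right form the
other. `twist_twist_right` has the two sides interchanged. -/
theorem twist_twist_left {F : Q ⊗[k] Q} (hF : H.IsTwist F) :
    asc k Q Q (Q ⊗[k] M) (F ⊗ₜ[k] 1) *
      head2 (Q ⊗[k] M) H.comul (tail Q (appendOne Q M) F * head2 M H.comul L.q) =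
      H.act₃ L.coact₃ L.pent₁ L.q₃ * L.pent₂ := by
  have h1 : asc k Q Q (Q ⊗[k] M) (F ⊗ₜ[k] 1) * head2 (Q ⊗[k] M) H.comul L.q₂ =
      H.act₃ L.coact₃ ((1 : Q) ⊗ₜ[k] L.Phi.val) L.q₃ * tail Q (tail Q L.coact) L.Phi.val := by
    rw [q₂, map_mul, head2_one_tmul, ← tail_tail_head2, ← mul_assoc, asc_one_mul_comm, mul_assoc,
      tail_tail_coact_asc_one L, ← map_mul, L.twist_mul_comul_q hF, map_mul, ← mul_assoc,
      mul_tail_tail_act₂]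
  have h2 : ∀ m, tail Q (tail Q L.coact) L.Phi.val * head2 (Q ⊗[k] M) H.comul (L.coact₂ m) =
      L.coact₃ m * tail Q (tail Q L.coact) L.Phi.val := by
    intro m
    rw [coact₂_apply, ← tail_tail_head2, ← map_mul, ← comulCoact_apply, ← coact₂_mul_Phi,
      map_mul, coact₃_apply']
  rw [L.twist_mul_comul_q hF, map_mul, ← mul_assoc, hF.mul_head2_act₂, h1,
    H.act₃_mul_right L.coact₃ _ _ h2, ← H.act₃_mul, mul_assoc]
  rfl

theorem twist_twist_right {F : Q ⊗[k] Q} (hF : H.IsTwist F) :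
    ((1 : Q) ⊗ₜ[k] asc k Q Q M (F ⊗ₜ[k] 1)) *
      tail Q (head2 M H.comul) (tail Q (appendOne Q M) F * head2 M H.comul L.q) =
      H.act₃ L.coact₃ L.pent₂ L.q₃ * L.pent₁ := by
  have h1 : ((1 : Q) ⊗ₜ[k] asc k Q Q M (F ⊗ₜ[k] 1)) * tail Q (head2 M H.comul) L.q₂ =
      H.act₃ L.coact₃ (tail Q (tail Q L.coact) L.Phi.val) L.q₃ * ((1 : Q) ⊗ₜ[k] L.Phi.val) := by
    rw [q₂, map_mul, tail_tmul, tail_tail_apply, ← mul_assoc,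
      Algebra.TensorProduct.tmul_mul_tmul, one_mul, QuasiHopfCore.asc_tmul_one,
      L.twist_mul_comul_q hF, ← one_tmul_act₂_mul, mul_assoc _ _ (1 ⊗ₜ[k] L.Phi.val),
      ← one_tmul_Phi_mul, ← mul_assoc, Algebra.TensorProduct.tmul_mul_tmul, one_mul]
    rfl
  have h2 : ∀ m, ((1 : Q) ⊗ₜ[k] L.Phi.val) * tail Q (head2 M H.comul) (L.coact₂ m) =
      L.coact₃ m * ((1 : Q) ⊗ₜ[k] L.Phi.val) := by
    intro m
    rw [coact₂_apply, tail_tail_apply, coact₃_apply, ← one_tmul_Phi_mul]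
    rfl
  rw [L.twist_mul_comul_q hF, map_mul, ← mul_assoc, hF.mul_tail_head2_act₂, h1,
    H.act₃_mul_right L.coact₃ _ _ h2, ← H.act₃_mul, mul_assoc]
  rfl

/-- The two sides of the pentagon differ by `φ ⊗ 1` on the right. On the outside this supplies the
factor `φ`; inside the sandwich the same factor is emitted on the left as the `S`-flip of `φ`. -/
theorem twist_twist {F : Q ⊗[k] Q} (hF : H.IsTwist F) :
    ((1 : Q) ⊗ₜ[k] asc k Q Q M (F ⊗ₜ[k] 1)) *
      tail Q (head2 M H.comul) (tail Q (appendOne Q M) F * head2 M H.comul L.q) *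
        padOne M H.phi.val =
    padOne M (H.flipS₃ H.phi.val) * (asc k Q Q (Q ⊗[k] M) (F ⊗ₜ[k] 1) *
      head2 (Q ⊗[k] M) H.comul (tail Q (appendOne Q M) F * head2 M H.comul L.q)) := by
  rw [L.twist_twist_right hF, L.twist_twist_left hF, mul_assoc, pent₁_mul, ← mul_assoc]
  congr 1
  rw [← pent₁_mul, H.act₃_mul, ← asc3_tmul_one, H.act₃_asc, map_one, mul_one]

end LeftCoaction

section Padding

variable {k : Type u} [Field k] {Q : Type v} [Ring Q] [Algebra k Q] (f : Q →ₐ[k] Q ⊗[k] Q)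
variable {M : Type w} [Ring M] [Algebra k M]

theorem head2_appendOne (F : Q ⊗[k] Q) :
    head2 (Q ⊗[k] M) f (tail Q (appendOne Q M) F) = padOne M (head2 Q f F) := by
  rw [tail_tail_head2]

theorem tail_head2_appendOne (F : Q ⊗[k] Q) :
    tail Q (head2 M f) (tail Q (appendOne Q M) F) = padOne M (tail Q f F) := by
  rw [tail_tail_apply, tail_tail_apply]
  congr 2
  ext a
  rw [AlgHom.comp_apply, AlgHom.comp_apply, appendOne_apply, head2_tmul',
    QuasiHopfCore.asc_tmul_one]

theorem padOne_appendOne (F : Q ⊗[k] Q) :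
    padOne M (tail Q (appendOne Q Q) F) = asc k Q Q (Q ⊗[k] M) (F ⊗ₜ[k] 1) := by
  rw [← QuasiHopfCore.asc_tmul_one, tail_tail_asc]
  rfl

end Padding

namespace QuasiHopfCore

variable {k : Type u} [Field k] {Q : Type v} [Ring Q] [Algebra k Q] {H : QuasiHopfCore k Q}

theorem flipS₃_asc (y : Q ⊗[k] Q) (a : Q) :
    H.flipS₃ (asc k Q Q Q (y ⊗ₜ[k] a)) = H.S a ⊗ₜ[k] H.flipS y := by
  induction y using tensor_induction₂ with
  | add x y hx hy => simp only [map_add, TensorProduct.add_tmul, TensorProduct.tmul_add, hx, hy]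
  | tmul b c => simp

theorem IsTwist.left_comul_S {F : Q ⊗[k] Q} (hF : H.IsTwist F) (a : Q) :
    tail Q (appendOne Q Q) F * head2 Q H.comul F * head2 Q H.comul (H.comul (H.S a)) =
      H.flipS₃ (tail Q H.comul (H.comul a)) *
        (tail Q (appendOne Q Q) F * head2 Q H.comul F) := by
  rw [mul_assoc, ← map_mul, hF.mul_comul_S, map_mul, ← mul_assoc, ← mul_assoc]
  congr 1
  generalize H.comul a = y
  induction y using tensor_induction₂ with
  | add x y hx hy => simp only [map_add, add_mul, mul_add, hx, hy]
  | tmul b c =>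
    rw [flipS_tmul, tail_tmul, flipS₃_tmul, head2_tmul', ← asc_tmul_one, asc_mul, asc_mul,
      hF.mul_comul_S, one_mul, mul_one]

theorem IsTwist.right_comul_S {F : Q ⊗[k] Q} (hF : H.IsTwist F) (a : Q) :
    ((1 : Q) ⊗ₜ[k] F) * tail Q H.comul F * tail Q H.comul (H.comul (H.S a)) =
      H.flipS₃ (head2 Q H.comul (H.comul a)) * (((1 : Q) ⊗ₜ[k] F) * tail Q H.comul F) := by
  rw [mul_assoc, ← map_mul, hF.mul_comul_S, map_mul, ← mul_assoc, ← mul_assoc]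
  congr 1
  generalize H.comul a = y
  induction y using tensor_induction₂ with
  | add x y hx hy => simp only [map_add, add_mul, mul_add, hx, hy]
  | tmul b c =>
    rw [flipS_tmul, tail_tmul, head2_tmul', flipS₃_asc, Algebra.TensorProduct.tmul_mul_tmul,
      Algebra.TensorProduct.tmul_mul_tmul, hF.mul_comul_S, one_mul, mul_one]

/-- Right cancellation of `q`. -/
theorem eq_of_mul_q_eq {M : Type w} [Ring M] [Algebra k M] (L : LeftCoaction H M)
    (χ : M →ₐ[k] k) {σ : Q → Q ⊗[k] (Q ⊗[k] Q)} {v v' : Q ⊗[k] (Q ⊗[k] Q)}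
    (hv : ∀ a, v * head2 Q H.comul (H.comul (H.S a)) = σ a * v)
    (hv' : ∀ a, v' * head2 Q H.comul (H.comul (H.S a)) = σ a * v')
    (h : padOne M v * head2 (Q ⊗[k] M) H.comul (head2 M H.comul L.q) =
      padOne M v' * head2 (Q ⊗[k] M) H.comul (head2 M H.comul L.q)) : v = v' := by
  have hS : ∀ b : Q, head2 (Q ⊗[k] M) H.comul (head2 M H.comul (b ⊗ₜ[k] (1 : M))) =
      padOne M (head2 Q H.comul (H.comul b)) := by
    intro b
    rw [head2_tmul', asc_tmul_one, head2_appendOne]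
  -- Both `v` and `v'` carry the coproducts of `S(a)` to the left as the same `σ a`, so agreement on
  -- `q` propagates to every sandwich of `q`.
  have key : ∀ r : Q ⊗[k] M,
      padOne M v * head2 (Q ⊗[k] M) H.comul (head2 M H.comul (L.act r L.q)) =
      padOne M v' * head2 (Q ⊗[k] M) H.comul (head2 M H.comul (L.act r L.q)) := by
    intro r
    induction r using tensor_induction₂ with
    | add x y hx hy => simp only [map_add, LinearMap.add_apply, mul_add, hx, hy]
    | tmul a m =>
      rw [LeftCoaction.act, act₁_tmul]
      simp only [map_mul, hS]
      simp only [← mul_assoc]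
      rw [← map_mul, ← map_mul, hv, hv', map_mul, map_mul, mul_assoc _ (padOne M v),
        mul_assoc _ (padOne M v'), h]
  -- For `r = p` the sandwiched `q` is `1`.
  have h1 := key L.p
  rw [L.act_p_q, map_one, map_one, mul_one, mul_one] at h1
  have hd : ∀ z : Q ⊗[k] (Q ⊗[k] Q), tail Q (tail Q (dropTail Q χ)) (padOne M z) = z := by
    intro z
    rw [tail_tail_apply, tail_comp]
    have : (dropTail Q χ).comp (appendOne Q M) = AlgHom.id k Q := by ext; simp
    rw [this]
    simp [tail]
  rw [← hd v, h1, hd]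

/-- Both sides intertwine `(Δ ⊗ id)Δ(S(a))` with the flip of `(Δ ⊗ id)Δ(a)`, by the twist identities
and quasi-coassociativity, and `twist_twist` says that they agree after multiplication by the
iterated coproduct of `q`. Right cancellation of `q` finishes the proof. -/
theorem IsTwist.cocycle {M : Type w} [Ring M] [Algebra k M] {F : Q ⊗[k] Q} (hF : H.IsTwist F)
    (L : LeftCoaction H M) (χ : M →ₐ[k] k) :
    ((1 : Q) ⊗ₜ[k] F) * tail Q H.comul F * H.phi.val =
      H.flipS₃ H.phi.val * (tail Q (appendOne Q Q) F * head2 Q H.comul F) := by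
  refine eq_of_mul_q_eq L χ (σ := fun a => H.flipS₃ (head2 Q H.comul (H.comul a))) ?_ ?_ ?_
  · intro a
    rw [mul_assoc _ H.phi.val, ← H.quasi_coassoc, ← mul_assoc, hF.right_comul_S]
    simp only [mul_assoc]
  · intro a
    rw [mul_assoc, hF.left_comul_S, ← mul_assoc, ← flipS₃_mul, H.quasi_coassoc, flipS₃_mul,
      mul_assoc]
  · have h := L.twist_twist hF
    have e : ((1 : Q) ⊗ₜ[k] asc k Q Q M (F ⊗ₜ[k] 1)) = padOne M ((1 : Q) ⊗ₜ[k] F) := by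
      rw [asc_tmul_one]; rfl
    rw [map_mul, tail_head2_appendOne, mul_assoc, mul_assoc, LeftCoaction.comul_comul_mul_phi, map_mul,
      head2_appendOne, ← padOne_appendOne, e] at h
    simp only [map_mul, mul_assoc]
    exact h

end QuasiHopfCore

/-! ### Tensors with a dual space as linear maps. -/

section DualTensor

variable {k : Type u} [Field k] {C M : Type*} [AddCommGroup C] [Module k C] [FiniteDimensional k C]
  [Ring M] [Algebra k M]

/-- For finite dimensional `C` the space `C^* ⊗ M` is `Hom(C, M)`; identities in the crossed
products are therefore checked by evaluation on points of `C`. -/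
theorem dualTensor_ext {w w' : Module.Dual k C ⊗[k] M}
    (h : ∀ x, dualTensorHom k C M w x = dualTensorHom k C M w' x) : w = w' := by
  apply (dualTensorHomEquiv k C M).injective
  ext x
  simpa using h x

theorem tensorDual_ext {w w' : M ⊗[k] Module.Dual k C}
    (h : ∀ x, dualTensorHom k C M (TensorProduct.comm k M (Module.Dual k C) w) x =
      dualTensorHom k C M (TensorProduct.comm k M (Module.Dual k C) w') x) : w = w' :=
  (TensorProduct.comm k M (Module.Dual k C)).injective (dualTensor_ext h)

end DualTensor

/-! ### Inverse antipode flips and module coalgebras. -/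

namespace QuasiHopfCore

variable {k : Type u} [Field k] {Q : Type v} [Ring Q] [Algebra k Q] (H : QuasiHopfCore k Q)

/-- `a ⊗ b ↦ S⁻¹(b) ⊗ S⁻¹(a)` -/
def flipSinv : Q ⊗[k] Q →ₗ[k] Q ⊗[k] Q :=
  TensorProduct.map H.Sinv H.Sinv ∘ₗ (TensorProduct.comm k Q Q).toLinearMap

@[simp] theorem flipSinv_tmul (a b : Q) :
    H.flipSinv (a ⊗ₜ[k] b) = H.Sinv b ⊗ₜ[k] H.Sinv a := rfl

theorem flipSinv_mul (x y : Q ⊗[k] Q) : H.flipSinv (x * y) = H.flipSinv y * H.flipSinv x := by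
  induction x using tensor_induction₂ with
  | add x y hx hy => simp only [map_add, hx, hy, add_mul, mul_add]
  | tmul a m =>
    induction y using tensor_induction₂ with
    | add x y hx hy => simp only [map_add, hx, hy, mul_add, add_mul]
    | tmul b n => simp [Sinv_mul]

@[simp] theorem flipSinv_flipS (x : Q ⊗[k] Q) : H.flipSinv (H.flipS x) = x := by
  induction x using tensor_induction₂ with
  | add x y hx hy => simp only [map_add, hx, hy]
  | tmul a m => simp

variable (M : Type w) [Ring M] [Algebra k M]

/-- `a ⊗ b ⊗ m ↦ S⁻¹(b) ⊗ S⁻¹(a) ⊗ m` -/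
def flipLegs : Q ⊗[k] (Q ⊗[k] M) →ₗ[k] Q ⊗[k] (Q ⊗[k] M) :=
  (asc k Q Q M).toLinearMap ∘ₗ H.flipSinv.rTensor M ∘ₗ
    (asc k Q Q M).symm.toLinearMap

variable {M}

@[simp] theorem flipLegs_tmul (a b : Q) (m : M) : H.flipLegs M (a ⊗ₜ[k] (b ⊗ₜ[k] m)) =
    H.Sinv b ⊗ₜ[k] (H.Sinv a ⊗ₜ[k] m) := rfl

theorem flipLegs_asc (y : Q ⊗[k] Q) (m : M) :
    H.flipLegs M (asc k Q Q M (y ⊗ₜ[k] m)) =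
      asc k Q Q M (H.flipSinv y ⊗ₜ[k] m) := by
  induction y using tensor_induction₂ with
  | add x y hx hy => simp only [map_add, hx, hy, TensorProduct.add_tmul]
  | tmul a m => simp

theorem flipLegs_tmul_mul (a b : Q) (m : M) (t : Q ⊗[k] (Q ⊗[k] M)) :
    H.flipLegs M ((b ⊗ₜ[k] (a ⊗ₜ[k] m)) * t) =
      ((1 : Q) ⊗ₜ[k] ((1 : Q) ⊗ₜ[k] m)) * H.flipLegs M t *
        (H.Sinv a ⊗ₜ[k] (H.Sinv b ⊗ₜ[k] 1)) := by
  induction t using tensor_induction₃ with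
  | tmul c d n => simp [Sinv_mul]
  | add x y hx hy => simp only [map_add, hx, hy, add_mul, mul_add]

/-- A coalgebra in the category of right modules. -/
structure ModuleCoalgebra (C : Type*) [AddCommGroup C] [Module k C] where
  act : Q →ₗ[k] Module.End k C
  act_one : act 1 = 1
  act_mul : ∀ a b, act (a * b) = act b * act a
  comul : C →ₗ[k] C ⊗[k] C
  counit : C →ₗ[k] k
  counit_act : ∀ a x, counit (act a x) = H.counit a * counit x
  comul_act : ∀ a x, comul (act a x) =
    TensorProduct.homTensorHomMap (RingHom.id k) C C C C
      (TensorProduct.map act act (H.comul a)) (comul x)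
  coassoc : ∀ x, comul.lTensor C (comul x) =
    TensorProduct.homTensorHomMap (RingHom.id k) C (C ⊗[k] C) C (C ⊗[k] C)
      (TensorProduct.map act (TensorProduct.homTensorHomMap (RingHom.id k) C C C C ∘ₗ
        TensorProduct.map act act) H.phi⁻¹.val)
      (TensorProduct.assoc k C C C (comul.rTensor C (comul x)))
  counit_left : ∀ x, TensorProduct.lid k C (counit.rTensor C (comul x)) = x
  counit_right : ∀ x, TensorProduct.rid k C (counit.lTensor C (comul x)) = x

end QuasiHopfCore

/-! ### Pairing functionals with tensors through a right action. -/

section Pairings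

variable {k : Type u} [Field k] {Q : Type v} [Ring Q] [Algebra k Q]
variable {M : Type w} [Ring M] [Algebra k M] {C : Type*} [AddCommGroup C] [Module k C]
variable (ρ : Q →ₗ[k] Module.End k C)

/-- `(x, a ⊗ m) ↦ φ(x · a) m` -/
def pair₁ (φ : Module.Dual k C) : C →ₗ[k] Q ⊗[k] M →ₗ[k] M :=
  (TensorProduct.lid k M).toLinearMap.compRight k (M := Q ⊗[k] M) ∘ₗ
    (LinearMap.rTensorHom M) ∘ₗ (φ.compRight k ∘ₗ ρ.flip)

@[simp] theorem pair₁_tmul (φ : Module.Dual k C) (x : C) (a : Q) (m : M) :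
    pair₁ ρ φ x (a ⊗ₜ[k] m) = φ (ρ a x) • m := by
  simp [pair₁]

variable {Y T : Type*} [AddCommGroup Y] [Module k Y] [AddCommGroup T] [Module k T]

/-- `(x ⊗ y, a ⊗ t) ↦ φ(x · a) B(y, t)` -/
def pairStep (φ : Module.Dual k C) (B : Y →ₗ[k] T →ₗ[k] M) :
    C ⊗[k] Y →ₗ[k] Q ⊗[k] T →ₗ[k] M :=
  (TensorProduct.map₂ (φ.compRight k ∘ₗ ρ.flip) B).compr₂ (TensorProduct.lid k M).toLinearMap

@[simp] theorem pairStep_tmul (φ : Module.Dual k C) (B : Y →ₗ[k] T →ₗ[k] M) (x : C) (y : Y)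
    (a : Q) (t : T) :
    pairStep ρ φ B (x ⊗ₜ[k] y) (a ⊗ₜ[k] t) = φ (ρ a x) • B y t := by
  simp [pairStep]

/-- `(x ⊗ y, a ⊗ b ⊗ m) ↦ φ(x · a) ψ(y · b) m` -/
def pair₂ (φ ψ : Module.Dual k C) : C ⊗[k] C →ₗ[k] Q ⊗[k] (Q ⊗[k] M) →ₗ[k] M :=
  pairStep ρ φ (pair₁ ρ ψ)

/-- `(x ⊗ y ⊗ z, a ⊗ b ⊗ c ⊗ m) ↦ φ(x · a) ψ(y · b) χ(z · c) m` -/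
def pair₃ (φ ψ χ : Module.Dual k C) :
    C ⊗[k] (C ⊗[k] C) →ₗ[k] Q ⊗[k] (Q ⊗[k] (Q ⊗[k] M)) →ₗ[k] M :=
  pairStep ρ φ (pair₂ ρ ψ χ)

@[simp] theorem pair₂_tmul (φ ψ : Module.Dual k C) (x y : C) (a b : Q) (m : M) :
    pair₂ ρ φ ψ (x ⊗ₜ[k] y) (a ⊗ₜ[k] (b ⊗ₜ[k] m)) = (φ (ρ a x) * ψ (ρ b y)) • m := by
  simp [pair₂, mul_smul]

/-- the action of `a ⊗ b` on `C ⊗ C` -/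
def tensorAct : Q ⊗[k] Q →ₗ[k] Module.End k (C ⊗[k] C) :=
  TensorProduct.homTensorHomMap (RingHom.id k) C C C C ∘ₗ TensorProduct.map ρ ρ

@[simp] theorem tensorAct_tmul (a b : Q) (x y : C) :
    tensorAct ρ (a ⊗ₜ[k] b) (x ⊗ₜ[k] y) = ρ a x ⊗ₜ[k] ρ b y := rfl

/-- the action of `a ⊗ b ⊗ c` on `C ⊗ C ⊗ C` -/
def tensorAct₃ : Q ⊗[k] (Q ⊗[k] Q) →ₗ[k] Module.End k (C ⊗[k] (C ⊗[k] C)) :=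
  TensorProduct.homTensorHomMap (RingHom.id k) C (C ⊗[k] C) C (C ⊗[k] C) ∘ₗ
    TensorProduct.map ρ (tensorAct ρ)

@[simp] theorem tensorAct₃_tmul (a : Q) (s : Q ⊗[k] Q) (x : C) (y : C ⊗[k] C) :
    tensorAct₃ ρ (a ⊗ₜ[k] s) (x ⊗ₜ[k] y) = ρ a x ⊗ₜ[k] tensorAct ρ s y := rfl

/-- An action on the points becomes left multiplication on the paired tensor, because `ρ` is a right
action. The threefold version converts the coassociativity defect of `C` into a factor `φ⁻¹`. -/
theorem pair₂_tensorAct (hρ : ∀ a b, ρ (a * b) = ρ b * ρ a) (φ ψ : Module.Dual k C) (r : Q ⊗[k] Q) (y : C ⊗[k] C)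
    (t : Q ⊗[k] (Q ⊗[k] M)) :
    pair₂ ρ φ ψ (tensorAct ρ r y) t = pair₂ ρ φ ψ y (tail Q (appendOne Q M) r * t) := by
  induction r using tensor_induction₂ with
  | add x y hx hy => simp only [map_add, add_mul, LinearMap.add_apply, hx, hy]
  | tmul a b =>
    induction y using tensor_induction₂ with
    | add x y hx hy => simp only [map_add, LinearMap.add_apply, hx, hy]
    | tmul x y =>
      induction t using tensor_induction₃ with
      | tmul c d m => simp [hρ]
      | add x y hx hy => simp only [map_add, mul_add, hx, hy]

theorem pair₃_tensorAct₃ (hρ : ∀ a b, ρ (a * b) = ρ b * ρ a) (φ ψ χ : Module.Dual k C)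
    (r : Q ⊗[k] (Q ⊗[k] Q)) (y : C ⊗[k] (C ⊗[k] C)) (t : Q ⊗[k] (Q ⊗[k] (Q ⊗[k] M))) :
    pair₃ ρ φ ψ χ (tensorAct₃ ρ r y) t = pair₃ ρ φ ψ χ y (padOne M r * t) := by
  induction r using tensor_induction₂ with
  | add x y hx hy => simp only [map_add, add_mul, LinearMap.add_apply, hx, hy]
  | tmul a b =>
    induction y using tensor_induction₂ with
    | add x y hx hy => simp only [map_add, LinearMap.add_apply, hx, hy]
    | tmul x y =>
      induction t using tensor_induction₂ with
      | add x y hx hy => simp only [map_add, mul_add, hx, hy]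
      | tmul c t =>
        have h := pair₂_tensorAct ρ hρ ψ χ b y t
        simp only [pair₃, tensorAct₃_tmul, pairStep_tmul, padOne, tail_tmul,
          Algebra.TensorProduct.tmul_mul_tmul, h, hρ, Module.End.mul_apply]

end Pairings

section Pairings

variable {k : Type u} [Field k] {Q : Type v} [Ring Q] [Algebra k Q]
variable {M : Type w} [Ring M] [Algebra k M] {C : Type*} [AddCommGroup C] [Module k C]
variable (ρ : Q →ₗ[k] Module.End k C)

theorem mul_pair₁ (φ : Module.Dual k C) (x : C) (s : Q ⊗[k] M) (m : M) :
    m * pair₁ ρ φ x s = pair₁ ρ φ x (((1 : Q) ⊗ₜ[k] m) * s) := by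
  induction s using tensor_induction₂ with
  | add x y hx hy => simp only [map_add, mul_add, hx, hy]
  | tmul a n => simp

theorem mul_pair₂ (φ ψ : Module.Dual k C) (y : C ⊗[k] C) (t : Q ⊗[k] (Q ⊗[k] M)) (m : M) :
    m * pair₂ ρ φ ψ y t = pair₂ ρ φ ψ y (((1 : Q) ⊗ₜ[k] ((1 : Q) ⊗ₜ[k] m)) * t) := by
  induction y using tensor_induction₂ with
  | add x y hx hy => simp only [map_add, mul_add, LinearMap.add_apply, hx, hy]
  | tmul x y =>
    induction t using tensor_induction₂ with
    | add x y hx hy => simp only [map_add, mul_add, hx, hy]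
    | tmul a t =>
      simp only [pair₂, pairStep_tmul, Algebra.TensorProduct.tmul_mul_tmul, one_mul,
        mul_smul_comm, mul_pair₁]

theorem pair₂_mul (φ ψ : Module.Dual k C) (y : C ⊗[k] C) (t : Q ⊗[k] (Q ⊗[k] M)) (m : M) :
    pair₂ ρ φ ψ y t * m = pair₂ ρ φ ψ y (t * ((1 : Q) ⊗ₜ[k] ((1 : Q) ⊗ₜ[k] m))) := by
  induction y using tensor_induction₂ with
  | add x y hx hy => simp only [map_add, add_mul, LinearMap.add_apply, hx, hy]
  | tmul x y =>
    induction t using tensor_induction₃ with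
    | tmul a b m => simp
    | add x y hx hy => simp only [map_add, add_mul, hx, hy]

theorem tensorAct_mul (hρ : ∀ a b, ρ (a * b) = ρ b * ρ a) (r s : Q ⊗[k] Q) (y : C ⊗[k] C) :
    tensorAct ρ (r * s) y = tensorAct ρ s (tensorAct ρ r y) := by
  induction y using tensor_induction₂ with
  | add x y hx hy => simp only [map_add, hx, hy]
  | tmul x y =>
    induction r using tensor_induction₂ with
    | add x y hx hy => simp only [map_add, add_mul, LinearMap.add_apply, hx, hy]
    | tmul a b =>
      induction s using tensor_induction₂ with
      | add x y hx hy => simp only [map_add, mul_add, LinearMap.add_apply, hx, hy]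
      | tmul c d => simp [hρ]

theorem pair₂_asc (φ ψ : Module.Dual k C) (y : C ⊗[k] C) (r : Q ⊗[k] Q) (m : M) :
    pair₂ ρ φ ψ y (asc k Q Q M (r ⊗ₜ[k] m)) =
      TensorProduct.dualDistrib k C C (φ ⊗ₜ[k] ψ) (tensorAct ρ r y) • m := by
  induction y using tensor_induction₂ with
  | add x y hx hy => simp only [map_add, add_smul, LinearMap.add_apply, hx, hy]
  | tmul x y =>
    induction r using tensor_induction₂ with
    | add x y hx hy => simp only [map_add, TensorProduct.add_tmul, add_smul, LinearMap.add_apply,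
        hx, hy]
    | tmul a b => simp

theorem pair₃_asc (φ ψ χ : Module.Dual k C) (z : C ⊗[k] C) (y : C) (r : Q ⊗[k] Q)
    (u : Q ⊗[k] M) :
    pair₃ ρ φ ψ χ (TensorProduct.assoc k C C C (z ⊗ₜ[k] y))
        (asc k Q Q (Q ⊗[k] M) (r ⊗ₜ[k] u)) =
      TensorProduct.dualDistrib k C C (φ ⊗ₜ[k] ψ) (tensorAct ρ r z) • pair₁ ρ χ y u := by
  induction z using tensor_induction₂ with
  | add x y hx hy => simp only [map_add, add_smul, LinearMap.add_apply, TensorProduct.add_tmul,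
      hx, hy]
  | tmul x y =>
    induction r using tensor_induction₂ with
    | add x y hx hy => simp only [map_add, TensorProduct.add_tmul, add_smul, LinearMap.add_apply,
        hx, hy]
    | tmul a b => simp [pair₃, pair₂, mul_smul]

theorem pair₂_tmul_left (φ ψ : Module.Dual k C) (x y : C) (a : Q) (s : Q ⊗[k] M) :
    pair₂ ρ φ ψ (x ⊗ₜ[k] y) (a ⊗ₜ[k] s) = φ (ρ a x) • pair₁ ρ ψ y s := by
  simp [pair₂]

theorem pair₃_tmul_left (φ ψ χ : Module.Dual k C) (x : C) (y : C ⊗[k] C) (a : Q)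
    (s : Q ⊗[k] (Q ⊗[k] M)) :
    pair₃ ρ φ ψ χ (x ⊗ₜ[k] y) (a ⊗ₜ[k] s) = φ (ρ a x) • pair₂ ρ ψ χ y s := by
  simp [pair₃]

theorem pair₁_comp (hρ : ∀ a b, ρ (a * b) = ρ b * ρ a) (φ : Module.Dual k C) (a : Q) (x : C)
    (s : Q ⊗[k] M) :
    pair₁ ρ (φ ∘ₗ ρ a) x s = pair₁ ρ φ x (s * (a ⊗ₜ[k] 1)) := by
  induction s using tensor_induction₂ with
  | add x y hx hy => simp only [map_add, add_mul, hx, hy]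
  | tmul b m => simp [hρ]

theorem pair₂_comp (hρ : ∀ a b, ρ (a * b) = ρ b * ρ a) (φ ψ : Module.Dual k C) (a b : Q)
    (y : C ⊗[k] C) (s : Q ⊗[k] (Q ⊗[k] M)) :
    pair₂ ρ (φ ∘ₗ ρ a) (ψ ∘ₗ ρ b) y s =
      pair₂ ρ φ ψ y (s * (a ⊗ₜ[k] (b ⊗ₜ[k] 1))) := by
  induction y using tensor_induction₂ with
  | add x y hx hy => simp only [map_add, LinearMap.add_apply, hx, hy]
  | tmul x y =>
    induction s using tensor_induction₂ with
    | add x y hx hy => simp only [map_add, add_mul, hx, hy]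
    | tmul c s =>
      simp only [Algebra.TensorProduct.tmul_mul_tmul, pair₂_tmul_left, pair₁_comp ρ hρ,
        LinearMap.comp_apply, hρ, Module.End.mul_apply]

/-- `a ⊗ m ↦ (x ↦ φ(x · a)) ⊗ m` -/
def spreadLeft (φ : Module.Dual k C) : Q ⊗[k] M →ₗ[k] Module.Dual k C ⊗[k] M :=
  (φ.compRight k ∘ₗ ρ).rTensor M

@[simp] theorem spreadLeft_tmul (φ : Module.Dual k C) (a : Q) (m : M) :
    spreadLeft ρ φ (a ⊗ₜ[k] m) = (φ ∘ₗ ρ a) ⊗ₜ[k] m := rfl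

theorem dualTensorHom_spreadLeft (φ : Module.Dual k C) (s : Q ⊗[k] M) (x : C) :
    dualTensorHom k C M (spreadLeft ρ φ s) x = pair₁ ρ φ x s := by
  induction s using tensor_induction₂ with
  | add x y hx hy => simp only [map_add, LinearMap.add_apply, hx, hy]
  | tmul b m => simp

end Pairings

/-! ### The generalized smash product `C^* # M`. -/

namespace LeftCoaction

variable {k : Type u} [Field k] {Q : Type v} [Ring Q] [Algebra k Q] {H : QuasiHopfCore k Q}
variable {M : Type w} [Ring M] [Algebra k M] (L : LeftCoaction H M)
variable {C : Type*} [AddCommGroup C] [Module k C] (K : H.ModuleCoalgebra C)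

/-- `x ↦ φ(x₁ · a) ψ(x₂ · b)` -/
def conv (φ ψ : Module.Dual k C) (a b : Q) : Module.Dual k C :=
  TensorProduct.dualDistrib k C C (φ ⊗ₜ[k] ψ) ∘ₗ tensorAct K.act (a ⊗ₜ[k] b) ∘ₗ K.comul

theorem conv_act (φ ψ : Module.Dual k C) (a b c : Q) (x : C) :
    conv K φ ψ a b (K.act c x) = TensorProduct.dualDistrib k C C (φ ⊗ₜ[k] ψ)
      (tensorAct K.act (H.comul c * (a ⊗ₜ[k] b)) (K.comul x)) := by
  rw [tensorAct_mul K.act K.act_mul, conv, LinearMap.comp_apply, LinearMap.comp_apply, K.comul_act]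
  rfl

-- The coproduct of `C` is `Q`-linear, so splitting a point that has been acted on by `c` splits `c`
-- by `Δ`.
variable {K} in
theorem pair₂_conv_left (φ ψ χ : Module.Dual k C) (a b : Q) (y : C ⊗[k] C)
    (s : Q ⊗[k] (Q ⊗[k] M)) (r : Q ⊗[k] M) :
    pair₂ K.act (conv K φ ψ a b) χ y (s * ((1 : Q) ⊗ₜ[k] r)) =
      pair₃ K.act φ ψ χ (TensorProduct.assoc k C C C (K.comul.rTensor C y))
        (head2 (Q ⊗[k] M) H.comul s * (a ⊗ₜ[k] (b ⊗ₜ[k] r))) := by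
  induction y using tensor_induction₂ with
  | add x y hx hy => simp only [map_add, LinearMap.add_apply, hx, hy]
  | tmul x y =>
    induction s using tensor_induction₂ with
    | add x y hx hy => simp only [map_add, add_mul, hx, hy]
    | tmul c s =>
      rw [head2_tmul', ← asc_tmul, asc_mul, LinearMap.rTensor_tmul, pair₃_asc,
        Algebra.TensorProduct.tmul_mul_tmul, pair₂_tmul_left, mul_one, conv_act]

variable {K} in
theorem pair₂_conv_right (φ ψ χ : Module.Dual k C) (a b : Q) (y : C ⊗[k] C)
    (s : Q ⊗[k] (Q ⊗[k] M)) (n : M) :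
    pair₂ K.act φ (conv K ψ χ a b) y (s * ((1 : Q) ⊗ₜ[k] ((1 : Q) ⊗ₜ[k] n))) =
      pair₃ K.act φ ψ χ (K.comul.lTensor C y)
        (tail Q (head2 M H.comul) s * ((1 : Q) ⊗ₜ[k] (a ⊗ₜ[k] (b ⊗ₜ[k] n)))) := by
  induction y using tensor_induction₂ with
  | add x y hx hy => simp only [map_add, LinearMap.add_apply, hx, hy]
  | tmul x y =>
    induction s using tensor_induction₃ with
    | tmul c d m =>
      have e : a ⊗ₜ[k] (b ⊗ₜ[k] n) = asc k Q Q M ((a ⊗ₜ[k] b) ⊗ₜ[k] n) := rfl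
      simp only [tail_tmul, head2_tmul', e, Algebra.TensorProduct.tmul_mul_tmul, asc_mul,
        LinearMap.lTensor_tmul, pair₃_tmul_left, pair₂_asc, pair₂_tmul_left, mul_one,
        pair₁_tmul, conv_act]
    | add x y hx hy => simp only [map_add, add_mul, hx, hy]

variable {K} in
theorem pair₂_counit_left (ψ : Module.Dual k C) (y : C ⊗[k] C) (t : Q ⊗[k] (Q ⊗[k] M)) :
    pair₂ K.act K.counit ψ y t = pair₁ K.act ψ (TensorProduct.lid k C (K.counit.rTensor C y))
      (dropHead (Q ⊗[k] M) H.counit t) := by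
  induction y using tensor_induction₂ with
  | add x y hx hy => simp only [map_add, LinearMap.add_apply, hx, hy]
  | tmul x y =>
    induction t using tensor_induction₂ with
    | add x y hx hy => simp only [map_add, hx, hy]
    | tmul a t => simp [pair₂_tmul_left, K.counit_act, mul_smul, smul_comm (H.counit a)]

variable {K} in
theorem pair₂_counit_right (φ : Module.Dual k C) (y : C ⊗[k] C) (t : Q ⊗[k] (Q ⊗[k] M)) :
    pair₂ K.act φ K.counit y t = pair₁ K.act φ (TensorProduct.rid k C (K.counit.lTensor C y))
      (tail Q (dropHead M H.counit) t) := by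
  induction y using tensor_induction₂ with
  | add x y hx hy => simp only [map_add, LinearMap.add_apply, hx, hy]
  | tmul x y =>
    induction t using tensor_induction₃ with
    | tmul a b m =>
      simp [K.counit_act, smul_smul]
      ring_nf
    | add x y hx hy => simp only [map_add, hx, hy]

variable [FiniteDimensional k C]

/-- `a ⊗ b ⊗ m ↦ (x ↦ φ(x₁ · a) ψ(x₂ · b)) ⊗ m` -/
def convTensor (φ ψ : Module.Dual k C) :
    Q ⊗[k] (Q ⊗[k] M) →ₗ[k] Module.Dual k C ⊗[k] M :=
  (dualTensorHomEquiv k C M).symm.toLinearMap ∘ₗ (pair₂ K.act φ ψ ∘ₗ K.comul).flip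

theorem dualTensorHom_convTensor (φ ψ : Module.Dual k C) (t : Q ⊗[k] (Q ⊗[k] M)) (x : C) :
    dualTensorHom k C M (convTensor K φ ψ t) x = pair₂ K.act φ ψ (K.comul x) t := by
  have : dualTensorHom k C M (convTensor K φ ψ t) =
      dualTensorHomEquiv k C M (convTensor K φ ψ t) := by simp
  rw [this, convTensor]
  simp

@[simp] theorem convTensor_tmul (φ ψ : Module.Dual k C) (a b : Q) (m : M) :
    convTensor K φ ψ (a ⊗ₜ[k] (b ⊗ₜ[k] m)) = conv K φ ψ a b ⊗ₜ[k] m := by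
  apply dualTensor_ext
  intro x
  rw [dualTensorHom_convTensor, ← asc_tmul, pair₂_asc]
  simp [conv]

section LeftSmash

/-- `mul` is the product of the generalized smash product `C^* # M`. -/
def IsLeftSmash (mul : (Module.Dual k C ⊗[k] M) →ₗ[k] (Module.Dual k C ⊗[k] M) →ₗ[k]
    (Module.Dual k C ⊗[k] M)) : Prop :=
  ∀ φ m ψ n x, dualTensorHom k C M (mul (φ ⊗ₜ[k] m) (ψ ⊗ₜ[k] n)) x =
    pair₂ K.act φ ψ (K.comul x)
      (L.Phi⁻¹.val * ((1 : Q) ⊗ₜ[k] (L.coact m * ((1 : Q) ⊗ₜ[k] n))))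

variable {L K} {mul : (Module.Dual k C ⊗[k] M) →ₗ[k] (Module.Dual k C ⊗[k] M) →ₗ[k]
    (Module.Dual k C ⊗[k] M)}

theorem IsLeftSmash.mul_tmul (h : L.IsLeftSmash K mul) (φ ψ : Module.Dual k C) (m n : M) :
    mul (φ ⊗ₜ[k] m) (ψ ⊗ₜ[k] n) =
      convTensor K φ ψ (L.Phi⁻¹.val * ((1 : Q) ⊗ₜ[k] (L.coact m * ((1 : Q) ⊗ₜ[k] n)))) := by
  apply dualTensor_ext
  intro x
  rw [h, dualTensorHom_convTensor]

theorem IsLeftSmash.convTensor_mul (h : L.IsLeftSmash K mul) (φ ψ χ : Module.Dual k C) (l : M)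
    (t : Q ⊗[k] (Q ⊗[k] M)) (x : C) :
    dualTensorHom k C M (mul (convTensor K φ ψ t) (χ ⊗ₜ[k] l)) x =
      pair₃ K.act φ ψ χ (TensorProduct.assoc k C C C (K.comul.rTensor C (K.comul x)))
        (head2 (Q ⊗[k] M) H.comul L.Phi⁻¹.val * (tail Q (tail Q L.coact) t *
          ((1 : Q) ⊗ₜ[k] ((1 : Q) ⊗ₜ[k] ((1 : Q) ⊗ₜ[k] l))))) := by
  induction t using tensor_induction₃ with
  | tmul a b m =>
    rw [convTensor_tmul, h, pair₂_conv_left]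
    simp only [tail_tmul, Algebra.TensorProduct.tmul_mul_tmul, mul_one]
  | add x y hx hy => simp only [map_add, add_mul, mul_add, LinearMap.add_apply, hx, hy]

theorem IsLeftSmash.mul_convTensor (h : L.IsLeftSmash K mul) (φ ψ χ : Module.Dual k C) (m : M)
    (t : Q ⊗[k] (Q ⊗[k] M)) (x : C) :
    dualTensorHom k C M (mul (φ ⊗ₜ[k] m) (convTensor K ψ χ t)) x =
      pair₃ K.act φ ψ χ (K.comul.lTensor C (K.comul x))
        (tail Q (head2 M H.comul) (L.Phi⁻¹.val * ((1 : Q) ⊗ₜ[k] L.coact m)) *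
          ((1 : Q) ⊗ₜ[k] t)) := by
  induction t using tensor_induction₃ with
  | tmul a b n =>
    rw [convTensor_tmul, h, ← pair₂_conv_right]
    simp only [Algebra.TensorProduct.tmul_mul_tmul, mul_one, mul_assoc]
  | add x y hx hy =>
    simp only [map_add, mul_add, LinearMap.add_apply, TensorProduct.tmul_add, hx, hy]

/-- Evaluated at `x`, the two bracketings are pairings with the two iterated coproducts of `x`. Once
these are identified at the cost of `φ⁻¹`, it remains to compare two elements of `Q ⊗ Q ⊗ Q ⊗ M`,
and they agree by the inverse pentagon and quasi-coassociativity. -/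
theorem IsLeftSmash.assoc (h : L.IsLeftSmash K mul) (u v z : Module.Dual k C ⊗[k] M) :
    mul (mul u v) z = mul u (mul v z) := by
  induction u using tensor_induction₂ with
  | add x y hx hy => simp only [map_add, LinearMap.add_apply, hx, hy]
  | tmul φ m =>
    induction v using tensor_induction₂ with
    | add x y hx hy => simp only [map_add, LinearMap.add_apply, hx, hy]
    | tmul ψ n =>
      induction z using tensor_induction₂ with
      | add x y hx hy => simp only [map_add, hx, hy]
      | tmul χ l =>
        apply dualTensor_ext
        intro x
        have hco : K.comul.lTensor C (K.comul x) = tensorAct₃ K.act H.phi⁻¹.val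
          (TensorProduct.assoc k C C C (K.comul.rTensor C (K.comul x))) := K.coassoc x
        rw [h.mul_tmul, h.mul_tmul, h.convTensor_mul, h.mul_convTensor, hco,
          pair₃_tensorAct₃ K.act K.act_mul]
        congr 1
        -- The inner `Φ⁻¹` must pass the iterated coaction of `m`, since in the other bracketing it
        -- stands on the right of it.
        have hc : ((1 : Q) ⊗ₜ[k] L.Phi⁻¹.val) * ((1 : Q) ⊗ₜ[k] L.coact₂ m) =
            ((1 : Q) ⊗ₜ[k] L.comulCoact m) * ((1 : Q) ⊗ₜ[k] L.Phi⁻¹.val) := by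
          simp only [Algebra.TensorProduct.tmul_mul_tmul, Phi_inv_mul_coact₂]
        have e1 : tail Q (tail Q L.coact) ((1 : Q) ⊗ₜ[k] (L.coact m * ((1 : Q) ⊗ₜ[k] n))) =
            ((1 : Q) ⊗ₜ[k] L.coact₂ m) * ((1 : Q) ⊗ₜ[k] ((1 : Q) ⊗ₜ[k] L.coact n)) := by
          simp only [tail_tmul, map_mul, Algebra.TensorProduct.tmul_mul_tmul, one_mul,
            coact₂_apply]
        have e2 : tail Q (head2 M H.comul) ((1 : Q) ⊗ₜ[k] L.coact m) =
            (1 : Q) ⊗ₜ[k] L.comulCoact m := rfl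
        have e3 : ((1 : Q) ⊗ₜ[k] (L.Phi⁻¹.val * ((1 : Q) ⊗ₜ[k] (L.coact n * ((1 : Q) ⊗ₜ[k] l))))) =
            ((1 : Q) ⊗ₜ[k] L.Phi⁻¹.val) * ((1 : Q) ⊗ₜ[k] ((1 : Q) ⊗ₜ[k] L.coact n)) *
              ((1 : Q) ⊗ₜ[k] ((1 : Q) ⊗ₜ[k] ((1 : Q) ⊗ₜ[k] l))) := by
          simp only [Algebra.TensorProduct.tmul_mul_tmul, one_mul, mul_assoc]
        rw [map_mul, e1, map_mul, e2, e3]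
        simp only [← mul_assoc]
        rw [L.pentagon_inv, mul_assoc _ _ (1 ⊗ₜ[k] L.coact₂ m), hc]
        simp only [← mul_assoc]

theorem IsLeftSmash.one_mul (h : L.IsLeftSmash K mul) (z : Module.Dual k C ⊗[k] M) :
    mul (K.counit ⊗ₜ[k] (1 : M)) z = z := by
  induction z using tensor_induction₂ with
  | add x y hx hy => simp only [map_add, hx, hy]
  | tmul ψ n =>
    apply dualTensor_ext
    intro x
    rw [h, pair₂_counit_left, K.counit_left, map_mul, counit_outer_inv]
    simp [K.act_one]

theorem IsLeftSmash.mul_counit (h : L.IsLeftSmash K mul) (φ : Module.Dual k C) (m n : M) :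
    mul (φ ⊗ₜ[k] m) (K.counit ⊗ₜ[k] n) = φ ⊗ₜ[k] (m * n) := by
  apply dualTensor_ext
  intro x
  rw [h, pair₂_counit_right, K.counit_right, map_mul, counit_inner_inv]
  simp [K.act_one, L.counit_coact]

end LeftSmash

end LeftCoaction

/-! ### The right smash product and the comparison map. -/

namespace QuasiHopfCore

variable {k : Type u} [Field k] {Q : Type v} [Ring Q] [Algebra k Q] {H : QuasiHopfCore k Q}

/-- This is the first twist identity read through `S⁻¹`. The comparison map evaluates functionals at
`S⁻¹(q¹)`, and here the product `F Δ(q)` of the central formula is recovered from it. -/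
theorem IsTwist.flipSinv_mul_comul {F : Q ⊗[k] Q} (hF : H.IsTwist F) (c : Q) :
    H.flipSinv F * H.comul (H.Sinv c) = H.flipSinv (F * H.comul c) := by
  have := congrArg H.flipSinv (hF.mul_comul_S (H.Sinv c))
  rw [S_Sinv, H.flipSinv_mul (H.flipS _), flipSinv_flipS] at this
  exact this.symm

variable {M : Type w} [Ring M] [Algebra k M]

theorem Sinv_rTensor_mul_tmul (s : Q ⊗[k] M) (a : Q) :
    H.Sinv.rTensor M s * (a ⊗ₜ[k] 1) = H.Sinv.rTensor M ((H.S a ⊗ₜ[k] 1) * s) := by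
  induction s using tensor_induction₂ with
  | add x y hx hy => simp only [map_add, add_mul, mul_add, hx, hy]
  | tmul b m => simp [H.Sinv_mul]

theorem tmul_mul_Sinv_rTensor (s : Q ⊗[k] M) (m : M) :
    ((1 : Q) ⊗ₜ[k] m) * H.Sinv.rTensor M s = H.Sinv.rTensor M (((1 : Q) ⊗ₜ[k] m) * s) := by
  induction s using tensor_induction₂ with
  | add x y hx hy => simp only [map_add, mul_add, hx, hy]
  | tmul b m => simp

end QuasiHopfCore

namespace LeftCoaction

variable {k : Type u} [Field k] {Q : Type v} [Ring Q] [Algebra k Q] {H : QuasiHopfCore k Q}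
variable {M : Type w} [Ring M] [Algebra k M] (L : LeftCoaction H M)
variable {C : Type*} [AddCommGroup C] [Module k C] (K : H.ModuleCoalgebra C)

theorem act_mul (s t W : Q ⊗[k] M) : L.act (s * t) W = L.act t (L.act s W) :=
  sandwich_mul _ (fun a b => by simp [H.S_mul]) _ _ _ _

theorem act_one_tmul (n : M) (W : Q ⊗[k] M) : L.act ((1 : Q) ⊗ₜ[k] n) W = W * L.coact n := by
  rw [act, H.act₁_tmul, H.S_one, ← Algebra.TensorProduct.one_def, one_mul]

theorem act_tmul_mul (s W : Q ⊗[k] M) (m : M) :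
    L.act s (((1 : Q) ⊗ₜ[k] m) * W) = ((1 : Q) ⊗ₜ[k] m) * L.act s W := by
  induction s using tensor_induction₂ with
  | add x y hx hy => simp only [map_add, mul_add, LinearMap.add_apply, hx, hy]
  | tmul a n =>
    simp only [act, H.act₁_tmul, ← mul_assoc, Algebra.TensorProduct.tmul_mul_tmul, one_mul, mul_one]

/-- `mul` is the product of the generalized smash product `M # C^*`. -/
def IsRightSmash (comulR : C →ₗ[k] C ⊗[k] C)
    (mul : (M ⊗[k] Module.Dual k C) →ₗ[k] (M ⊗[k] Module.Dual k C) →ₗ[k]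
      (M ⊗[k] Module.Dual k C)) : Prop :=
  ∀ m φ n ψ x, dualTensorHom k C M (TensorProduct.comm k M (Module.Dual k C)
      (mul (m ⊗ₜ[k] φ) (n ⊗ₜ[k] ψ))) x =
    m * pair₂ K.act φ ψ (comulR x)
      (H.flipLegs M (((1 : Q) ⊗ₜ[k] L.coact n) * L.Phi.val))

/-- `f` is the isomorphism `φ ⋈ m ↦ (q² ⋈ φ(- · S⁻¹(q¹))) (m ⋈ 1)`. -/
def IsSmashEquiv (f : (Module.Dual k C ⊗[k] M) →ₗ[k] (M ⊗[k] Module.Dual k C)) : Prop :=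
  ∀ φ m x, dualTensorHom k C M (TensorProduct.comm k M (Module.Dual k C) (f (φ ⊗ₜ[k] m))) x =
    pair₁ K.act φ x (H.Sinv.rTensor M (L.q * L.coact m))

/-- `g` is the isomorphism `m ⋈ φ ↦ (1 ⋈ m) (φ(- · p¹) ⋈ p²)`. -/
def IsSmashEquivSymm (g : (M ⊗[k] Module.Dual k C) →ₗ[k] (Module.Dual k C ⊗[k] M)) : Prop :=
  ∀ m φ x, dualTensorHom k C M (g (m ⊗ₜ[k] φ)) x = pair₁ K.act φ x (L.coact m * L.p)

variable {L K}

/-- `a ⊗ m ↦ m ⊗ (x ↦ φ(x · a))` -/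
def spreadRight (ρ : Q →ₗ[k] Module.End k C) (φ : Module.Dual k C) :
    Q ⊗[k] M →ₗ[k] M ⊗[k] Module.Dual k C :=
  (TensorProduct.comm k (Module.Dual k C) M).toLinearMap ∘ₗ spreadLeft ρ φ

@[simp] theorem spreadRight_tmul (ρ : Q →ₗ[k] Module.End k C) (φ : Module.Dual k C) (a : Q)
    (m : M) : spreadRight ρ φ (a ⊗ₜ[k] m) = m ⊗ₜ[k] (φ ∘ₗ ρ a) := rfl

theorem dualTensorHom_spreadRight (ρ : Q →ₗ[k] Module.End k C) (φ : Module.Dual k C)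
    (s : Q ⊗[k] M) (x : C) :
    dualTensorHom k C M (TensorProduct.comm k M (Module.Dual k C) (spreadRight ρ φ s)) x =
      pair₁ ρ φ x s := by
  rw [← dualTensorHom_spreadLeft]
  simp [spreadRight]

/-- Images under the comparison map are spread along `S⁻¹` of a tensor. For such elements the right
product is ordinary multiplication in `Q ⊗ Q ⊗ M`, followed by one flip of the legs by `S⁻¹`. -/
theorem IsRightSmash.mul_spreadRight {comulR : C →ₗ[k] C ⊗[k] C}
    {mulR : (M ⊗[k] Module.Dual k C) →ₗ[k] (M ⊗[k] Module.Dual k C) →ₗ[k]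
      (M ⊗[k] Module.Dual k C)}
    (hR : L.IsRightSmash K comulR mulR)
    (φ ψ : Module.Dual k C) (s t : Q ⊗[k] M) (x : C) :
    dualTensorHom k C M (TensorProduct.comm k M (Module.Dual k C)
      (mulR (spreadRight K.act φ (H.Sinv.rTensor M s))
        (spreadRight K.act ψ (H.Sinv.rTensor M t)))) x =
      pair₂ K.act φ ψ (comulR x)
        (H.flipLegs M (((1 : Q) ⊗ₜ[k] s) * tail Q L.coact t * L.Phi.val)) := by
  induction s using tensor_induction₂ with
  | add x y hx hy =>
    simp only [map_add, add_mul, TensorProduct.tmul_add, LinearMap.add_apply, hx, hy]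
  | tmul a m =>
    induction t using tensor_induction₂ with
    | add x y hx hy =>
      simp only [map_add, add_mul, mul_add, LinearMap.add_apply, hx, hy]
    | tmul b n =>
      have e : ((1 : Q) ⊗ₜ[k] (a ⊗ₜ[k] m)) * tail Q L.coact (b ⊗ₜ[k] n) * L.Phi.val =
          (b ⊗ₜ[k] (a ⊗ₜ[k] m)) * (((1 : Q) ⊗ₜ[k] L.coact n) * L.Phi.val) := by
        rw [← mul_assoc, tail_tmul, Algebra.TensorProduct.tmul_mul_tmul,
          Algebra.TensorProduct.tmul_mul_tmul, one_mul, mul_one]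
      rw [LinearMap.rTensor_tmul, LinearMap.rTensor_tmul, spreadRight_tmul, spreadRight_tmul, hR,
        pair₂_comp _ K.act_mul, mul_pair₂, e, H.flipLegs_tmul_mul, mul_assoc]

variable [FiniteDimensional k C]

section Inverse

variable {f : (Module.Dual k C ⊗[k] M) →ₗ[k] (M ⊗[k] Module.Dual k C)}
  {g : (M ⊗[k] Module.Dual k C) →ₗ[k] (Module.Dual k C ⊗[k] M)}

theorem IsSmashEquiv.apply_tmul (hf : L.IsSmashEquiv K f) (φ : Module.Dual k C) (m : M) :
    f (φ ⊗ₜ[k] m) = spreadRight K.act φ (H.Sinv.rTensor M (L.q * L.coact m)) := by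
  apply tensorDual_ext
  intro x
  rw [hf, dualTensorHom_spreadRight]

theorem IsSmashEquivSymm.apply_tmul (hg : L.IsSmashEquivSymm K g) (m : M) (φ : Module.Dual k C) :
    g (m ⊗ₜ[k] φ) = spreadLeft K.act φ (L.coact m * L.p) := by
  apply dualTensor_ext
  intro x
  rw [hg, dualTensorHom_spreadLeft]

theorem IsSmashEquivSymm.apply_spreadRight (hg : L.IsSmashEquivSymm K g) (φ : Module.Dual k C)
    (r : Q ⊗[k] M) :
    g (spreadRight K.act φ (H.Sinv.rTensor M r)) = spreadLeft K.act φ (L.coAct r L.p) := by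
  induction r using tensor_induction₂ with
  | add x y hx hy => simp only [map_add, coAct_add, hx, hy]
  | tmul a m =>
    apply dualTensor_ext
    intro x
    rw [LinearMap.rTensor_tmul, spreadRight_tmul, hg, pair₁_comp _ K.act_mul,
      dualTensorHom_spreadLeft, coAct_tmul]

theorem IsSmashEquiv.apply_spreadLeft (hf : L.IsSmashEquiv K f) (φ : Module.Dual k C)
    (s : Q ⊗[k] M) :
    f (spreadLeft K.act φ s) = spreadRight K.act φ (H.Sinv.rTensor M (L.act s L.q)) := by
  induction s using tensor_induction₂ with
  | add x y hx hy => simp only [map_add, LinearMap.add_apply, hx, hy]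
  | tmul a m =>
    apply tensorDual_ext
    intro x
    rw [spreadLeft_tmul, hf, pair₁_comp _ K.act_mul, dualTensorHom_spreadRight,
      QuasiHopfCore.Sinv_rTensor_mul_tmul, act, H.act₁_tmul, mul_assoc]

/-- On `φ ⊗ m` the composite spreads `φ` along `coAct (q λ(m)) p`. By `coAct_p` the element `m`
moves out to the right, and `coAct_q_p` leaves `1 ⊗ m`. -/
theorem IsSmashEquivSymm.comp_eq_id (hf : L.IsSmashEquiv K f) (hg : L.IsSmashEquivSymm K g) :
    g ∘ₗ f = LinearMap.id := by
  apply TensorProduct.ext'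
  intro φ m
  rw [LinearMap.comp_apply, hf.apply_tmul, hg.apply_spreadRight, coAct_mul, coAct_p,
    coAct_mul_right, coAct_q_p, one_mul, spreadLeft_tmul, K.act_one]
  rfl

/-- The same argument on the other side: `act_q` moves `m` out to the left, and `act_p_q` leaves `1
⊗ m`. -/
theorem IsSmashEquiv.comp_eq_id (hf : L.IsSmashEquiv K f) (hg : L.IsSmashEquivSymm K g) :
    f ∘ₗ g = LinearMap.id := by
  apply TensorProduct.ext'
  intro m φ
  rw [LinearMap.comp_apply, hg.apply_tmul, hf.apply_spreadLeft, act_mul, act_q, act_tmul_mul,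
    act_p_q, mul_one, LinearMap.rTensor_tmul, H.Sinv_one, spreadRight_tmul, K.act_one]
  rfl

/-- The counit ignores `S` and takes `α` to `1`, so it reduces the contraction `q` to a counit image
of `Φ⁻¹`, which is `1`. -/
theorem IsSmashEquiv.apply_counit_tmul (hf : L.IsSmashEquiv K f)
    (hS : ∀ a, H.counit (H.S a) = H.counit a) (hα : H.counit H.alpha = 1) (m : M) :
    f (K.counit ⊗ₜ[k] m) = m ⊗ₜ[k] K.counit := by
  have hp : ∀ (x : C) (s : Q ⊗[k] M), pair₁ K.act K.counit x (H.Sinv.rTensor M s) =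
      K.counit x • dropHead M H.counit s := by
    intro x s
    induction s using tensor_induction₂ with
    | add x y hx hy => simp only [map_add, smul_add, hx, hy]
    | tmul a m =>
      have : H.counit (H.Sinv a) = H.counit a := by rw [← hS, H.S_Sinv]
      simp [K.counit_act, this, mul_smul, smul_comm (K.counit x)]
  have hq : dropHead M H.counit L.q = 1 := by
    have : ∀ t : Q ⊗[k] (Q ⊗[k] M), dropHead M H.counit (H.contract M t) =
        dropHead M H.counit (dropHead (Q ⊗[k] M) H.counit t) := by
      intro t
      induction t using tensor_induction₃ with
      | tmul a b m => simp [hS, hα, mul_smul]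
      | add x y hx hy => simp only [map_add, hx, hy]
    rw [q, this, L.counit_outer_inv, map_one]
  apply tensorDual_ext
  intro x
  rw [hf, hp, map_mul, hq, L.counit_coact, one_mul]
  simp

end Inverse

section Multiplicative

variable {f : (Module.Dual k C ⊗[k] M) →ₗ[k] (M ⊗[k] Module.Dual k C)}
  {mulL : (Module.Dual k C ⊗[k] M) →ₗ[k] (Module.Dual k C ⊗[k] M) →ₗ[k] (Module.Dual k C ⊗[k] M)}
  {mulR : (M ⊗[k] Module.Dual k C) →ₗ[k] (M ⊗[k] Module.Dual k C) →ₗ[k] (M ⊗[k] Module.Dual k C)}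
  {comulR : C →ₗ[k] C ⊗[k] C} {F : Q ⊗[k] Q}

/-- Hypothesis `hc` relates the two coproducts of `C` by the flipped twist; transferring it to the
paired tensor is what places `F` in front of `Δ(q)`. -/
theorem IsSmashEquiv.apply_convTensor (hf : L.IsSmashEquiv K f) (hF : H.IsTwist F)
    (hc : ∀ x, tensorAct K.act (H.flipSinv F) (comulR x) = K.comul x) (φ ψ : Module.Dual k C)
    (t : Q ⊗[k] (Q ⊗[k] M)) (x : C) :
    dualTensorHom k C M (TensorProduct.comm k M (Module.Dual k C) (f (convTensor K φ ψ t))) x =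
      pair₂ K.act φ ψ (comulR x) (H.flipLegs M (H.act₂ L.comulCoact t
        (tail Q (appendOne Q M) F * head2 M H.comul L.q))) := by
  induction t using tensor_induction₃ with
  | tmul a b m =>
    rw [convTensor_tmul, hf, H.act₂_tmul, mul_assoc, mul_assoc, comulCoact_apply, ← map_mul]
    generalize L.q * L.coact m = r
    induction r using tensor_induction₂ with
    | add x y hx hy => simp only [map_add, mul_add, hx, hy]
    | tmul c l =>
      have e : a ⊗ₜ[k] b = H.flipSinv (H.S b ⊗ₜ[k] H.S a) := by simp
      rw [LinearMap.rTensor_tmul, pair₁_tmul, conv_act, ← hc, ← tensorAct_mul _ K.act_mul,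
        ← mul_assoc, hF.flipSinv_mul_comul, e, ← H.flipSinv_mul, ← pair₂_asc, ← H.flipLegs_asc,
        head2_tmul', ← asc_tmul, ← QuasiHopfCore.asc_tmul_one, asc_mul, asc_mul, one_mul, one_mul]
  | add x y hx hy => simp only [map_add, LinearMap.add_apply, hx, hy]

/-- The left product inserts `Φ⁻¹ (1 ⊗ λ(m)(1 ⊗ n))`. The central formula turns its image into `(1 ⊗
q)(id ⊗ λ)(act (λ(m)(1 ⊗ n)) q) Φ`, and `act_q` rewrites this as `(1 ⊗ q λ(m))(id ⊗ λ)(q λ(n)) Φ`.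
That is the right product of the two images. -/
theorem IsSmashEquiv.map_mul (hf : L.IsSmashEquiv K f) (hF : H.IsTwist F)
    (hc : ∀ x, tensorAct K.act (H.flipSinv F) (comulR x) = K.comul x)
    (hL : L.IsLeftSmash K mulL) (hR : L.IsRightSmash K comulR mulR)
    (u v : Module.Dual k C ⊗[k] M) : f (mulL u v) = mulR (f u) (f v) := by
  induction u using tensor_induction₂ with
  | add x y hx hy => simp only [map_add, LinearMap.add_apply, hx, hy]
  | tmul φ m =>
    induction v using tensor_induction₂ with
    | add x y hx hy => simp only [map_add, hx, hy]
    | tmul ψ n =>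
      apply tensorDual_ext
      intro x
      rw [hL.mul_tmul, hf.apply_convTensor hF hc, L.act₂_comulCoact_twist hF, act₂_tmul_q₂,
        act_mul, act_q, act_one_tmul, hf.apply_tmul, hf.apply_tmul, hR.mul_spreadRight, H.S_one,
        ← Algebra.TensorProduct.one_def, one_mul, mul_assoc ((1 : Q) ⊗ₜ[k] m),
        _root_.map_mul (tail Q L.coact), tail_tmul, ← mul_assoc,
        Algebra.TensorProduct.tmul_mul_tmul, one_mul]

end Multiplicative

end LeftCoaction

/-! ### Transport of algebra structures. -/

section Transport

variable {k : Type u} [Field k] {A B : Type*} [AddCommGroup A] [Module k A] [AddCommGroup B]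
  [Module k B]

/-- Unital associative algebra structures transport along multiplicative bijections. -/
theorem IsUnitalAssocAlgebra.of_surjective {mulA : A →ₗ[k] A →ₗ[k] A} {oneA : A}
    {mulB : B →ₗ[k] B →ₗ[k] B} {oneB : B} (hA : IsUnitalAssocAlgebra mulA oneA) {f : A →ₗ[k] B}
    (hf : IsUnitalAlgebraMap mulA oneA mulB oneB f) (hs : Function.Surjective f) :
    IsUnitalAssocAlgebra mulB oneB where
  assoc x y z := by
    obtain ⟨x, rfl⟩ := hs x
    obtain ⟨y, rfl⟩ := hs y
    obtain ⟨z, rfl⟩ := hs z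
    simp only [← hf.map_mul, hA.assoc]
  one_mul x := by
    obtain ⟨x, rfl⟩ := hs x
    rw [← hf.map_one, ← hf.map_mul, hA.one_mul]
  mul_one x := by
    obtain ⟨x, rfl⟩ := hs x
    rw [← hf.map_one, ← hf.map_mul, hA.mul_one]

end Transport

/-! ### Counit identities for the reassociator and the antipode. -/

namespace QuasiHopfAlgebra

variable {k : Type u} [Field k] {G : Type v} [Ring G] [Algebra k G] (H : QuasiHopfAlgebra k G)

/-- The underlying core of a quasi-Hopf algebra. -/
def toCore : QuasiHopfCore k G where
  comul := H.comul
  counit := H.counit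
  phi := H.phi
  quasi_coassoc := H.quasi_coassoc
  counit_left := H.counit_left
  antipode := H.antipode
  alpha := H.alpha
  beta := H.beta
  antipode_one := H.antipode_one
  antipode_mul := H.antipode_mul
  antipode_alpha := H.antipode_alpha
  antipode_beta := H.antipode_beta
  antipode_phi := H.antipode_phi
  antipode_phi_inv := H.antipode_phi_inv

theorem counit_asc_right {N : Type*} [Ring N] [Algebra k N] (y : G ⊗[k] G) (z : N) :
    tail G (dropHead N H.counit) (asc k G G N (y ⊗ₜ[k] z)) =
      dropTail G H.counit y ⊗ₜ[k] z := by
  induction y using tensor_induction₂ with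
  | tmul a b => simp [TensorProduct.smul_tmul']
  | add x y hx hy => simp only [map_add, TensorProduct.add_tmul, hx, hy]

theorem counit_head2_right {N : Type*} [Ring N] [Algebra k N] (x : G ⊗[k] N) :
    tail G (dropHead N H.counit) (head2 N H.comul x) = x := by
  induction x using tensor_induction₂ with
  | tmul a b => rw [head2_tmul', counit_asc_right, H.counit_right]
  | add x y hx hy => simp only [map_add, hx, hy]

theorem counit_head2_left {N : Type*} [Ring N] [Algebra k N] (x : G ⊗[k] N) :
    dropHead (G ⊗[k] N) H.counit (head2 N H.comul x) = x :=
  congrArg (fun g => g x) (LeftCoaction.dropHead_comp_head2 (H := H.toCore) (M := N))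

theorem tail_dropHead_tail {A N N' : Type*} [Ring A] [Algebra k A] [Ring N] [Algebra k N] [Ring N']
    [Algebra k N'] (g : N →ₐ[k] N') (x : A ⊗[k] (G ⊗[k] N)) :
    tail A (dropHead N' H.counit) (tail A (tail G g) x) =
      tail A g (tail A (dropHead N H.counit) x) := by
  induction x using tensor_induction₃ with
  | tmul a b c => simp
  | add x y hx hy => simp only [map_add, hx, hy]

/-- `(ε ⊗ id ⊗ id)(φ) = 1` -/
theorem counit_phi_left : dropHead (G ⊗[k] G) H.counit H.phi.val = 1 := by
  -- Under the counit on the second leg the pentagon becomes `φ = (1 ⊗ (ε ⊗ id ⊗ id)(φ)) φ`, and `φ`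
  -- cancels.
  have h := congrArg (tail G (dropHead (G ⊗[k] G) H.counit)) H.pentagon
  have h3 : ∀ x, tail G (dropHead (G ⊗[k] G) H.counit) (tail G (head2 G H.comul) x) = x := by
    intro x
    induction x using tensor_induction₂ with
    | tmul a b => rw [tail_tmul, tail_tmul, counit_head2_left]
    | add x y hx hy => simp only [map_add, hx, hy]
  simp only [map_mul, tail_dropHead_tail, counit_head2_right, h3, H.counit_phi, map_one, one_mul,
    mul_one, tail_tmul] at h
  have h' : (1 : G) ⊗ₜ[k] dropHead (G ⊗[k] G) H.counit H.phi.val = 1 :=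
    H.phi.isUnit.mul_eq_right.1 h.symm
  have := congrArg (dropHead (G ⊗[k] G) H.counit) h'
  simpa using this

/-- `(id ⊗ id ⊗ ε)(φ) = 1` -/
theorem counit_phi_right : tail G (dropTail G H.counit) H.phi.val = 1 := by
  -- Under the counit on the third leg the pentagon becomes `φ = φ ((id ⊗ id ⊗ ε)(φ) ⊗ 1)`.
  have h := congrArg (tail G (tail G (dropHead G H.counit))) H.pentagon
  have h1 : ∀ x, tail G (tail G (dropHead G H.counit)) (tail G (tail G H.comul) x) = x := by
    intro x
    induction x using tensor_induction₃ with
    | tmul a b c => rw [tail_tmul, tail_tmul, tail_tmul, tail_tmul, H.counit_left]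
    | add x y hx hy => simp only [map_add, hx, hy]
  have h2 : ∀ x, tail G (tail G (dropHead G H.counit)) (head2 (G ⊗[k] G) H.comul x) =
      head2 G H.comul (tail G (dropHead G H.counit) x) :=
    fun x => tail_tail_head2 _ _ x
  have h3 : ∀ x, tail G (tail G (dropHead G H.counit)) (tail G (head2 G H.comul) x) = x := by
    intro x
    induction x using tensor_induction₂ with
    | tmul a b => rw [tail_tmul, tail_tmul, counit_head2_right]
    | add x y hx hy => simp only [map_add, hx, hy]
  have h4 : ∀ x, tail G (tail G (dropHead G H.counit)) (tail G (tail G (appendOne G G)) x) =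
      tail G (appendOne G G) (tail G (dropTail G H.counit) x) := by
    intro x
    induction x using tensor_induction₃ with
    | tmul a b c => simp
    | add x y hx hy => simp only [map_add, hx, hy]
  simp only [map_mul, h1, h2, h3, h4, H.counit_phi, map_one, mul_one, tail_tmul,
    ← Algebra.TensorProduct.one_def, one_mul] at h
  have h' := H.phi.isUnit.mul_eq_left.1 h.symm
  have := congrArg (tail G (dropTail G H.counit)) h'
  rw [tail_tail_apply, map_one] at this
  have e : (dropTail G H.counit).comp (appendOne G G) = AlgHom.id k G := by
    ext; simp
  rw [e] at this
  simpa [tail] using this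

/-- Apply `ε` to `S(a₁) α a₂ = ε(a) α`; the normalization removes `ε(α)` from both sides. -/
theorem counit_S (hα : H.counit H.alpha = 1) (a : G) :
    H.counit (H.S a) = H.counit a := by
  have h := congrArg H.counit (H.antipode_alpha a)
  have e : ∀ y : G ⊗[k] G, H.counit (mul' k G (TensorProduct.map H.antipode.toLinearMap
      (mulLeft k H.alpha) y)) = H.counit (H.S (dropTail G H.counit y)) := by
    intro y
    induction y using tensor_induction₂ with
    | tmul a b => simp [hα, S, mul_comm]
    | add x y hx hy => simp only [map_add, hx, hy]
  rw [e, H.counit_right] at h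
  simpa [hα] using h

theorem counit_Sinv (hα : H.counit H.alpha = 1) (a : G) :
    H.counit (H.Sinv a) = H.counit a := by
  rw [← H.counit_S hα]
  exact congrArg H.counit (H.antipode.apply_symm_apply a)

end QuasiHopfAlgebra

/-! ### The explicit formula for Drinfel'd's twist. -/

namespace QuasiHopfAlgebra

variable {k : Type u} [Field k] {G : Type v} [Ring G] [Algebra k G] (H : QuasiHopfAlgebra k G)

theorem Phi_inv_conj (a : G) : H.phi⁻¹.val * tail G H.comul (H.comul a) =
    head2 G H.comul (H.comul a) * H.phi⁻¹.val := by
  rw [Units.inv_mul_eq_iff_eq_mul, ← mul_assoc, ← H.quasi_coassoc, mul_assoc, Units.mul_inv,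
    mul_one]

theorem phi_inv_tmul_one : tail G (tail G (appendOne G G)) H.phi⁻¹.val =
    head2 (G ⊗[k] G) H.comul H.phi⁻¹.val * (tail G (tail G H.comul) H.phi⁻¹.val *
      ((1 : G) ⊗ₜ[k] H.phi.val) * tail G (head2 G H.comul) H.phi.val) := by
  have hA : tail G (tail G H.comul) H.phi⁻¹.val * tail G (tail G H.comul) H.phi.val = 1 := by
    rw [← map_mul, Units.inv_mul, map_one]
  have hB : head2 (G ⊗[k] G) H.comul H.phi⁻¹.val * head2 (G ⊗[k] G) H.comul H.phi.val = 1 := by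
    rw [← map_mul, Units.inv_mul, map_one]
  have hE : tail G (tail G (appendOne G G)) H.phi.val *
      tail G (tail G (appendOne G G)) H.phi⁻¹.val = 1 := by
    rw [← map_mul, Units.mul_inv, map_one]
  calc _ = head2 (G ⊗[k] G) H.comul H.phi⁻¹.val * (tail G (tail G H.comul) H.phi⁻¹.val *
        tail G (tail G H.comul) H.phi.val) * head2 (G ⊗[k] G) H.comul H.phi.val *
          tail G (tail G (appendOne G G)) H.phi⁻¹.val := by rw [hA, mul_one, hB, one_mul]
    _ = head2 (G ⊗[k] G) H.comul H.phi⁻¹.val * (tail G (tail G H.comul) H.phi⁻¹.val *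
        (tail G (tail G H.comul) H.phi.val * head2 (G ⊗[k] G) H.comul H.phi.val)) *
          tail G (tail G (appendOne G G)) H.phi⁻¹.val := by simp only [mul_assoc]
    _ = _ := by
      rw [H.pentagon]
      simp only [mul_assoc, hE, mul_one]

/-- `x ⊗ y ↦ (S ⊗ S)(Δᵒᵖ(x)) γ Δ(y)` -/
def twistPair : G ⊗[k] G →ₗ[k] G ⊗[k] G :=
  mul' k (G ⊗[k] G) ∘ₗ TensorProduct.map (mulRight k H.gamma ∘ₗ H.flipS ∘ₗ H.comul.toLinearMap)
    H.comul.toLinearMap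

@[simp] theorem twistPair_tmul (x y : G) : H.twistPair (x ⊗ₜ[k] y) =
    H.flipS (H.comul x) * H.gamma * H.comul y := rfl

theorem flipS_mul (x y : G ⊗[k] G) : H.flipS (x * y) = H.flipS y * H.flipS x :=
  H.toCore.flipS_mul x y

theorem twistPair_mul_tmul (z : G ⊗[k] G) (x y : G) : H.twistPair (z * (x ⊗ₜ[k] y)) =
    H.flipS (H.comul x) * H.twistPair z * H.comul y := by
  induction z using tensor_induction₂ with
  | tmul a b =>
    rw [Algebra.TensorProduct.tmul_mul_tmul, twistPair_tmul, twistPair_tmul, map_mul H.comul,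
      map_mul H.comul, flipS_mul]
    simp only [mul_assoc]
  | add x y hx hy => simp only [map_add, add_mul, mul_add, hx, hy]

theorem flipS_mul_gamma_mul (y z : G ⊗[k] G) : H.flipS y * H.gamma * z =
    H.toCore.contractPair (H.toCore.theta * asc k G G (G ⊗[k] G) (y ⊗ₜ[k] z)) := by
  induction y using tensor_induction₂ with
  | tmul a b =>
    rw [asc_tmul, H.toCore.contractPair_mul]
    rfl
  | add x y hx hy => simp only [map_add, add_mul, mul_add, TensorProduct.add_tmul, hx, hy]

theorem contractPair_comul_mul (r : G ⊗[k] (G ⊗[k] G)) (t : G ⊗[k] (G ⊗[k] (G ⊗[k] G))) :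
    H.toCore.contractPair (tail G (head2 G H.comul) r * t) =
      H.toCore.contractPair
        (QuasiHopfCore.insertOnes G G (tail G (dropHead G H.counit) r) * t) := by
  have key : ∀ (a : G) (t : G ⊗[k] (G ⊗[k] G)), H.toCore.contractPair (a ⊗ₜ[k] t) =
      ((1 : G) ⊗ₜ[k] (H.S a * H.alpha)) * H.toCore.contract G t := by
    intro a t
    induction t using tensor_induction₃ with
    | tmul b c d => simp [toCore, QuasiHopfCore.S, S, mul_assoc]
    | add x y hx hy => simp only [map_add, TensorProduct.tmul_add, mul_add, hx, hy]
  induction r using tensor_induction₂ with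
  | tmul a r =>
    induction t using tensor_induction₂ with
    | tmul b t =>
      rw [tail_tmul, tail_tmul, QuasiHopfCore.insertOnes_tmul,
        Algebra.TensorProduct.tmul_mul_tmul, Algebra.TensorProduct.tmul_mul_tmul, key, key]
      have h1 := H.toCore.contract_comul_mul r t
      have h2 := H.toCore.contract_comul_mul ((1 : G) ⊗ₜ[k] dropHead G H.counit r) t
      rw [head2_one_tmul, dropHead_tmul, map_one, one_smul] at h2
      rw [h2]
      congr 1
    | add x y hx hy => simp only [map_add, mul_add, hx, hy]
  | add x y hx hy => simp only [map_add, add_mul, hx, hy]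

theorem contractPair_insertOnes_comul_mul (a : G) (t : G ⊗[k] (G ⊗[k] (G ⊗[k] G))) :
    H.toCore.contractPair (QuasiHopfCore.insertOnes G G (H.comul a) * t) =
      H.counit a • H.toCore.contractPair t := by
  induction t using tensor_induction₄ with
  | tmul b c d e =>
    have key : ∀ y : G ⊗[k] G, H.toCore.contractPair (QuasiHopfCore.insertOnes G G y *
        (b ⊗ₜ[k] (c ⊗ₜ[k] (d ⊗ₜ[k] e)))) =
        (H.S c * H.alpha * d) ⊗ₜ[k] (H.S b * H.toCore.ev y * e) := by
      intro y
      induction y using tensor_induction₂ with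
      | tmul a f => simp [toCore, QuasiHopfCore.S, S, H.antipode_mul, mul_assoc]
      | add x y hx hy => simp only [map_add, add_mul, mul_add, TensorProduct.tmul_add, hx, hy]
    have h := H.toCore.ev_comul a
    change H.toCore.ev (H.comul a) = H.counit a • H.alpha at h
    rw [key, h]
    simp [toCore, QuasiHopfCore.S, S]
  | add x y hx hy => simp only [map_add, mul_add, smul_add, hx, hy]

/-- The iterated coproduct of `a` is moved in front of `(1 ⊗ φ⁻¹)(id ⊗ id ⊗ Δ)(φ)` by
quasi-coassociativity, used twice. There the inner pair of legs and then the outer pair are absorbed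
by the two copies of `α`. -/
theorem twistPair_comul (a : G) : H.twistPair (H.comul a) = H.counit a • H.gamma := by
  have h1 : ∀ y : G ⊗[k] G, H.twistPair y = H.toCore.contractPair (H.toCore.theta *
      head2 (G ⊗[k] G) H.comul (tail G H.comul y)) := by
    intro y
    induction y using tensor_induction₂ with
    | tmul a b => rw [twistPair_tmul, flipS_mul_gamma_mul]; rfl
    | add x y hx hy => simp only [map_add, mul_add, hx, hy]
  have h2 : ∀ y : G ⊗[k] G, ((1 : G) ⊗ₜ[k] H.phi⁻¹.val) * tail G (tail G H.comul) (tail G H.comul y) =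
      tail G (head2 G H.comul) (tail G H.comul y) * ((1 : G) ⊗ₜ[k] H.phi⁻¹.val) := by
    intro y
    induction y using tensor_induction₂ with
    | tmul a b => simp only [tail_tmul, Algebra.TensorProduct.tmul_mul_tmul, one_mul, mul_one,
        H.Phi_inv_conj]
    | add x y hx hy => simp only [map_add, mul_add, add_mul, hx, hy]
  have h3 : ∀ y : G ⊗[k] G, tail G (dropHead G H.counit) (tail G H.comul y) = y := by
    intro y
    induction y using tensor_induction₂ with
    | tmul a b => rw [tail_tmul, tail_tmul, H.counit_left]
    | add x y hx hy => simp only [map_add, hx, hy]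
  have h4 : H.toCore.theta = ((1 : G) ⊗ₜ[k] H.phi⁻¹.val) * tail G (tail G H.comul) H.phi.val := rfl
  rw [h1, ← tail_tail_head2, h4, mul_assoc, ← map_mul (tail G (tail G H.comul)),
    ← H.quasi_coassoc, map_mul (tail G (tail G H.comul)), ← mul_assoc, h2,
    mul_assoc, contractPair_comul_mul, h3, contractPair_insertOnes_comul_mul]
  rfl

theorem twistPair_comul_mul (a : G) (z : G ⊗[k] G) :
    H.twistPair (H.comul a * z) = H.counit a • H.twistPair z := by
  induction z using tensor_induction₂ with
  | tmul x y => rw [twistPair_mul_tmul, twistPair_comul, twistPair_tmul]; simp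
  | add x y hx hy => simp only [map_add, mul_add, smul_add, hx, hy]

theorem twistF_eq : H.twistF = H.twistPair (H.toCore.coev.lTensor G H.phi⁻¹.val) := by
  rw [twistF]
  generalize H.phi⁻¹.val = t
  induction t using tensor_induction₂ with
  | tmul a t => rfl
  | add x y hx hy => simp only [map_add, hx, hy]

theorem twistPair_coev_mul_comul (t : G ⊗[k] (G ⊗[k] G)) (y : G ⊗[k] G) :
    H.toCore.coev.lTensor G (t * tail G H.comul y) =
      H.toCore.coev.lTensor G t * (dropTail G H.counit y ⊗ₜ[k] 1) := by
  have key : ∀ (b c : G) (z : G ⊗[k] G), H.toCore.coev ((b ⊗ₜ[k] c) * z) =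
      b * H.toCore.coev z * H.S c := by
    intro b c z
    induction z using tensor_induction₂ with
    | tmul d e => simp [H.toCore.S_mul, mul_assoc]; rfl
    | add x y hx hy => simp only [map_add, mul_add, add_mul, hx, hy]
  induction y using tensor_induction₂ with
  | tmul d e =>
    induction t using tensor_induction₃ with
    | tmul a b c =>
      have h : H.toCore.coev (H.comul e) = H.counit e • H.beta := H.toCore.coev_comul e
      rw [tail_tmul, Algebra.TensorProduct.tmul_mul_tmul, LinearMap.lTensor_tmul, key, h,
        LinearMap.lTensor_tmul, dropTail_tmul, Algebra.TensorProduct.tmul_mul_tmul]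
      simp [← TensorProduct.smul_tmul']
      rfl
    | add x y hx hy => simp only [map_add, add_mul, hx, hy]
  | add x y hx hy => simp only [map_add, mul_add, TensorProduct.add_tmul, hx, hy]

theorem twistPair_coev_comul_mul (y : G ⊗[k] G) (t : G ⊗[k] (G ⊗[k] G)) :
    H.twistPair (H.toCore.coev.lTensor G (head2 G H.comul y * t)) =
      H.twistPair (H.toCore.coev.lTensor G t) * H.comul (H.S (dropHead G H.counit y)) := by
  induction y using tensor_induction₂ with
  | tmul d e =>
    induction t using tensor_induction₃ with
    | tmul a b c =>
      have key : ∀ z : G ⊗[k] G, H.toCore.coev.lTensor G (asc k G G G (z ⊗ₜ[k] e) *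
          (a ⊗ₜ[k] (b ⊗ₜ[k] c))) = z * (a ⊗ₜ[k] (b * H.beta * H.S c * H.S e)) := by
        intro z
        induction z using tensor_induction₂ with
        | tmul d e =>
          simp [H.toCore.S_mul, mul_assoc]; rfl
        | add x y hx hy => simp only [map_add, TensorProduct.add_tmul, add_mul, hx, hy]
      have h : H.toCore.coev (b ⊗ₜ[k] c) = b * H.beta * H.S c := H.toCore.coev_tmul b c
      rw [head2_tmul', key, twistPair_comul_mul, LinearMap.lTensor_tmul, h, twistPair_tmul,
        twistPair_tmul, dropHead_tmul, map_smul, map_smul, mul_smul_comm, map_mul _ _ (H.S e)]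
      simp only [mul_assoc]
    | add x y hx hy => simp only [map_add, mul_add, add_mul, hx, hy]
  | add x y hx hy => simp only [map_add, add_mul, mul_add, hx, hy]

/-- The formula of `F` is evaluated on both sides of `φ⁻¹ (id ⊗ Δ)Δ(a) = (Δ ⊗ id)Δ(a) φ⁻¹`. On the
left `β` absorbs a coproduct and a factor `(S ⊗ S)(Δᵒᵖ(a))` comes out in front; on the right `γ`
absorbs one and a factor `Δ(S(a))` comes out behind. -/
theorem twistF_mul_comul_S (a : G) :
    H.twistF * H.comul (H.S a) = H.flipS (H.comul a) * H.twistF := by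
  have h := congrArg (fun t => H.twistPair (H.toCore.coev.lTensor G t)) (H.Phi_inv_conj a)
  simp only [twistPair_coev_comul_mul, twistPair_coev_mul_comul, H.counit_left, H.counit_right,
    twistPair_mul_tmul, map_one, mul_one, ← twistF_eq] at h
  exact h.symm

/-- `a ⊗ b ⊗ c ↦ a β S(b) α c` -/
def zig : G ⊗[k] (G ⊗[k] G) →ₗ[k] G :=
  mul' k G ∘ₗ TensorProduct.map (mulRight k H.beta) H.toCore.ev

@[simp] theorem zig_tmul (a b c : G) :
    H.zig (a ⊗ₜ[k] (b ⊗ₜ[k] c)) = a * H.beta * (H.S b * H.alpha * c) := by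
  simp [zig]; rfl

theorem zig_tmul_left (a : G) (y : G ⊗[k] G) : H.zig (a ⊗ₜ[k] y) = a * H.beta * H.toCore.ev y := by
  simp [zig]

theorem zig_comul_mul (s : G ⊗[k] G) (t : G ⊗[k] (G ⊗[k] G)) :
    H.zig (tail G H.comul s * t) = dropTail G H.counit s * H.zig t := by
  induction s using tensor_induction₂ with
  | tmul a b =>
    induction t using tensor_induction₃ with
    | tmul c d e =>
      have h : H.toCore.ev (H.comul b) = H.counit b • H.alpha := H.toCore.ev_comul b
      rw [tail_tmul, Algebra.TensorProduct.tmul_mul_tmul, zig_tmul_left, QuasiHopfCore.ev_mul_tmul,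
        h, zig_tmul_left, H.toCore.ev_tmul, dropTail_tmul]
      simp [mul_assoc]
      rfl
    | add x y hx hy => simp only [map_add, mul_add, hx, hy]
  | add x y hx hy => simp only [map_add, add_mul, hx, hy]

theorem zig_mul_comul (t : G ⊗[k] (G ⊗[k] G)) (s : G ⊗[k] G) :
    H.zig (t * head2 G H.comul s) = H.zig t * dropHead G H.counit s := by
  induction s using tensor_induction₂ with
  | tmul a b =>
    induction t using tensor_induction₃ with
    | tmul c d e =>
      have key : ∀ z : G ⊗[k] G, H.zig ((c ⊗ₜ[k] (d ⊗ₜ[k] e)) * asc k G G G (z ⊗ₜ[k] b)) =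
          c * H.toCore.coev z * (H.S d * H.alpha * e * b) := by
        intro z
        induction z using tensor_induction₂ with
        | tmul x y => simp [S, H.antipode_mul, mul_assoc]; rfl
        | add x y hx hy => simp only [map_add, TensorProduct.add_tmul, mul_add, add_mul, hx, hy]
      have h : H.toCore.coev (H.comul a) = H.counit a • H.beta := H.toCore.coev_comul a
      rw [head2_tmul', key, h, zig_tmul, dropHead_tmul]
      simp [mul_assoc]
    | add x y hx hy => simp only [map_add, add_mul, hx, hy]
  | add x y hx hy => simp only [map_add, mul_add, hx, hy]

theorem twistPair_zig_comul_mul (s : G ⊗[k] (G ⊗[k] G)) (t : G ⊗[k] (G ⊗[k] (G ⊗[k] G))) :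
    H.twistPair (H.zig.lTensor G (head2 (G ⊗[k] G) H.comul s * t)) =
      H.twistPair (H.zig.lTensor G
        (((1 : G) ⊗ₜ[k] ((1 : G) ⊗ₜ[k] dropHead (G ⊗[k] G) H.counit s)) * t)) := by
  have key : ∀ (y z : G ⊗[k] G), H.zig.lTensor G (asc k G G (G ⊗[k] G) (y ⊗ₜ[k] z) * t) =
      y * H.zig.lTensor G (((1 : G) ⊗ₜ[k] ((1 : G) ⊗ₜ[k] z)) * t) := by
    intro y z
    induction y using tensor_induction₂ with
    | tmul a b =>
      induction t using tensor_induction₃ with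
      | tmul c d e => simp [zig_tmul_left, mul_assoc]
      | add x y hx hy => simp only [map_add, mul_add, hx, hy]
    | add x y hx hy => simp only [map_add, TensorProduct.add_tmul, add_mul, hx, hy]
  induction s using tensor_induction₂ with
  | tmul a s =>
    rw [head2_tmul', key, twistPair_comul_mul, dropHead_tmul]
    simp
  | add x y hx hy => simp only [map_add, add_mul, TensorProduct.tmul_add, hx, hy]

/-- Multiplying by `Δ(α)` completes `Q β S(R)` to the zigzag `Q β S(R) α`, so `F Δ(α)` is an
evaluation of `φ⁻¹ ⊗ 1`. By the pentagon this is a product of four factors. Three contain a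
coproduct that is absorbed by `γ`, `α` or `β` and become trivial under the counit. The fourth, `1 ⊗
φ`, gives `X β S(Y) α Z = 1`, and `γ` remains. -/
theorem twistF_mul_comul_alpha : H.twistF * H.comul H.alpha = H.gamma := by
  have e1 : ∀ t : G ⊗[k] (G ⊗[k] G), H.zig.lTensor G (tail G (tail G (appendOne G G)) t) =
      H.toCore.coev.lTensor G t * ((1 : G) ⊗ₜ[k] H.alpha) := by
    intro t
    induction t using tensor_induction₃ with
    | tmul a b c => simp [mul_assoc]; rfl
    | add x y hx hy => simp only [map_add, add_mul, hx, hy]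
  have e2 : ∀ (r : G ⊗[k] (G ⊗[k] G)) (t : G ⊗[k] (G ⊗[k] (G ⊗[k] G))),
      H.zig.lTensor G (tail G (tail G H.comul) r * t) =
        tail G (dropTail G H.counit) r * H.zig.lTensor G t := by
    intro r t
    induction r using tensor_induction₂ with
    | tmul a r =>
      induction t using tensor_induction₂ with
      | tmul b t => simp [zig_comul_mul]
      | add x y hx hy => simp only [map_add, mul_add, hx, hy]
    | add x y hx hy => simp only [map_add, add_mul, hx, hy]
  have e3 : ∀ (t : G ⊗[k] (G ⊗[k] (G ⊗[k] G))) (r : G ⊗[k] (G ⊗[k] G)),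
      H.zig.lTensor G (t * tail G (head2 G H.comul) r) =
        H.zig.lTensor G t * tail G (dropHead G H.counit) r := by
    intro t r
    induction r using tensor_induction₂ with
    | tmul a r =>
      induction t using tensor_induction₂ with
      | tmul b t => simp [zig_mul_comul]
      | add x y hx hy => simp only [map_add, add_mul, hx, hy]
    | add x y hx hy => simp only [map_add, mul_add, hx, hy]
  have i1 : dropHead (G ⊗[k] G) H.counit H.phi⁻¹.val = 1 := by
    have := congrArg (dropHead (G ⊗[k] G) H.counit) H.phi.mul_inv
    rwa [map_mul, H.counit_phi_left, one_mul, map_one] at this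
  have i2 : tail G (dropTail G H.counit) H.phi⁻¹.val = 1 := by
    have := congrArg (tail G (dropTail G H.counit)) H.phi.mul_inv
    rwa [map_mul, H.counit_phi_right, one_mul, map_one] at this
  have hz : H.zig H.phi.val = 1 := H.antipode_phi
  have e4 : H.twistF * H.comul H.alpha = H.twistPair (H.zig.lTensor G
      (tail G (tail G (appendOne G G)) H.phi⁻¹.val)) := by
    rw [e1, twistPair_mul_tmul, twistF_eq, map_one,
      show H.flipS 1 = 1 from H.toCore.flipS_one, one_mul]
  rw [e4, phi_inv_tmul_one, twistPair_zig_comul_mul, i1, ← Algebra.TensorProduct.one_def,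
    ← Algebra.TensorProduct.one_def, one_mul, e3, H.counit_phi, mul_one, e2, i2, one_mul,
    LinearMap.lTensor_tmul, hz, twistPair_tmul, map_one,
    show H.flipS 1 = 1 from H.toCore.flipS_one, one_mul, mul_one]

/-- Drinfel'd's twist satisfies its two characteristic identities. -/
theorem isTwist_twistF : H.toCore.IsTwist H.twistF where
  mul_comul_S := H.twistF_mul_comul_S
  mul_comul_alpha := H.twistF_mul_comul_alpha

end QuasiHopfAlgebra

/-! ### The cocycle identity for `h`. -/

namespace QuasiHopfCore

variable {k : Type u} [Field k] {Q : Type v} [Ring Q] [Algebra k Q] (H : QuasiHopfCore k Q)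

/-- `a ⊗ b ⊗ c ↦ S⁻¹(c) ⊗ S⁻¹(b) ⊗ S⁻¹(a)` -/
def flipSinv₃ : Q ⊗[k] (Q ⊗[k] Q) →ₗ[k] Q ⊗[k] (Q ⊗[k] Q) :=
  (TensorProduct.assoc k Q Q Q).toLinearMap ∘ₗ TensorProduct.map H.flipSinv H.Sinv ∘ₗ
    (TensorProduct.comm k Q (Q ⊗[k] Q)).toLinearMap

theorem flipSinv₃_tmul (a : Q) (y : Q ⊗[k] Q) :
    H.flipSinv₃ (a ⊗ₜ[k] y) = asc k Q Q Q (H.flipSinv y ⊗ₜ[k] H.Sinv a) := rfl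

@[simp] theorem flipSinv₃_tmul' (a b c : Q) :
    H.flipSinv₃ (a ⊗ₜ[k] (b ⊗ₜ[k] c)) = H.Sinv c ⊗ₜ[k] (H.Sinv b ⊗ₜ[k] H.Sinv a) := rfl

theorem flipSinv₃_asc (y : Q ⊗[k] Q) (a : Q) :
    H.flipSinv₃ (asc k Q Q Q (y ⊗ₜ[k] a)) = H.Sinv a ⊗ₜ[k] H.flipSinv y := by
  induction y using tensor_induction₂ with
  | tmul b c => simp
  | add x y hx hy => simp only [map_add, TensorProduct.add_tmul, TensorProduct.tmul_add, hx, hy]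

theorem flipSinv₃_mul (x y : Q ⊗[k] (Q ⊗[k] Q)) :
    H.flipSinv₃ (x * y) = H.flipSinv₃ y * H.flipSinv₃ x := by
  induction x using tensor_induction₃ with
  | tmul a b c =>
    induction y using tensor_induction₃ with
    | tmul d e f => simp [H.Sinv_mul]
    | add x y hx hy => simp only [map_add, hx, hy, mul_add, add_mul]
  | add x y hx hy => simp only [map_add, hx, hy, add_mul, mul_add]

theorem flipSinv₃_flipS₃ (x : Q ⊗[k] (Q ⊗[k] Q)) : H.flipSinv₃ (H.flipS₃ x) = x := by
  induction x using tensor_induction₃ with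
  | tmul a b c => simp
  | add x y hx hy => simp only [map_add, hx, hy]

variable {H}

/-- The cocycle identity for `(S⁻¹ ⊗ S⁻¹)(F²¹)`. -/
theorem IsTwist.cocycle_flipSinv {M : Type w} [Ring M] [Algebra k M] {F : Q ⊗[k] Q}
    (hF : H.IsTwist F) (L : LeftCoaction H M) (χ : M →ₐ[k] k) :
    H.flipSinv₃ H.phi.val * (tail Q (appendOne Q Q) (H.flipSinv F) *
      head2 Q H.comul (H.flipSinv F)) =
    ((1 : Q) ⊗ₜ[k] H.flipSinv F) * tail Q H.comul (H.flipSinv F) * H.phi.val := by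
  have hc := congrArg H.flipSinv₃ (hF.cocycle L χ)
  have h1 : H.flipSinv₃ ((1 : Q) ⊗ₜ[k] F) = tail Q (appendOne Q Q) (H.flipSinv F) := by
    rw [flipSinv₃_tmul, H.Sinv_one, asc_tmul_one]
  have h2 : H.flipSinv₃ (tail Q (appendOne Q Q) F) = (1 : Q) ⊗ₜ[k] H.flipSinv F := by
    rw [← asc_tmul_one, flipSinv₃_asc, H.Sinv_one]
  have h3 : ∀ x, H.flipSinv₃ (tail Q H.comul x) * tail Q (appendOne Q Q) (H.flipSinv F) =
      tail Q (appendOne Q Q) (H.flipSinv F) * head2 Q H.comul (H.flipSinv x) := by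
    intro x
    induction x using tensor_induction₂ with
    | tmul a b =>
      rw [tail_tmul, flipSinv₃_tmul, ← asc_tmul_one, asc_mul, flipSinv_tmul, head2_tmul', asc_mul,
        hF.flipSinv_mul_comul, H.flipSinv_mul, one_mul, mul_one]
    | add x y hx hy => simp only [map_add, add_mul, mul_add, hx, hy]
  have h4 : ∀ x, H.flipSinv₃ (head2 Q H.comul x) * ((1 : Q) ⊗ₜ[k] H.flipSinv F) =
      ((1 : Q) ⊗ₜ[k] H.flipSinv F) * tail Q H.comul (H.flipSinv x) := by
    intro x
    induction x using tensor_induction₂ with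
    | tmul a b =>
      rw [head2_tmul', flipSinv₃_asc, flipSinv_tmul, tail_tmul,
        Algebra.TensorProduct.tmul_mul_tmul, Algebra.TensorProduct.tmul_mul_tmul,
        hF.flipSinv_mul_comul, H.flipSinv_mul, one_mul, mul_one]
    | add x y hx hy => simp only [map_add, add_mul, mul_add, hx, hy]
  rw [flipSinv₃_mul, flipSinv₃_mul, flipSinv₃_mul, flipSinv₃_mul, flipSinv₃_flipS₃, h1, h2, h3,
    h4] at hc
  exact hc

end QuasiHopfCore

/-! ### Invertibility and normalization of `h`, and the opposite coproduct. -/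

namespace QuasiHopfAlgebra

variable {k : Type u} [Field k] {G : Type v} [Ring G] [Algebra k G] (H : QuasiHopfAlgebra k G)

/-- The left regular coaction. -/
def selfCoaction : LeftCoaction H.toCore G where
  coact := H.comul
  Phi := H.phi
  quasi_coassoc := H.quasi_coassoc
  pentagon := H.pentagon.symm
  counit_coact := H.counit_left
  counit_inner := H.counit_phi
  counit_outer := H.counit_phi_left

theorem counit_phi_inv_left : dropHead (G ⊗[k] G) H.counit H.phi⁻¹.val = 1 :=
  H.selfCoaction.counit_outer_inv

theorem counit_phi_inv_right : tail G (dropTail G H.counit) H.phi⁻¹.val = 1 := by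
  have := congrArg (tail G (dropTail G H.counit)) H.phi.mul_inv
  rwa [map_mul, H.counit_phi_right, one_mul, map_one] at this

theorem twistH_cocycle : H.toCore.flipSinv₃ H.phi.val * (tail G (appendOne G G) H.twistH *
      head2 G H.comul H.twistH) =
    ((1 : G) ⊗ₜ[k] H.twistH) * tail G H.comul H.twistH * H.phi.val :=
  H.isTwist_twistF.cocycle_flipSinv H.selfCoaction H.counit

theorem isUnit_twistH [FiniteDimensional k G] : IsUnit H.twistH := by
  obtain ⟨Y, hY⟩ := H.selfCoaction.exists_mul_twist_eq_one H.isTwist_twistF H.counit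
  have hi : Function.Injective (mulLeft k H.twistF) := by
    intro x y hxy
    have := congrArg (Y * ·) hxy
    simpa [← mul_assoc, hY] using this
  -- In finite dimension the left inverse is two-sided: left multiplication by `F` is injective,
  -- hence surjective.
  obtain ⟨Z, hZ⟩ := LinearMap.surjective_of_injective hi 1
  have hZY : Z = Y := by
    calc Z = Y * H.twistF * Z := by rw [hY, one_mul]
      _ = Y * (mulLeft k H.twistF Z) := by rw [mul_assoc]; rfl
      _ = Y := by rw [hZ, mul_one]
  have hF : H.twistF * Y = 1 := by rw [← hZY]; exact hZ
  have h1 : H.toCore.flipSinv 1 = 1 := by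
    rw [Algebra.TensorProduct.one_def, QuasiHopfCore.flipSinv_tmul, H.toCore.Sinv_one]
  refine ⟨⟨H.twistH, H.toCore.flipSinv Y, ?_, ?_⟩, rfl⟩
  · change H.toCore.flipSinv H.twistF * _ = 1
    rw [← H.toCore.flipSinv_mul, hY, h1]
  · change _ * H.toCore.flipSinv H.twistF = 1
    rw [← H.toCore.flipSinv_mul, hF, h1]

theorem twistH_mul_inv [FiniteDimensional k G] : H.twistH * H.twistHInv = 1 :=
  Ring.mul_inverse_cancel _ H.isUnit_twistH

theorem inv_mul_twistH [FiniteDimensional k G] : H.twistHInv * H.twistH = 1 :=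
  Ring.inverse_mul_cancel _ H.isUnit_twistH

section Normalization

theorem dropHead_flipS (hα : H.counit H.alpha = 1) (y : G ⊗[k] G) :
    dropHead G H.counit (H.flipS y) = H.S (dropTail G H.counit y) := by
  induction y using tensor_induction₂ with
  | tmul a b =>
    change dropHead G H.counit (H.S b ⊗ₜ[k] H.S a) = _
    simp [H.counit_S hα]
  | add x y hx hy => simp only [map_add, hx, hy]

theorem dropTail_flipS (hα : H.counit H.alpha = 1) (y : G ⊗[k] G) :
    dropTail G H.counit (H.flipS y) = H.S (dropHead G H.counit y) := by
  induction y using tensor_induction₂ with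
  | tmul a b =>
    change dropTail G H.counit (H.S b ⊗ₜ[k] H.S a) = _
    simp [H.counit_S hα]
  | add x y hx hy => simp only [map_add, hx, hy]

theorem dropHead_gamma (hα : H.counit H.alpha = 1) : dropHead G H.counit H.gamma = H.alpha := by
  have h : ∀ t, dropHead G H.counit (H.toCore.contractPair t) =
      H.toCore.ev (tail G (dropHead G H.counit) (tail G (dropHead (G ⊗[k] G) H.counit) t)) := by
    intro t
    induction t using tensor_induction₄ with
    | tmul a b c d =>
      have e : H.counit (H.toCore.S b) = H.counit b := H.counit_S hα b
      have e' : H.counit H.toCore.alpha = 1 := hα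
      simp [e, e', mul_smul]
    | add x y hx hy => simp only [map_add, hx, hy]
  change dropHead G H.counit (H.toCore.contractPair (((1 : G) ⊗ₜ[k] H.phi⁻¹.val) *
    tail G (tail G H.comul) H.phi.val)) = _
  rw [h, map_mul, tail_dropHead_tail, H.counit_phi, map_one, mul_one, tail_tmul,
    H.counit_phi_inv_left, tail_tmul, map_one, H.toCore.ev_tmul, H.toCore.S_one, one_mul, mul_one]
  rfl

theorem dropTail_gamma (hα : H.counit H.alpha = 1) : dropTail G H.counit H.gamma = H.alpha := by
  have h : ∀ t, dropTail G H.counit (H.toCore.contractPair t) =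
      H.toCore.ev (tail G (dropTail G H.counit) (dropHead (G ⊗[k] (G ⊗[k] G)) H.counit t)) := by
    intro t
    induction t using tensor_induction₄ with
    | tmul a b c d =>
      have e : H.counit (H.toCore.S a) = H.counit a := H.counit_S hα a
      have e' : H.counit H.toCore.alpha = 1 := hα
      simp [e, e', smul_smul]
    | add x y hx hy => simp only [map_add, hx, hy]
  have h' : ∀ t : G ⊗[k] (G ⊗[k] G), dropHead (G ⊗[k] (G ⊗[k] G)) H.counit
      (tail G (tail G H.comul) t) = tail G H.comul (dropHead (G ⊗[k] G) H.counit t) := by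
    intro t
    induction t using tensor_induction₂ with
    | tmul a t => simp
    | add x y hx hy => simp only [map_add, hx, hy]
  change dropTail G H.counit (H.toCore.contractPair (((1 : G) ⊗ₜ[k] H.phi⁻¹.val) *
    tail G (tail G H.comul) H.phi.val)) = _
  rw [h, map_mul, h', H.counit_phi_left, map_one, mul_one, dropHead_tmul, map_one, one_smul,
    H.counit_phi_inv_right, Algebra.TensorProduct.one_def, H.toCore.ev_tmul, H.toCore.S_one,
    one_mul, mul_one]
  rfl

/-- The counit on one leg reduces `γ` to `α` and undoes the coproducts, so the formula of `F`
becomes `S(P) α Q β S(R) = 1`. -/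
theorem dropHead_twistF (hα : H.counit H.alpha = 1) : dropHead G H.counit H.twistF = 1 := by
  have h : ∀ t, dropHead G H.counit (H.twistPair t) =
      mul' k G (TensorProduct.map (mulRight k H.alpha ∘ₗ H.S) LinearMap.id t) := by
    intro t
    induction t using tensor_induction₂ with
    | tmul a b =>
      rw [twistPair_tmul, map_mul, map_mul, H.dropHead_flipS hα, H.dropHead_gamma hα,
        H.counit_left, H.counit_right]
      simp
    | add x y hx hy => simp only [map_add, hx, hy]
  rw [twistF_eq, h]
  refine Eq.trans ?_ H.antipode_phi_inv
  generalize H.phi⁻¹.val = t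
  induction t using tensor_induction₃ with
  | tmul a b c => rfl
  | add x y hx hy => simp only [map_add, hx, hy]

theorem dropTail_twistF (hα : H.counit H.alpha = 1) : dropTail G H.counit H.twistF = 1 := by
  have h : ∀ t, dropTail G H.counit (H.twistPair t) =
      mul' k G (TensorProduct.map (mulRight k H.alpha ∘ₗ H.S) LinearMap.id t) := by
    intro t
    induction t using tensor_induction₂ with
    | tmul a b =>
      rw [twistPair_tmul, map_mul, map_mul, H.dropTail_flipS hα, H.dropTail_gamma hα,
        H.counit_left, H.counit_right]
      simp
    | add x y hx hy => simp only [map_add, hx, hy]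
  rw [twistF_eq, h]
  refine Eq.trans ?_ H.antipode_phi_inv
  generalize H.phi⁻¹.val = t
  induction t using tensor_induction₃ with
  | tmul a b c => rfl
  | add x y hx hy => simp only [map_add, hx, hy]

theorem dropHead_twistH (hα : H.counit H.alpha = 1) : dropHead G H.counit H.twistH = 1 := by
  have h : ∀ y, dropHead G H.counit (H.flipSinv y) = H.toCore.Sinv (dropTail G H.counit y) := by
    intro y
    induction y using tensor_induction₂ with
    | tmul a b =>
      change dropHead G H.counit (H.Sinv b ⊗ₜ[k] H.Sinv a) = _
      simp [H.counit_Sinv hα]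
      rfl
    | add x y hx hy => simp only [map_add, hx, hy]
  rw [twistH, h, H.dropTail_twistF hα, H.toCore.Sinv_one]

theorem dropTail_twistH (hα : H.counit H.alpha = 1) : dropTail G H.counit H.twistH = 1 := by
  have h : ∀ y, dropTail G H.counit (H.flipSinv y) = H.toCore.Sinv (dropHead G H.counit y) := by
    intro y
    induction y using tensor_induction₂ with
    | tmul a b =>
      change dropTail G H.counit (H.Sinv b ⊗ₜ[k] H.Sinv a) = _
      simp [H.counit_Sinv hα]
      rfl
    | add x y hx hy => simp only [map_add, hx, hy]
  rw [twistH, h, H.dropHead_twistF hα, H.toCore.Sinv_one]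

end Normalization

section Cop

/-- `a ⊗ b ⊗ c ↦ c ⊗ b ⊗ a` -/
def rev (k : Type u) [Field k] (G : Type v) [Ring G] [Algebra k G] :
    G ⊗[k] (G ⊗[k] G) →ₐ[k] G ⊗[k] (G ⊗[k] G) :=
  (asc k G G G).toAlgHom.comp
    ((Algebra.TensorProduct.map (Algebra.TensorProduct.comm k G G).toAlgHom (AlgHom.id k G)).comp
      (Algebra.TensorProduct.comm k G (G ⊗[k] G)).toAlgHom)

@[simp] theorem rev_tmul (a b c : G) :
    rev k G (a ⊗ₜ[k] (b ⊗ₜ[k] c)) = c ⊗ₜ[k] (b ⊗ₜ[k] a) := rfl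

/-- `Δᵒᵖ` -/
def comulOp : G →ₐ[k] G ⊗[k] G := (Algebra.TensorProduct.comm k G G).toAlgHom.comp H.comul

theorem comulOp_apply (a : G) : H.comulOp a = Algebra.TensorProduct.comm k G G (H.comul a) := rfl

theorem tail_comulOp (y : G ⊗[k] G) :
    tail G H.comulOp (Algebra.TensorProduct.comm k G G y) = rev k G (head2 G H.comul y) := by
  induction y using tensor_induction₂ with
  | tmul a b =>
    rw [Algebra.TensorProduct.comm_tmul, tail_tmul, comulOp_apply, head2_tmul']
    generalize H.comul a = z
    induction z using tensor_induction₂ with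
    | tmul a b => simp
    | add x y hx hy => simp only [map_add, TensorProduct.add_tmul, TensorProduct.tmul_add, hx, hy]
  | add x y hx hy => simp only [map_add, hx, hy]

theorem head2_comulOp (y : G ⊗[k] G) :
    head2 G H.comulOp (Algebra.TensorProduct.comm k G G y) = rev k G (tail G H.comul y) := by
  induction y using tensor_induction₂ with
  | tmul a b =>
    rw [Algebra.TensorProduct.comm_tmul, tail_tmul, head2_tmul', comulOp_apply]
    generalize H.comul b = z
    induction z using tensor_induction₂ with
    | tmul a b => simp
    | add x y hx hy => simp only [map_add, TensorProduct.add_tmul, TensorProduct.tmul_add, hx, hy]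
  | add x y hx hy => simp only [map_add, hx, hy]

theorem dropHead_comm (y : G ⊗[k] G) :
    dropHead G H.counit (Algebra.TensorProduct.comm k G G y) = dropTail G H.counit y := by
  induction y using tensor_induction₂ with
  | tmul a b => simp
  | add x y hx hy => simp only [map_add, hx, hy]

theorem Sinv_mul (a b : G) : H.Sinv (a * b) = H.Sinv b * H.Sinv a := H.toCore.Sinv_mul a b

@[simp] theorem Sinv_S (a : G) : H.Sinv (H.S a) = a := H.toCore.Sinv_S a

@[simp] theorem S_Sinv (a : G) : H.S (H.Sinv a) = a := H.toCore.S_Sinv a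

/-- The quasi-Hopf algebra with the opposite coproduct. -/
def copCore : QuasiHopfCore k G where
  comul := H.comulOp
  counit := H.counit
  phi := Units.map (MonoidHomClass.toMonoidHom (rev k G)) H.phi⁻¹
  quasi_coassoc a := by
    change tail G H.comulOp (H.comulOp a) * rev k G H.phi⁻¹.val =
      rev k G H.phi⁻¹.val * head2 G H.comulOp (H.comulOp a)
    rw [comulOp_apply, tail_comulOp, head2_comulOp, ← map_mul, ← map_mul, H.Phi_inv_conj]
  counit_left a := by rw [comulOp_apply, dropHead_comm, H.counit_right]
  antipode := H.antipode.symm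
  alpha := H.Sinv H.alpha
  beta := H.Sinv H.beta
  antipode_one := H.toCore.Sinv_one
  antipode_mul := H.toCore.Sinv_mul
  antipode_alpha a := by
    have h := congrArg H.Sinv (H.antipode_alpha a)
    rw [map_smul] at h
    rw [← h, comulOp_apply]
    generalize H.comul a = y
    induction y using tensor_induction₂ with
    | tmul a b => simp [Sinv_mul, mul_assoc]; simp [Sinv]
    | add x y hx hy => simp only [map_add, hx, hy]
  antipode_beta a := by
    have h := congrArg H.Sinv (H.antipode_beta a)
    rw [map_smul] at h
    rw [← h, comulOp_apply]
    generalize H.comul a = y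
    induction y using tensor_induction₂ with
    | tmul a b => simp [Sinv_mul, mul_assoc]; simp [Sinv]
    | add x y hx hy => simp only [map_add, hx, hy]
  antipode_phi := by
    have h := congrArg H.Sinv H.antipode_phi_inv
    rw [show H.Sinv 1 = 1 from H.toCore.Sinv_one] at h
    refine Eq.trans ?_ h
    change (_ : G ⊗[k] (G ⊗[k] G) →ₗ[k] G) (rev k G H.phi⁻¹.val) = _
    generalize H.phi⁻¹.val = t
    induction t using tensor_induction₃ with
    | tmul a b c => simp [Sinv_mul, mul_assoc]; simp [Sinv]
    | add x y hx hy => simp only [map_add, hx, hy]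
  antipode_phi_inv := by
    have h := congrArg H.Sinv H.antipode_phi
    rw [show H.Sinv 1 = 1 from H.toCore.Sinv_one] at h
    refine Eq.trans ?_ h
    change (_ : G ⊗[k] (G ⊗[k] G) →ₗ[k] G) (rev k G H.phi.val) = _
    generalize H.phi.val = t
    induction t using tensor_induction₃ with
    | tmul a b c => simp [Sinv_mul, mul_assoc]; simp [Sinv]
    | add x y hx hy => simp only [map_add, hx, hy]

end Cop

end QuasiHopfAlgebra

/-! ### The twist of `Gᶜᵒᵖ`. -/

namespace QuasiHopfAlgebra

variable {k : Type u} [Field k] {G : Type v} [Ring G] [Algebra k G] (H : QuasiHopfAlgebra k G)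

/-- `a ⊗ b ⊗ c ⊗ d ↦ d ⊗ c ⊗ b ⊗ a` -/
def rev₄ (k : Type u) [Field k] (G : Type v) [Ring G] [Algebra k G] :
    G ⊗[k] (G ⊗[k] (G ⊗[k] G)) →ₐ[k] G ⊗[k] (G ⊗[k] (G ⊗[k] G)) :=
  (asc3 k G G G G).comp
    ((Algebra.TensorProduct.map (rev k G) (AlgHom.id k G)).comp
      (Algebra.TensorProduct.comm k G (G ⊗[k] (G ⊗[k] G))).toAlgHom)

@[simp] theorem rev₄_tmul (a b c d : G) :
    rev₄ k G (a ⊗ₜ[k] (b ⊗ₜ[k] (c ⊗ₜ[k] d))) = d ⊗ₜ[k] (c ⊗ₜ[k] (b ⊗ₜ[k] a)) := rfl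

/-- The pentagon rewrites the defining tensor of `γ` with an extra left factor `(id ⊗ Δ ⊗ id)(φ)`,
which contracts to `1`. The remaining tensor, reversed, is the one defining `γ` for `Gᶜᵒᵖ`. -/
theorem gamma_eq : H.gamma = H.toCore.contractPair (tail G (tail G (appendOne G G)) H.phi.val *
    head2 (G ⊗[k] G) H.comul H.phi⁻¹.val) := by
  have hB : head2 (G ⊗[k] G) H.comul H.phi.val * head2 (G ⊗[k] G) H.comul H.phi⁻¹.val = 1 := by
    rw [← map_mul, Units.mul_inv, map_one]
  have hC : ((1 : G) ⊗ₜ[k] H.phi⁻¹.val) * ((1 : G) ⊗ₜ[k] H.phi.val) = 1 := by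
    rw [Algebra.TensorProduct.tmul_mul_tmul, Units.inv_mul, one_mul]
    rfl
  have h : H.toCore.theta = tail G (head2 G H.comul) H.phi.val *
      (tail G (tail G (appendOne G G)) H.phi.val * head2 (G ⊗[k] G) H.comul H.phi⁻¹.val) := by
    calc H.toCore.theta = ((1 : G) ⊗ₜ[k] H.phi⁻¹.val) * (tail G (tail G H.comul) H.phi.val *
          head2 (G ⊗[k] G) H.comul H.phi.val) * head2 (G ⊗[k] G) H.comul H.phi⁻¹.val := by
            rw [mul_assoc, mul_assoc, hB, mul_one]
            rfl
      _ = _ := by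
        rw [H.pentagon]
        simp only [← mul_assoc]
        rw [hC, one_mul]
  change H.toCore.contractPair H.toCore.theta = _
  rw [h, contractPair_comul_mul, H.counit_phi, map_one, one_mul]

theorem copCore_gamma : H.copCore.gamma =
    Algebra.TensorProduct.comm k G G (H.flipSinv H.gamma) := by
  have h1 : H.copCore.theta = rev₄ k G (tail G (tail G (appendOne G G)) H.phi.val *
      head2 (G ⊗[k] G) H.comul H.phi⁻¹.val) := by
    have e1 : ∀ x, (1 : G) ⊗ₜ[k] rev k G x = rev₄ k G (tail G (tail G (appendOne G G)) x) := by
      intro x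
      induction x using tensor_induction₃ with
      | tmul a b c => simp
      | add x y hx hy => simp only [map_add, TensorProduct.tmul_add, hx, hy]
    have e2 : ∀ x, tail G (tail G H.comulOp) (rev k G x) =
        rev₄ k G (head2 (G ⊗[k] G) H.comul x) := by
      intro x
      induction x using tensor_induction₃ with
      | tmul a b c =>
        rw [rev_tmul, tail_tmul, tail_tmul, comulOp_apply, head2_tmul']
        generalize H.comul a = z
        induction z using tensor_induction₂ with
        | tmul a b => simp
        | add x y hx hy => simp only [map_add, TensorProduct.add_tmul, TensorProduct.tmul_add, hx, hy]
      | add x y hx hy => simp only [map_add, hx, hy]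
    rw [map_mul, ← e1, ← e2]
    rfl
  have h2 : ∀ x, H.copCore.contractPair (rev₄ k G x) =
      Algebra.TensorProduct.comm k G G (H.flipSinv (H.toCore.contractPair x)) := by
    have hs : ∀ a, H.copCore.S a = H.Sinv a := fun _ => rfl
    have hs' : ∀ a, H.toCore.S a = H.S a := fun _ => rfl
    have ha : H.copCore.alpha = H.Sinv H.alpha := rfl
    have ha' : H.toCore.alpha = H.alpha := rfl
    intro x
    induction x using tensor_induction₄ with
    | tmul a b c d =>
      simp [flipSinv, hs, hs', ha, ha', Sinv_mul, mul_assoc]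
    | add x y hx hy => simp only [map_add, hx, hy]
  rw [QuasiHopfCore.gamma, h1, h2, ← gamma_eq]

/-- Applying `S⁻¹` to the twist identities of `F` and flipping gives those of `h²¹`, since the
antipode of `Gᶜᵒᵖ` is `S⁻¹` and its `α` is `S⁻¹(α)`. -/
theorem isTwist_copCore : H.copCore.IsTwist (Algebra.TensorProduct.comm k G G H.twistH) where
  mul_comul_S a := by
    change _ * Algebra.TensorProduct.comm k G G (H.comul (H.toCore.Sinv a)) = _
    rw [← map_mul]
    have h := H.isTwist_twistF.flipSinv_mul_comul a
    change H.twistH * H.comul (H.toCore.Sinv a) = _ at h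
    rw [h, H.toCore.flipSinv_mul, map_mul]
    congr 1
    change _ = H.copCore.flipS (Algebra.TensorProduct.comm k G G (H.comul a))
    change Algebra.TensorProduct.comm k G G (H.toCore.flipSinv (H.comul a)) = _
    generalize H.comul a = y
    induction y using tensor_induction₂ with
    | tmul a b => rfl
    | add x y hx hy => simp only [map_add, hx, hy]
  mul_comul_alpha := by
    change _ * Algebra.TensorProduct.comm k G G (H.comul (H.toCore.Sinv H.alpha)) = _
    rw [← map_mul, copCore_gamma]
    have h := H.isTwist_twistF.flipSinv_mul_comul H.alpha
    change H.twistH * H.comul (H.toCore.Sinv H.alpha) =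
      H.flipSinv (H.twistF * H.comul H.alpha) at h
    rw [h, twistF_mul_comul_alpha]

end QuasiHopfAlgebra

/-! ### Tensor products of quasi-Hopf algebras. -/

section Interchange

variable (k : Type u) [Field k] (A B : Type*) [Ring A] [Algebra k A] [Ring B] [Algebra k B]

variable (A' B' : Type*) [Ring A'] [Algebra k A'] [Ring B'] [Algebra k B']

/-- `(a ⊗ a') ⊗ (b ⊗ b') ↦ (a ⊗ b) ⊗ (a' ⊗ b')` -/
def mix : (A ⊗[k] A') ⊗[k] (B ⊗[k] B') →ₐ[k] (A ⊗[k] B) ⊗[k] (A' ⊗[k] B') :=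
  (Algebra.TensorProduct.tensorTensorTensorComm k k k k A A' B B').toAlgHom

@[simp] theorem mix_tmul (a : A) (a' : A') (b : B) (b' : B') :
    mix k A B A' B' ((a ⊗ₜ[k] a') ⊗ₜ[k] (b ⊗ₜ[k] b')) = (a ⊗ₜ[k] b) ⊗ₜ[k] (a' ⊗ₜ[k] b') := rfl

/-- the threefold version of `mix` -/
def mix₃ : (A ⊗[k] (A ⊗[k] A)) ⊗[k] (B ⊗[k] (B ⊗[k] B)) →ₐ[k]
    (A ⊗[k] B) ⊗[k] ((A ⊗[k] B) ⊗[k] (A ⊗[k] B)) :=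
  (tail (A ⊗[k] B) (mix k A B A B)).comp (mix k A B (A ⊗[k] A) (B ⊗[k] B))

@[simp] theorem mix₃_tmul (a a' a'' : A) (b b' b'' : B) :
    mix₃ k A B ((a ⊗ₜ[k] (a' ⊗ₜ[k] a'')) ⊗ₜ[k] (b ⊗ₜ[k] (b' ⊗ₜ[k] b''))) =
      (a ⊗ₜ[k] b) ⊗ₜ[k] ((a' ⊗ₜ[k] b') ⊗ₜ[k] (a'' ⊗ₜ[k] b'')) := rfl

/-- the fourfold version of `mix` -/
def mix₄ : (A ⊗[k] (A ⊗[k] (A ⊗[k] A))) ⊗[k] (B ⊗[k] (B ⊗[k] (B ⊗[k] B))) →ₐ[k]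
    (A ⊗[k] B) ⊗[k] ((A ⊗[k] B) ⊗[k] ((A ⊗[k] B) ⊗[k] (A ⊗[k] B))) :=
  (tail (A ⊗[k] B) (mix₃ k A B)).comp (mix k A B (A ⊗[k] (A ⊗[k] A)) (B ⊗[k] (B ⊗[k] B)))

@[simp] theorem mix₄_tmul (a a' : A) (y : A ⊗[k] A) (b b' : B) (z : B ⊗[k] B) :
    mix₄ k A B ((a ⊗ₜ[k] (a' ⊗ₜ[k] y)) ⊗ₜ[k] (b ⊗ₜ[k] (b' ⊗ₜ[k] z))) =
      (a ⊗ₜ[k] b) ⊗ₜ[k] ((a' ⊗ₜ[k] b') ⊗ₜ[k] mix k A B A B (y ⊗ₜ[k] z)) := rfl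

end Interchange

namespace QuasiHopfCore

variable {k : Type u} [Field k] {A B : Type v} [Ring A] [Algebra k A] [Ring B] [Algebra k B]
variable (H : QuasiHopfCore k A) (K : QuasiHopfCore k B)

/-- the coproduct of `H ⊗ K` -/
def prodComul : A ⊗[k] B →ₐ[k] (A ⊗[k] B) ⊗[k] (A ⊗[k] B) :=
  (mix k A B A B).comp (Algebra.TensorProduct.map H.comul K.comul)

theorem prodComul_tmul (a : A) (b : B) :
    H.prodComul K (a ⊗ₜ[k] b) = mix k A B A B (H.comul a ⊗ₜ[k] K.comul b) := rfl

/-- the counit of `H ⊗ K` -/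
def prodCounit : A ⊗[k] B →ₐ[k] k :=
  (Algebra.TensorProduct.lmul' k).comp (Algebra.TensorProduct.map H.counit K.counit)

@[simp] theorem prodCounit_tmul (a : A) (b : B) :
    H.prodCounit K (a ⊗ₜ[k] b) = H.counit a * K.counit b := rfl

theorem tail_prodComul_mix (y : A ⊗[k] A) (z : B ⊗[k] B) :
    tail (A ⊗[k] B) (H.prodComul K) (mix k A B A B (y ⊗ₜ[k] z)) =
      mix₃ k A B (tail A H.comul y ⊗ₜ[k] tail B K.comul z) := by
  induction y using tensor_induction₂ with
  | tmul a b =>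
    induction z using tensor_induction₂ with
    | tmul c d => rfl
    | add x y hx hy => simp only [map_add, TensorProduct.tmul_add, hx, hy]
  | add x y hx hy => simp only [map_add, TensorProduct.add_tmul, hx, hy]

theorem asc_mix (y : A ⊗[k] A) (z : B ⊗[k] B) (a : A) (b : B) :
    asc k (A ⊗[k] B) (A ⊗[k] B) (A ⊗[k] B) (mix k A B A B (y ⊗ₜ[k] z) ⊗ₜ[k] (a ⊗ₜ[k] b)) =
      mix₃ k A B (asc k A A A (y ⊗ₜ[k] a) ⊗ₜ[k] asc k B B B (z ⊗ₜ[k] b)) := by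
  induction y using tensor_induction₂ with
  | tmul c d =>
    induction z using tensor_induction₂ with
    | tmul e f => rfl
    | add x y hx hy => simp only [map_add, TensorProduct.tmul_add, TensorProduct.add_tmul, hx, hy]
  | add x y hx hy => simp only [map_add, TensorProduct.add_tmul, hx, hy]

theorem head2_prodComul_mix (y : A ⊗[k] A) (z : B ⊗[k] B) :
    head2 (A ⊗[k] B) (H.prodComul K) (mix k A B A B (y ⊗ₜ[k] z)) =
      mix₃ k A B (head2 A H.comul y ⊗ₜ[k] head2 B K.comul z) := by
  induction y using tensor_induction₂ with
  | tmul a b =>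
    induction z using tensor_induction₂ with
    | tmul c d =>
      rw [mix_tmul, head2_tmul', prodComul_tmul, asc_mix]
      rfl
    | add x y hx hy => simp only [map_add, TensorProduct.tmul_add, hx, hy]
  | add x y hx hy => simp only [map_add, TensorProduct.add_tmul, hx, hy]

/-- the reassociator of `H ⊗ K` -/
def prodPhi : ((A ⊗[k] B) ⊗[k] ((A ⊗[k] B) ⊗[k] (A ⊗[k] B)))ˣ where
  val := mix₃ k A B (H.phi.val ⊗ₜ[k] K.phi.val)
  inv := mix₃ k A B (H.phi⁻¹.val ⊗ₜ[k] K.phi⁻¹.val)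
  val_inv := by
    rw [← map_mul, Algebra.TensorProduct.tmul_mul_tmul, Units.mul_inv, Units.mul_inv,
      ← Algebra.TensorProduct.one_def, map_one]
  inv_val := by
    rw [← map_mul, Algebra.TensorProduct.tmul_mul_tmul, Units.inv_mul, Units.inv_mul,
      ← Algebra.TensorProduct.one_def, map_one]

/-- The tensor product of two quasi-Hopf algebras. -/
def prod : QuasiHopfCore k (A ⊗[k] B) where
  comul := H.prodComul K
  counit := H.prodCounit K
  phi := H.prodPhi K
  quasi_coassoc x := by
    induction x using tensor_induction₂ with
    | tmul a b =>
      rw [prodComul_tmul, tail_prodComul_mix, head2_prodComul_mix]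
      change _ * mix₃ k A B _ = mix₃ k A B _ * _
      rw [← map_mul, ← map_mul, Algebra.TensorProduct.tmul_mul_tmul,
        Algebra.TensorProduct.tmul_mul_tmul, H.quasi_coassoc, K.quasi_coassoc]
    | add x y hx hy => simp only [map_add, add_mul, mul_add, hx, hy]
  counit_left x := by
    have h : ∀ (y : A ⊗[k] A) (z : B ⊗[k] B), dropHead (A ⊗[k] B) (H.prodCounit K)
        (mix k A B A B (y ⊗ₜ[k] z)) = dropHead A H.counit y ⊗ₜ[k] dropHead B K.counit z := by
      intro y z
      induction y using tensor_induction₂ with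
      | tmul a b =>
        induction z using tensor_induction₂ with
        | tmul c d => simp [TensorProduct.smul_tmul', TensorProduct.tmul_smul, smul_smul, mul_comm]
        | add x y hx hy => simp only [map_add, TensorProduct.tmul_add, hx, hy]
      | add x y hx hy => simp only [map_add, TensorProduct.add_tmul, hx, hy]
    induction x using tensor_induction₂ with
    | tmul a b => rw [prodComul_tmul, h, H.counit_left, K.counit_left]
    | add x y hx hy => simp only [map_add, hx, hy]
  antipode := TensorProduct.congr H.antipode K.antipode
  alpha := H.alpha ⊗ₜ[k] K.alpha
  beta := H.beta ⊗ₜ[k] K.beta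
  antipode_one := by
    rw [Algebra.TensorProduct.one_def, TensorProduct.congr_tmul, H.antipode_one, K.antipode_one]
  antipode_mul x y := by
    induction x using tensor_induction₂ with
    | tmul a b =>
      induction y using tensor_induction₂ with
      | tmul c d => simp [H.antipode_mul, K.antipode_mul]
      | add x y hx hy => simp only [map_add, mul_add, add_mul, hx, hy]
    | add x y hx hy => simp only [map_add, mul_add, add_mul, hx, hy]
  antipode_alpha x := by
    have h : ∀ (y : A ⊗[k] A) (z : B ⊗[k] B), mul' k (A ⊗[k] B) (TensorProduct.map
        (TensorProduct.congr H.antipode K.antipode).toLinearMap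
        (mulLeft k (H.alpha ⊗ₜ[k] K.alpha)) (mix k A B A B (y ⊗ₜ[k] z))) =
        mul' k A (TensorProduct.map H.antipode.toLinearMap (mulLeft k H.alpha) y) ⊗ₜ[k]
        mul' k B (TensorProduct.map K.antipode.toLinearMap (mulLeft k K.alpha) z) := by
      intro y z
      induction y using tensor_induction₂ with
      | tmul a b =>
        induction z using tensor_induction₂ with
        | tmul c d => simp
        | add x y hx hy => simp only [map_add, TensorProduct.tmul_add, hx, hy]
      | add x y hx hy => simp only [map_add, TensorProduct.add_tmul, hx, hy]
    induction x using tensor_induction₂ with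
    | tmul a b =>
      rw [prodComul_tmul, h, H.antipode_alpha, K.antipode_alpha, prodCounit_tmul,
        TensorProduct.smul_tmul_smul]
    | add x y hx hy => simp only [map_add, add_smul, hx, hy]
  antipode_beta x := by
    have h : ∀ (y : A ⊗[k] A) (z : B ⊗[k] B), mul' k (A ⊗[k] B) (TensorProduct.map
        (mulRight k (H.beta ⊗ₜ[k] K.beta))
        (TensorProduct.congr H.antipode K.antipode).toLinearMap (mix k A B A B (y ⊗ₜ[k] z))) =
        mul' k A (TensorProduct.map (mulRight k H.beta) H.antipode.toLinearMap y) ⊗ₜ[k]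
        mul' k B (TensorProduct.map (mulRight k K.beta) K.antipode.toLinearMap z) := by
      intro y z
      induction y using tensor_induction₂ with
      | tmul a b =>
        induction z using tensor_induction₂ with
        | tmul c d => simp
        | add x y hx hy => simp only [map_add, TensorProduct.tmul_add, hx, hy]
      | add x y hx hy => simp only [map_add, TensorProduct.add_tmul, hx, hy]
    induction x using tensor_induction₂ with
    | tmul a b =>
      rw [prodComul_tmul, h, H.antipode_beta, K.antipode_beta, prodCounit_tmul,
        TensorProduct.smul_tmul_smul]
    | add x y hx hy => simp only [map_add, add_smul, hx, hy]
  antipode_phi := by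
    refine Eq.trans (b := (1 : A) ⊗ₜ[k] (1 : B)) ?_ rfl
    rw [← H.antipode_phi, ← K.antipode_phi]
    change (_ : (A ⊗[k] B) ⊗[k] ((A ⊗[k] B) ⊗[k] (A ⊗[k] B)) →ₗ[k] A ⊗[k] B)
      (mix₃ k A B (H.phi.val ⊗ₜ[k] K.phi.val)) = _
    generalize H.phi.val = y
    generalize K.phi.val = z
    induction y using tensor_induction₃ with
    | tmul a b c =>
      induction z using tensor_induction₃ with
      | tmul d e f => simp
      | add x y hx hy => simp only [map_add, TensorProduct.tmul_add, hx, hy]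
    | add x y hx hy => simp only [map_add, TensorProduct.add_tmul, hx, hy]
  antipode_phi_inv := by
    refine Eq.trans (b := (1 : A) ⊗ₜ[k] (1 : B)) ?_ rfl
    rw [← H.antipode_phi_inv, ← K.antipode_phi_inv]
    change (_ : (A ⊗[k] B) ⊗[k] ((A ⊗[k] B) ⊗[k] (A ⊗[k] B)) →ₗ[k] A ⊗[k] B)
      (mix₃ k A B (H.phi⁻¹.val ⊗ₜ[k] K.phi⁻¹.val)) = _
    generalize H.phi⁻¹.val = y
    generalize K.phi⁻¹.val = z
    induction y using tensor_induction₃ with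
    | tmul a b c =>
      induction z using tensor_induction₃ with
      | tmul d e f => simp
      | add x y hx hy => simp only [map_add, TensorProduct.tmul_add, hx, hy]
    | add x y hx hy => simp only [map_add, TensorProduct.add_tmul, hx, hy]

@[simp] theorem prod_S_tmul (a : A) (b : B) :
    (H.prod K).S (a ⊗ₜ[k] b) = H.S a ⊗ₜ[k] K.S b := rfl

@[simp] theorem prod_Sinv_tmul (a : A) (b : B) :
    (H.prod K).Sinv (a ⊗ₜ[k] b) = H.Sinv a ⊗ₜ[k] K.Sinv b := rfl

theorem prod_flipS_mix (y : A ⊗[k] A) (z : B ⊗[k] B) :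
    (H.prod K).flipS (mix k A B A B (y ⊗ₜ[k] z)) =
      mix k A B A B (H.flipS y ⊗ₜ[k] K.flipS z) := by
  induction y using tensor_induction₂ with
  | tmul a b =>
    induction z using tensor_induction₂ with
    | tmul c d => rfl
    | add x y hx hy => simp only [map_add, TensorProduct.tmul_add, hx, hy]
  | add x y hx hy => simp only [map_add, TensorProduct.add_tmul, hx, hy]

theorem prod_flipSinv_mix (y : A ⊗[k] A) (z : B ⊗[k] B) :
    (H.prod K).flipSinv (mix k A B A B (y ⊗ₜ[k] z)) =
      mix k A B A B (H.flipSinv y ⊗ₜ[k] K.flipSinv z) := by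
  induction y using tensor_induction₂ with
  | tmul a b =>
    induction z using tensor_induction₂ with
    | tmul c d => rfl
    | add x y hx hy => simp only [map_add, TensorProduct.tmul_add, hx, hy]
  | add x y hx hy => simp only [map_add, TensorProduct.add_tmul, hx, hy]

theorem prod_gamma : (H.prod K).gamma = mix k A B A B (H.gamma ⊗ₜ[k] K.gamma) := by
  have h1 : (H.prod K).theta = mix₄ k A B (H.theta ⊗ₜ[k] K.theta) := by
    have e1 : ((1 : A ⊗[k] B) ⊗ₜ[k] mix₃ k A B (H.phi⁻¹.val ⊗ₜ[k] K.phi⁻¹.val)) =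
        mix₄ k A B (((1 : A) ⊗ₜ[k] H.phi⁻¹.val) ⊗ₜ[k] ((1 : B) ⊗ₜ[k] K.phi⁻¹.val)) := rfl
    have e2 : ∀ (y : A ⊗[k] (A ⊗[k] A)) (z : B ⊗[k] (B ⊗[k] B)),
        tail (A ⊗[k] B) (tail (A ⊗[k] B) (H.prodComul K)) (mix₃ k A B (y ⊗ₜ[k] z)) =
          mix₄ k A B (tail A (tail A H.comul) y ⊗ₜ[k] tail B (tail B K.comul) z) := by
      intro y z
      induction y using tensor_induction₃ with
      | tmul a b c =>
        induction z using tensor_induction₃ with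
        | tmul d e f => rfl
        | add x y hx hy => simp only [map_add, TensorProduct.tmul_add, hx, hy]
      | add x y hx hy => simp only [map_add, TensorProduct.add_tmul, hx, hy]
    change ((1 : A ⊗[k] B) ⊗ₜ[k] mix₃ k A B (H.phi⁻¹.val ⊗ₜ[k] K.phi⁻¹.val)) *
      tail (A ⊗[k] B) (tail (A ⊗[k] B) (H.prodComul K)) (mix₃ k A B (H.phi.val ⊗ₜ[k] K.phi.val)) = _
    rw [e1, e2, ← map_mul, Algebra.TensorProduct.tmul_mul_tmul]
    rfl
  have h2 : ∀ (y : A ⊗[k] (A ⊗[k] (A ⊗[k] A))) (z : B ⊗[k] (B ⊗[k] (B ⊗[k] B))),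
      (H.prod K).contractPair (mix₄ k A B (y ⊗ₜ[k] z)) =
        mix k A B A B (H.contractPair y ⊗ₜ[k] K.contractPair z) := by
    have ha : (H.prod K).alpha = H.alpha ⊗ₜ[k] K.alpha := rfl
    intro y z
    induction y using tensor_induction₄ with
    | tmul a b c d =>
      induction z using tensor_induction₄ with
      | tmul e f g h => simp [ha]
      | add x y hx hy => simp only [map_add, TensorProduct.tmul_add, hx, hy]
    | add x y hx hy => simp only [map_add, TensorProduct.add_tmul, hx, hy]
  rw [gamma, h1, h2]
  rfl

variable {H K}

theorem IsTwist.prod {F : A ⊗[k] A} {E : B ⊗[k] B} (hF : H.IsTwist F) (hE : K.IsTwist E) :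
    (H.prod K).IsTwist (mix k A B A B (F ⊗ₜ[k] E)) where
  mul_comul_S x := by
    induction x using tensor_induction₂ with
    | tmul a b =>
      rw [prod_S_tmul]
      change _ * H.prodComul K _ = (H.prod K).flipS (H.prodComul K _) * _
      rw [prodComul_tmul, prodComul_tmul, prod_flipS_mix, ← map_mul, ← map_mul,
        Algebra.TensorProduct.tmul_mul_tmul, Algebra.TensorProduct.tmul_mul_tmul, hF.mul_comul_S,
        hE.mul_comul_S]
    | add x y hx hy => simp only [map_add, mul_add, add_mul, hx, hy]
  mul_comul_alpha := by
    rw [prod_gamma]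
    change _ * H.prodComul K (H.alpha ⊗ₜ[k] K.alpha) = _
    rw [prodComul_tmul, ← map_mul, Algebra.TensorProduct.tmul_mul_tmul, hF.mul_comul_alpha,
      hE.mul_comul_alpha]

end QuasiHopfCore

/-! ### Two-sided coactions as left coactions. -/

section Gather

variable {k : Type u} [Field k] {G : Type v} [Ring G] [Algebra k G]
variable (M : Type w) [Ring M] [Algebra k M]

/-- moves the last tensor factor of `B` past `A` -/
def popLast {B B' : Type*} [Ring B] [Algebra k B] [Ring B'] [Algebra k B'] (A : Type*) [Ring A]
    [Algebra k A] (x : B →ₐ[k] B' ⊗[k] G) : A ⊗[k] B →ₐ[k] (A ⊗[k] B') ⊗[k] G :=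
  (asc k A B' G).symm.toAlgHom.comp (tail A x)

variable (k G)

/-- `a ⊗ m ⊗ b ↦ (a ⊗ b) ⊗ m` -/
def gather : G ⊗[k] (M ⊗[k] G) →ₐ[k] (G ⊗[k] G) ⊗[k] M :=
  (asc k G G M).symm.toAlgHom.comp (tail G (Algebra.TensorProduct.comm k M G).toAlgHom)

/-- `a ⊗ b ⊗ m ⊗ c ⊗ d ↦ (a ⊗ d) ⊗ (b ⊗ c) ⊗ m` -/
def gather₂ : G ⊗[k] (G ⊗[k] (M ⊗[k] (G ⊗[k] G))) →ₐ[k] (G ⊗[k] G) ⊗[k] ((G ⊗[k] G) ⊗[k] M) :=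
  (tail (G ⊗[k] G) (gather k G M)).comp ((gather k G (G ⊗[k] (M ⊗[k] G))).comp
    (tail G (popLast G (popLast M (AlgHom.id k (G ⊗[k] G))))))

/-- `a ⊗ b ⊗ c ⊗ m ⊗ d ⊗ e ⊗ f ↦ (a ⊗ f) ⊗ (b ⊗ e) ⊗ (c ⊗ d) ⊗ m` -/
def gather₃ : G ⊗[k] (G ⊗[k] (G ⊗[k] (M ⊗[k] (G ⊗[k] (G ⊗[k] G))))) →ₐ[k]
    (G ⊗[k] G) ⊗[k] ((G ⊗[k] G) ⊗[k] ((G ⊗[k] G) ⊗[k] M)) :=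
  (tail (G ⊗[k] G) (gather₂ k G M)).comp ((gather k G (G ⊗[k] (G ⊗[k] (M ⊗[k] (G ⊗[k] G))))).comp
    (tail G (popLast G (popLast G (popLast M (popLast G (AlgHom.id k (G ⊗[k] G))))))))

variable {k G M}

@[simp] theorem gather_tmul (a b : G) (m : M) :
    gather k G M (a ⊗ₜ[k] (m ⊗ₜ[k] b)) = (a ⊗ₜ[k] b) ⊗ₜ[k] m := rfl

@[simp] theorem gather₂_tmul (a b c d : G) (m : M) :
    gather₂ k G M (a ⊗ₜ[k] (b ⊗ₜ[k] (m ⊗ₜ[k] (c ⊗ₜ[k] d)))) =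
      (a ⊗ₜ[k] d) ⊗ₜ[k] ((b ⊗ₜ[k] c) ⊗ₜ[k] m) := rfl

end Gather

namespace TwoSidedCoaction

variable {k : Type u} [Field k] {G : Type v} [Ring G] [Algebra k G] {H : QuasiHopfAlgebra k G}

/-- `G ⊗ Gᶜᵒᵖ` -/
abbrev _root_.QuasiHopf.QuasiHopfAlgebra.double (H : QuasiHopfAlgebra k G) :
    QuasiHopfCore k (G ⊗[k] G) := H.toCore.prod H.copCore

theorem double_comul_tmul (a b : G) : H.double.comul (a ⊗ₜ[k] b) =
    mix k G G G G (H.comul a ⊗ₜ[k] Algebra.TensorProduct.comm k G G (H.comul b)) := rfl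

@[simp] theorem double_counit_tmul (a b : G) :
    H.double.counit (a ⊗ₜ[k] b) = H.counit a * H.counit b := rfl

variable {M : Type w} [Ring M] [Algebra k M] (D : TwoSidedCoaction H.toQuasiBialgebra M)

theorem tail_gather_delta (y : G ⊗[k] (M ⊗[k] G)) :
    tail (G ⊗[k] G) ((gather k G M).comp D.delta) (gather k G M y) =
      gather₂ k G M (tail G (head3 G D.delta) y) := by
  induction y using tensor_induction₃ with
  | tmul a m b =>
    rw [gather_tmul, tail_tmul, tail_tmul, head3_tmul', AlgHom.comp_apply]
    generalize D.delta m = y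
    induction y using tensor_induction₃ with
    | tmul c n d => rfl
    | add x y hx hy => simp only [map_add, TensorProduct.tmul_add, TensorProduct.add_tmul, hx, hy]
  | add x y hx hy => simp only [map_add, hx, hy]

theorem tail_tail_gather_delta (y : G ⊗[k] (G ⊗[k] (M ⊗[k] (G ⊗[k] G)))) :
    tail (G ⊗[k] G) (tail (G ⊗[k] G) ((gather k G M).comp D.delta)) (gather₂ k G M y) =
      gather₃ k G M (tail G (tail G (head3 (G ⊗[k] G) D.delta)) y) := by
  induction y using tensor_induction₅ with
  | tmul a b m c d =>
    rw [gather₂_tmul, tail_tmul, tail_tmul, tail_tmul, tail_tmul, head3_tmul', AlgHom.comp_apply]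
    generalize D.delta m = y
    induction y using tensor_induction₃ with
    | tmul c n d => rfl
    | add x y hx hy => simp only [map_add, TensorProduct.tmul_add, TensorProduct.add_tmul, hx, hy]
  | add x y hx hy => simp only [map_add, hx, hy]

theorem head2_double_gather (y : G ⊗[k] (M ⊗[k] G)) :
    head2 M H.double.comul (gather k G M y) =
      gather₂ k G M (head2 (M ⊗[k] (G ⊗[k] G)) H.comul (tail G (tail M H.comul) y)) := by
  induction y using tensor_induction₃ with
  | tmul a m b =>
    rw [gather_tmul, head2_tmul', double_comul_tmul, tail_tmul, tail_tmul, head2_tmul']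
    generalize H.comul a = y
    generalize H.comul b = z
    induction y using tensor_induction₂ with
    | tmul c d =>
      induction z using tensor_induction₂ with
      | tmul e f => rfl
      | add x y hx hy => simp only [map_add, TensorProduct.tmul_add, TensorProduct.add_tmul, hx, hy]
    | add x y hx hy => simp only [map_add, TensorProduct.add_tmul, hx, hy]
  | add x y hx hy => simp only [map_add, hx, hy]

theorem head2_double_gather₂ (y : G ⊗[k] (G ⊗[k] (M ⊗[k] (G ⊗[k] G)))) :
    head2 ((G ⊗[k] G) ⊗[k] M) H.double.comul (gather₂ k G M y) =
      gather₃ k G M (head2 (G ⊗[k] (M ⊗[k] (G ⊗[k] (G ⊗[k] G)))) H.comul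
          (tail G (tail G (tail M (tail G H.comul))) y)) := by
  induction y using tensor_induction₅ with
  | tmul a b m c d =>
    rw [gather₂_tmul, head2_tmul', double_comul_tmul, tail_tmul, tail_tmul, tail_tmul, tail_tmul,
      head2_tmul']
    generalize H.comul a = y
    generalize H.comul d = z
    induction y using tensor_induction₂ with
    | tmul c d =>
      induction z using tensor_induction₂ with
      | tmul e f => rfl
      | add x y hx hy => simp only [map_add, TensorProduct.tmul_add, TensorProduct.add_tmul, hx, hy]
    | add x y hx hy => simp only [map_add, TensorProduct.add_tmul, hx, hy]
  | add x y hx hy => simp only [map_add, hx, hy]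

theorem tail_head2_double_gather₂ (y : G ⊗[k] (G ⊗[k] (M ⊗[k] (G ⊗[k] G)))) :
    tail (G ⊗[k] G) (head2 M H.double.comul) (gather₂ k G M y) =
      gather₃ k G M (tail G (head2 (M ⊗[k] (G ⊗[k] (G ⊗[k] G))) H.comul)
          (tail G (tail G (tail M (head2 G H.comul))) y)) := by
  induction y using tensor_induction₅ with
  | tmul a b m c d =>
    rw [gather₂_tmul, tail_tmul, head2_tmul', double_comul_tmul, tail_tmul, tail_tmul, tail_tmul,
      tail_tmul, head2_tmul', head2_tmul']
    generalize H.comul b = y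
    generalize H.comul c = z
    induction y using tensor_induction₂ with
    | tmul c d =>
      induction z using tensor_induction₂ with
      | tmul e f => rfl
      | add x y hx hy => simp only [map_add, TensorProduct.tmul_add, TensorProduct.add_tmul, hx, hy]
    | add x y hx hy => simp only [map_add, TensorProduct.tmul_add, TensorProduct.add_tmul, hx, hy]
  | add x y hx hy => simp only [map_add, hx, hy]

theorem one_tmul_gather₂ (y : G ⊗[k] (G ⊗[k] (M ⊗[k] (G ⊗[k] G)))) :
    (1 : G ⊗[k] G) ⊗ₜ[k] gather₂ k G M y =
      gather₃ k G M ((1 : G) ⊗ₜ[k] tail G (tail G (tail M (tail G (appendOne G G)))) y) := by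
  induction y using tensor_induction₅ with
  | tmul a b m c d => rfl
  | add x y hx hy => simp only [map_add, TensorProduct.tmul_add, hx, hy]

theorem padOne_mix₃_rev (y z : G ⊗[k] (G ⊗[k] G)) :
    padOne M (mix₃ k G G (y ⊗ₜ[k] QuasiHopfAlgebra.rev k G z)) =
      gather₃ k G M (head3 (M ⊗[k] (G ⊗[k] (G ⊗[k] G))) (AlgHom.id k (G ⊗[k] (G ⊗[k] G)))
          (y ⊗ₜ[k] ((1 : M) ⊗ₜ[k] z))) := by
  induction y using tensor_induction₃ with
  | tmul a b c =>
    induction z using tensor_induction₃ with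
    | tmul d e f => rfl
    | add x y hx hy => simp only [map_add, TensorProduct.tmul_add, hx, hy]
  | add x y hx hy => simp only [map_add, TensorProduct.add_tmul, hx, hy]

theorem tail_dropHead_gather₂ (y : G ⊗[k] (G ⊗[k] (M ⊗[k] (G ⊗[k] G)))) :
    tail (G ⊗[k] G) (dropHead M H.double.counit) (gather₂ k G M y) =
      gather k G M (tail G (dropHead (M ⊗[k] G) H.counit)
        (tail G (tail G (tail M (dropHead G H.counit))) y)) := by
  induction y using tensor_induction₅ with
  | tmul a b m c d =>
    simp only [gather₂_tmul, tail_tmul, dropHead_tmul, double_counit_tmul, TensorProduct.tmul_smul,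
      map_smul, gather_tmul, mul_smul]
    exact smul_comm _ _ _
  | add x y hx hy => rw [map_add, map_add, hx, hy, map_add, map_add, map_add]

theorem dropHead_gather₂ (y : G ⊗[k] (G ⊗[k] (M ⊗[k] (G ⊗[k] G)))) :
    dropHead ((G ⊗[k] G) ⊗[k] M) H.double.counit (gather₂ k G M y) =
      gather k G M (dropHead (G ⊗[k] (M ⊗[k] G)) H.counit
        (tail G (tail G (tail M (dropTail G H.counit))) y)) := by
  induction y using tensor_induction₅ with
  | tmul a b m c d =>
    simp only [gather₂_tmul, tail_tmul, dropHead_tmul, dropTail_tmul, double_counit_tmul,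
      TensorProduct.tmul_smul, map_smul, gather_tmul, mul_smul]
    exact smul_comm _ _ _
  | add x y hx hy => rw [map_add, map_add, hx, hy, map_add, map_add, map_add]

/-- A two-sided coaction of `G` is a left coaction of `G ⊗ Gᶜᵒᵖ`. -/
def toLeft : LeftCoaction H.double M where
  coact := (gather k G M).comp D.delta
  Phi := Units.map (MonoidHomClass.toMonoidHom (gather₂ k G M)) D.Psi
  quasi_coassoc m := by
    change _ * gather₂ k G M D.Psi.val = gather₂ k G M D.Psi.val * _
    rw [AlgHom.comp_apply, tail_gather_delta, head2_double_gather, ← map_mul, ← map_mul,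
      D.quasi_coassoc]
  -- The reassociator of `Gᶜᵒᵖ` is `φ⁻¹` with reversed legs, so the factor `φ ⊗ 1 ⊗ φ⁻¹` in the
  -- two-sided pentagon is exactly the reassociator of `G ⊗ Gᶜᵒᵖ`.
  pentagon := by
    change (1 ⊗ₜ[k] gather₂ k G M D.Psi.val) * tail _ (head2 M H.double.comul) (gather₂ k G M D.Psi.val) *
      padOne M (mix₃ k G G (H.phi.val ⊗ₜ[k] QuasiHopfAlgebra.rev k G H.phi⁻¹.val)) =
      tail _ (tail _ _) (gather₂ k G M D.Psi.val) * head2 _ _ (gather₂ k G M D.Psi.val)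
    rw [one_tmul_gather₂, tail_head2_double_gather₂, padOne_mix₃_rev, tail_tail_gather_delta,
      head2_double_gather₂, ← map_mul, ← map_mul, ← map_mul, D.pentagon]
  counit_coact m := by
    have h : ∀ y : G ⊗[k] (M ⊗[k] G), dropHead M H.double.counit (gather k G M y) =
        dropTail M H.counit (dropHead (M ⊗[k] G) H.counit y) := by
      intro y
      induction y using tensor_induction₃ with
      | tmul a m b => simp [mul_smul]
      | add x y hx hy => simp only [map_add, hx, hy]
    rw [AlgHom.comp_apply, h, D.counit_delta]
  counit_inner := by
    change tail _ _ (gather₂ k G M D.Psi.val) = 1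
    rw [tail_dropHead_gather₂, D.counit_Psi_inner, map_one]
  counit_outer := by
    change dropHead _ _ (gather₂ k G M D.Psi.val) = 1
    rw [dropHead_gather₂, D.counit_Psi_outer, map_one]

end TwoSidedCoaction

/-! ### The twisted coalgebra structure on `G`. -/

namespace QuasiHopfAlgebra

variable {k : Type u} [Field k] {G : Type v} [Ring G] [Algebra k G] (H : QuasiHopfAlgebra k G)

/-- `a ⊗ b ↦ (x ↦ S⁻¹(b) x a)` -/
def biact : G ⊗[k] G →ₗ[k] Module.End k G :=
  TensorProduct.lift (LinearMap.mk₂ k (fun a b => mulRight k a ∘ₗ mulLeft k (H.Sinv b))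
    (fun _ _ _ => by ext; simp [mul_add]) (fun _ _ _ => by ext; simp)
    (fun _ _ _ => by ext; simp [add_mul]) (fun _ _ _ => by ext; simp))

@[simp] theorem biact_tmul (a b x : G) : H.biact (a ⊗ₜ[k] b) x = H.Sinv b * x * a := rfl

theorem biact_one : H.biact 1 = 1 := by
  ext x
  rw [Algebra.TensorProduct.one_def, biact_tmul, show H.Sinv 1 = 1 from H.toCore.Sinv_one]
  simp

theorem biact_mul (s t : G ⊗[k] G) : H.biact (s * t) = H.biact t * H.biact s := by
  ext x
  induction s using tensor_induction₂ with
  | tmul a b =>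
    induction t using tensor_induction₂ with
    | tmul c d => simp [Sinv_mul, mul_assoc]
    | add x y hx hy => simp only [map_add, mul_add, add_mul, LinearMap.add_apply, hx, hy]
  | add x y hx hy => simp only [map_add, mul_add, add_mul, LinearMap.add_apply, hx, hy]

theorem tensorAct_biact (z w y : G ⊗[k] G) :
    tensorAct H.biact (mix k G G G G (z ⊗ₜ[k] Algebra.TensorProduct.comm k G G w)) y =
      H.flipSinv w * y * z := by
  induction z using tensor_induction₂ with
  | tmul a b =>
    induction w using tensor_induction₂ with
    | tmul c d =>
      induction y using tensor_induction₂ with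
      | tmul e f => simp [flipSinv]
      | add x y hx hy => simp only [map_add, mul_add, add_mul, hx, hy]
    | add x y hx hy => simp only [map_add, TensorProduct.tmul_add, LinearMap.add_apply, add_mul,
        hx, hy]
  | add x y hx hy => simp only [map_add, TensorProduct.add_tmul, LinearMap.add_apply, mul_add,
      hx, hy]

theorem tensorAct₃_biact (z w y : G ⊗[k] (G ⊗[k] G)) :
    tensorAct₃ H.biact (mix₃ k G G (z ⊗ₜ[k] rev k G w)) y =
      H.toCore.flipSinv₃ w * y * z := by
  induction z using tensor_induction₃ with
  | tmul a b c =>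
    induction w using tensor_induction₃ with
    | tmul c d e =>
      induction y using tensor_induction₃ with
      | tmul e f g => simp; rfl
      | add x y hx hy => simp only [map_add, mul_add, add_mul, hx, hy]
    | add x y hx hy => simp only [map_add, TensorProduct.tmul_add, LinearMap.add_apply, add_mul,
        hx, hy]
  | add x y hx hy => simp only [map_add, TensorProduct.add_tmul, LinearMap.add_apply, mul_add,
      hx, hy]

theorem flipSinv_comul_mul_twistH (b : G) :
    H.flipSinv (H.comul b) * H.twistH = H.twistH * H.comul (H.Sinv b) := by
  have h := H.isTwist_twistF.flipSinv_mul_comul b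
  rw [H.toCore.flipSinv_mul] at h
  exact h.symm

/-- `G` with the twisted coproduct `x ↦ h Δ(x)` is a coalgebra of right `G ⊗ Gᶜᵒᵖ`-modules. -/
def twistedCoalgebra (hα : H.counit H.alpha = 1) : H.double.ModuleCoalgebra G where
  act := H.biact
  act_one := H.biact_one
  act_mul := H.biact_mul
  comul := mulLeft k H.twistH ∘ₗ H.comul.toLinearMap
  counit := H.counit.toLinearMap
  counit_act a x := by
    induction a using tensor_induction₂ with
    | tmul a b => simp [H.counit_Sinv hα]; ring
    | add x y hx hy => simp only [map_add, LinearMap.add_apply, add_mul, hx, hy]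
  comul_act a x := by
    change _ = tensorAct H.biact (H.double.comul a) (H.twistH * H.comul x)
    change H.twistH * H.comul (H.biact a x) = _
    induction a using tensor_induction₂ with
    | tmul a b =>
      rw [TwoSidedCoaction.double_comul_tmul, tensorAct_biact, biact_tmul, map_mul, map_mul,
        ← mul_assoc, ← mul_assoc, ← flipSinv_comul_mul_twistH, ← mul_assoc]
    | add x y hx hy => simp only [map_add, LinearMap.add_apply, mul_add, hx, hy]
  coassoc x := by
    change _ = tensorAct₃ H.biact (mix₃ k G G (H.phi⁻¹.val ⊗ₜ[k] rev k G H.phi.val)) _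
    have h1 : ∀ y, (mulLeft k H.twistH ∘ₗ H.comul.toLinearMap).lTensor G y =
        ((1 : G) ⊗ₜ[k] H.twistH) * tail G H.comul y := by
      intro y
      induction y using tensor_induction₂ with
      | tmul a b => simp
      | add x y hx hy => simp only [map_add, mul_add, hx, hy]
    have h2 : ∀ y, TensorProduct.assoc k G G G
        ((mulLeft k H.twistH ∘ₗ H.comul.toLinearMap).rTensor G y) =
        tail G (appendOne G G) H.twistH * head2 G H.comul y := by
      intro y
      induction y using tensor_induction₂ with
      | tmul a b =>
        rw [← QuasiHopfCore.asc_tmul_one, head2_tmul', asc_mul, one_mul]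
        rfl
      | add x y hx hy => simp only [map_add, mul_add, hx, hy]
    have h3 : head2 G H.comul (H.comul x) * H.phi⁻¹.val =
        H.phi⁻¹.val * tail G H.comul (H.comul x) := (H.Phi_inv_conj x).symm
    change ((mulLeft k H.twistH ∘ₗ H.comul.toLinearMap).lTensor G (H.twistH * H.comul x)) =
      tensorAct₃ H.biact _ (TensorProduct.assoc k G G G
        ((mulLeft k H.twistH ∘ₗ H.comul.toLinearMap).rTensor G (H.twistH * H.comul x)))
    rw [tensorAct₃_biact, h1, h2, map_mul, map_mul]
    -- Inserting `φ φ⁻¹` exposes the cocycle identity of `h`; the remaining `φ⁻¹` is moved to the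
    -- right by quasi-coassociativity.
    calc _ = (((1 : G) ⊗ₜ[k] H.twistH) * tail G H.comul H.twistH * H.phi.val) *
          (H.phi⁻¹.val * tail G H.comul (H.comul x)) := by
            rw [mul_assoc _ H.phi.val, ← mul_assoc H.phi.val, Units.mul_inv, one_mul, mul_assoc]
      _ = _ := by
        rw [← H.twistH_cocycle, ← h3]
        simp only [mul_assoc]
  counit_left x := by
    change dropHead G H.counit (H.twistH * H.comul x) = x
    rw [map_mul, H.dropHead_twistH hα, H.counit_left, one_mul]
  counit_right x := by
    change dropTail G H.counit (H.twistH * H.comul x) = x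
    rw [map_mul, H.dropTail_twistH hα, H.counit_right, one_mul]

/-- Drinfel'd's twist for `G ⊗ Gᶜᵒᵖ`. -/
def doubleTwist : (G ⊗[k] G) ⊗[k] (G ⊗[k] G) :=
  mix k G G G G (H.twistF ⊗ₜ[k] Algebra.TensorProduct.comm k G G H.twistH)

theorem isTwist_doubleTwist : H.double.IsTwist H.doubleTwist :=
  H.isTwist_twistF.prod H.isTwist_copCore

/-- `x ↦ Δ(x) h⁻¹` -/
def comulTwistInv : G →ₗ[k] G ⊗[k] G := mulRight k H.twistHInv ∘ₗ H.comul.toLinearMap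

theorem comulTwistInv_apply (x : G) : H.comulTwistInv x = H.comul x * H.twistHInv := rfl

/-- After the flip the half `F` of the double twist multiplies by `h` on the right and cancels
`h⁻¹`, while the half `h²¹` multiplies by `h` on the left. -/
theorem tensorAct_flipSinv_doubleTwist [FiniteDimensional k G] (x : G) :
    tensorAct H.biact (H.double.flipSinv H.doubleTwist) (H.comulTwistInv x) =
      H.twistH * H.comul x := by
  have h : ∀ y, H.copCore.flipSinv (Algebra.TensorProduct.comm k G G (H.flipSinv y)) =
      Algebra.TensorProduct.comm k G G y := by
    intro y
    induction y using tensor_induction₂ with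
    | tmul a b => exact congrArg₂ (· ⊗ₜ[k] ·) (H.S_Sinv b) (H.S_Sinv a)
    | add x y hx hy => simp only [map_add, hx, hy]
  rw [doubleTwist, QuasiHopfCore.prod_flipSinv_mix, twistH, h, tensorAct_biact, comulTwistInv_apply,
    mul_assoc, mul_assoc]
  change H.twistH * (H.comul x * (H.twistHInv * H.twistH)) = _
  rw [H.inv_mul_twistH, mul_one]
  rfl

end QuasiHopfAlgebra

/-! ### Products with the counit. -/

namespace LeftCoaction

variable {k : Type u} [Field k] {Q : Type v} [Ring Q] [Algebra k Q] {H : QuasiHopfCore k Q}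
variable {M : Type w} [Ring M] [Algebra k M] {L : LeftCoaction H M}
variable {C : Type*} [AddCommGroup C] [Module k C] {K : H.ModuleCoalgebra C}

theorem IsLeftSmash.counit_mul_spreadLeft
    {mul : (Module.Dual k C ⊗[k] M) →ₗ[k] (Module.Dual k C ⊗[k] M) →ₗ[k] (Module.Dual k C ⊗[k] M)}
    (h : L.IsLeftSmash K mul) (m : M) (φ : Module.Dual k C) (s : Q ⊗[k] M) (x : C) :
    dualTensorHom k C M (mul (K.counit ⊗ₜ[k] m) (spreadLeft K.act φ s)) x =
      pair₁ K.act φ x (L.coact m * s) := by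
  induction s using tensor_induction₂ with
  | tmul a n =>
    rw [spreadLeft_tmul, h, pair₂_counit_left, K.counit_left, map_mul, counit_outer_inv, _root_.one_mul,
      dropHead_tmul, map_one, one_smul, pair₁_comp _ K.act_mul, mul_assoc,
      Algebra.TensorProduct.tmul_mul_tmul, _root_.one_mul, mul_one]
  | add x y hx hy => simp only [map_add, mul_add, LinearMap.add_apply, hx, hy]

theorem IsRightSmash.spreadRight_mul_counit {comulR : C →ₗ[k] C ⊗[k] C}
    {mul : (M ⊗[k] Module.Dual k C) →ₗ[k] (M ⊗[k] Module.Dual k C) →ₗ[k] (M ⊗[k] Module.Dual k C)}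
    (h : L.IsRightSmash K comulR mul) (hS : ∀ a, H.counit (H.Sinv a) = H.counit a)
    (hc : ∀ x, TensorProduct.rid k C (K.counit.lTensor C (comulR x)) = x)
    (φ : Module.Dual k C) (s : Q ⊗[k] M) (m : M) (x : C) :
    dualTensorHom k C M (TensorProduct.comm k M (Module.Dual k C)
      (mul (spreadRight K.act φ (H.Sinv.rTensor M s)) (m ⊗ₜ[k] K.counit))) x =
      pair₁ K.act φ x (H.Sinv.rTensor M (s * L.coact m)) := by
  have hf : ∀ t, tail Q (dropHead M H.counit) (H.flipLegs M t) =
      H.Sinv.rTensor M (dropHead (Q ⊗[k] M) H.counit t) := by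
    intro t
    induction t using tensor_induction₃ with
    | tmul a b m => simp [hS, TensorProduct.smul_tmul']
    | add x y hx hy => simp only [map_add, hx, hy]
  induction s using tensor_induction₂ with
  | tmul a n =>
    rw [LinearMap.rTensor_tmul, spreadRight_tmul, h, pair₂_counit_right, hc, hf, map_mul,
      L.counit_outer, mul_one, dropHead_tmul, map_one, one_smul, pair₁_comp _ K.act_mul,
      mul_pair₁, QuasiHopfCore.Sinv_rTensor_mul_tmul, QuasiHopfCore.tmul_mul_Sinv_rTensor,
      H.S_Sinv, ← mul_assoc, Algebra.TensorProduct.tmul_mul_tmul, one_mul, mul_one]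
  | add x y hx hy => simp only [map_add, add_mul, LinearMap.add_apply, hx, hy]

end LeftCoaction

/-! ### The concrete products and maps as smash product data. -/

section DualEval

variable {k : Type u} [Field k] {G : Type v} [Ring G] [Algebra k G]

/-- evaluation of threefold tensors of functionals -/
def tripleEval : Module.Dual k G ⊗[k] (Module.Dual k G ⊗[k] Module.Dual k G) →ₗ[k]
    Module.Dual k (G ⊗[k] (G ⊗[k] G)) :=
  TensorProduct.dualDistrib k G (G ⊗[k] G) ∘ₗ (TensorProduct.dualDistrib k G G).lTensor _

@[simp] theorem tripleEval_tmul (φ ψ χ : Module.Dual k G) (a b c : G) :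
    tripleEval (φ ⊗ₜ[k] (ψ ⊗ₜ[k] χ)) (a ⊗ₜ[k] (b ⊗ₜ[k] c)) = φ a * (ψ b * χ c) := by
  simp [tripleEval]

theorem dualDistrib_dualComul [FiniteDimensional k G] (φ : Module.Dual k G) :
    TensorProduct.dualDistrib k G G (dualComul φ) = φ ∘ₗ mul' k G := by
  have : ∀ z, TensorProduct.dualDistrib k G G z = TensorProduct.dualDistribEquiv k G G z :=
    fun _ => rfl
  rw [this, dualComul, LinearMap.comp_apply, LinearEquiv.coe_toLinearMap,
    LinearEquiv.apply_symm_apply]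
  rfl

theorem tripleEval_dualComul₂ [FiniteDimensional k G] (φ : Module.Dual k G) (a b c : G) :
    tripleEval (dualComul₂ φ) (a ⊗ₜ[k] (b ⊗ₜ[k] c)) = φ (a * (b * c)) := by
  have h : ∀ z : Module.Dual k G ⊗[k] Module.Dual k G,
      tripleEval (dualComul.lTensor (Module.Dual k G) z) (a ⊗ₜ[k] (b ⊗ₜ[k] c)) =
        TensorProduct.dualDistrib k G G z (a ⊗ₜ[k] (b * c)) := by
    intro z
    induction z using tensor_induction₂ with
    | tmul ψ χ =>
      rw [LinearMap.lTensor_tmul, tripleEval, LinearMap.comp_apply, LinearMap.lTensor_tmul,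
        dualDistrib_dualComul]
      simp
    | add x y hx hy => simp only [map_add, LinearMap.add_apply, hx, hy]
  rw [dualComul₂, LinearMap.comp_apply, h, dualDistrib_dualComul]
  simp

@[simp] theorem hit_tmul (a b : G) (φ : Module.Dual k G) (x : G) :
    hit (a ⊗ₜ[k] b) φ x = φ (b * (x * a)) := by
  simp [hit, leftHit, rightHit, Module.Dual.transpose_apply]

end DualEval

namespace TwoSidedCoaction

variable {k : Type u} [Field k] {G : Type v} [Ring G] [Algebra k G] {H : QuasiHopfAlgebra k G}
variable {M : Type w} [Ring M] [Algebra k M] (D : TwoSidedCoaction H.toQuasiBialgebra M)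

@[simp] theorem outerEval_tmul (ψ φ : Module.Dual k G) (a b : G) (m : M) :
    outerEval ψ φ (a ⊗ₜ[k] (m ⊗ₜ[k] b)) = (ψ a * φ b) • m := by
  simp only [outerEval, LinearMap.mk₂_apply, LinearMap.comp_apply, TensorProduct.map_tmul,
    LinearMap.lTensor_tmul, LinearEquiv.coe_toLinearMap, TensorProduct.rid_tmul,
    TensorProduct.lid_tmul, smul_smul]

@[simp] theorem act_tmul (m : M) (φ ψ : Module.Dual k G) :
    D.act (m ⊗ₜ[k] (φ ⊗ₜ[k] ψ)) = outerEval ψ φ (D.delta m) := by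
  simp [act]

/-- The three parts of `ψ` reassemble to `ψ(S⁻¹(b) y a)`, where `a` and `b` are the outer legs of
`δ(m)`; this is `ψ` on the point `y` acted on by `a ⊗ b`. -/
theorem leftCross_eq [FiniteDimensional k G] (m : M) (ψ : Module.Dual k G) :
    D.leftCross (m ⊗ₜ[k] ψ) = spreadLeft H.biact ψ (gather k G M (D.delta m)) := by
  apply dualTensor_ext
  intro y
  rw [dualTensorHom_spreadLeft]
  have h : ∀ t, dualTensorHom k G M
      ((D.act ∘ₗ ((dualSinv H).rTensor (Module.Dual k G)).lTensor M).lTensor (Module.Dual k G)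
        (TensorProduct.leftComm k M (Module.Dual k G) _ (m ⊗ₜ[k]
          (TensorProduct.leftComm k (Module.Dual k G) (Module.Dual k G) (Module.Dual k G) t)))) y =
      TensorProduct.lid k M (LinearMap.rTensor M (tripleEval t ∘ₗ TensorProduct.map H.Sinv
        (TensorProduct.mk k G G y) ∘ₗ (TensorProduct.comm k G G).toLinearMap)
          (gather k G M (D.delta m))) := by
    intro t
    induction t using tensor_induction₃ with
    | tmul φ ψ χ =>
      simp only [TensorProduct.leftComm_tmul, LinearMap.lTensor_tmul, LinearMap.comp_apply,
        LinearMap.rTensor_tmul, act_tmul, dualTensorHom_apply]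
      generalize D.delta m = z
      induction z using tensor_induction₃ with
      | tmul a n b => simp [dualSinv, smul_smul]; ring_nf
      | add x y hx hy => simp only [map_add, smul_add, hx, hy]
    | add x y hx hy =>
      simp only [map_add, TensorProduct.tmul_add, LinearMap.add_apply, hx, hy, LinearMap.add_comp,
        LinearMap.rTensor_add]
  refine (h (dualComul₂ ψ)).trans ?_
  generalize gather k G M (D.delta m) = z
  induction z using tensor_induction₂ with
  | tmul s n =>
    induction s using tensor_induction₂ with
    | tmul a b => simp [tripleEval_dualComul₂, mul_assoc]
    | add x y hx hy => simp only [map_add, TensorProduct.add_tmul, hx, hy]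
  | add x y hx hy => simp only [map_add, hx, hy]

theorem rightCross_eq [FiniteDimensional k G] (φ : Module.Dual k G) (n : M) :
    D.rightCross (φ ⊗ₜ[k] n) =
      LeftCoaction.spreadRight H.biact φ (H.double.Sinv.rTensor M (gather k G M (D.delta n))) := by
  apply tensorDual_ext
  intro y
  rw [LeftCoaction.dualTensorHom_spreadRight]
  have h : ∀ t, dualTensorHom k G M
      ((D.act ∘ₗ ((dualSinv H).lTensor (Module.Dual k G)).lTensor M).lTensor (Module.Dual k G)
        (TensorProduct.leftComm k M (Module.Dual k G) _ (n ⊗ₜ[k]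
          (TensorProduct.leftComm k (Module.Dual k G) (Module.Dual k G) (Module.Dual k G) t)))) y =
      TensorProduct.lid k M (LinearMap.rTensor M (tripleEval t ∘ₗ TensorProduct.map LinearMap.id
        (TensorProduct.mk k G G y ∘ₗ H.Sinv) ∘ₗ (TensorProduct.comm k G G).toLinearMap)
          (gather k G M (D.delta n))) := by
    intro t
    induction t using tensor_induction₃ with
    | tmul φ ψ χ =>
      simp only [TensorProduct.leftComm_tmul, LinearMap.lTensor_tmul, LinearMap.comp_apply,
        act_tmul, dualTensorHom_apply]
      generalize D.delta n = z
      induction z using tensor_induction₃ with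
      | tmul a n b => simp [dualSinv, smul_smul]; ring_nf
      | add x y hx hy => simp only [map_add, smul_add, hx, hy]
    | add x y hx hy =>
      simp only [map_add, TensorProduct.tmul_add, LinearMap.add_apply, hx, hy, LinearMap.add_comp,
        LinearMap.rTensor_add]
  have h' := h (dualComul₂ φ)
  have e : TensorProduct.comm k M (Module.Dual k G) (D.rightCross (φ ⊗ₜ[k] n)) =
      ((D.act ∘ₗ ((dualSinv H).lTensor (Module.Dual k G)).lTensor M).lTensor (Module.Dual k G)
        (TensorProduct.leftComm k M (Module.Dual k G) _ (n ⊗ₜ[k]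
          (TensorProduct.leftComm k (Module.Dual k G) (Module.Dual k G) (Module.Dual k G)
            (dualComul₂ φ))))) := by
    simp [rightCross]
  rw [e, h']
  generalize gather k G M (D.delta n) = z
  induction z using tensor_induction₂ with
  | tmul s n =>
    induction s using tensor_induction₂ with
    | tmul a b =>
      have hs : H.Sinv (H.copCore.Sinv b) = b := H.Sinv_S b
      have hs' : H.toCore.Sinv a = H.Sinv a := rfl
      simp [tripleEval_dualComul₂, mul_assoc, hs, hs']
    | add x y hx hy => simp only [map_add, TensorProduct.add_tmul, hx, hy]
  | add x y hx hy => simp only [map_add, hx, hy]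

theorem gather_qElt : gather k G M D.qElt = D.toLeft.q := by
  rw [qElt, LeftCoaction.q]
  change _ = H.double.contract M (gather₂ k G M D.Psi⁻¹.val)
  generalize D.Psi⁻¹.val = z
  have ha : H.double.alpha = H.alpha ⊗ₜ[k] H.Sinv H.alpha := rfl
  have hS : ∀ a, H.toCore.S a = H.S a := fun _ => rfl
  have hS' : ∀ a, H.copCore.S a = H.Sinv a := fun _ => rfl
  induction z using tensor_induction₅ with
  | tmul a b m c d => simp [ha, hS, hS', H.Sinv_mul]
  | add x y hx hy => simp only [map_add, hx, hy]

theorem gather_pElt : gather k G M ((H.Sinv.lTensor M).lTensor G D.pElt) =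
    (TensorProduct.map LinearMap.id H.Sinv).rTensor M D.toLeft.p := by
  rw [pElt, LeftCoaction.p]
  change _ = (TensorProduct.map LinearMap.id H.Sinv).rTensor M (H.double.Sinv.rTensor M
    (H.double.cocontract M (gather₂ k G M D.Psi.val)))
  generalize D.Psi.val = z
  have ha : H.double.beta = H.beta ⊗ₜ[k] H.Sinv H.beta := rfl
  have hS : ∀ a, H.toCore.S a = H.S a := fun _ => rfl
  have hS' : ∀ a, H.copCore.S a = H.Sinv a := fun _ => rfl
  have hT : ∀ a, H.toCore.Sinv a = H.Sinv a := fun _ => rfl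
  have hT' : ∀ a, H.copCore.Sinv a = H.S a := fun _ => rfl
  have hm : ∀ a b, H.S (a * b) = H.S b * H.S a := H.antipode_mul
  induction z using tensor_induction₅ with
  | tmul a b m c d => simp [ha, hS, hS', hT, hT', H.Sinv_mul, hm, mul_assoc]
  | add x y hx hy => simp only [map_add, hx, hy]

theorem spread_eq (φ : Module.Dual k G) (z : G ⊗[k] (M ⊗[k] G)) :
    spread z φ = LeftCoaction.spreadRight H.biact φ
      ((TensorProduct.map LinearMap.id H.S).rTensor M (gather k G M z)) := by
  induction z using tensor_induction₃ with
  | tmul a m b =>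
    rw [gather_tmul, LinearMap.rTensor_tmul, TensorProduct.map_tmul,
      LeftCoaction.spreadRight_tmul]
    have : hit (a ⊗ₜ[k] b) φ = φ ∘ₗ H.biact (a ⊗ₜ[k] H.S b) := by
      ext x; simp [mul_assoc]
    simp [spread, this]
  | add x y hx hy => simp only [map_add, LinearMap.add_apply, hx, hy]

/-- `((φ ⊗ ψ) ⊗ m) ↦ (φ ⊗ ψ)(y) m` -/
theorem dualTensorHom_dualMul (z : (Module.Dual k G ⊗[k] Module.Dual k G) ⊗[k] M) (x : G) :
    dualTensorHom k G M ((dualMul H.toQuasiBialgebra).rTensor M z) x =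
      TensorProduct.lid k M (LinearMap.rTensor M ((TensorProduct.dualDistrib k G G).flip
        (H.comul x)) z) := by
  induction z using tensor_induction₂ with
  | tmul s m => simp [dualMul]
  | add x y hx hy => simp only [map_add, LinearMap.add_apply, hx, hy]

/-- The legs of `Ψ⁻¹` in `Ω_L` act as `Φ⁻¹` does through `biact`. The factor `h⁵⁴` is left
multiplication by `h` on points, which is why the coproduct in the coalgebra is `h Δ`. Likewise
`h⁻¹` in `Ω_R` multiplies on the right. -/
theorem leftOp_OmegaL_eval (φ ψ : Module.Dual k G) (m : M) (y : G ⊗[k] G) :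
    TensorProduct.lid k M (LinearMap.rTensor M ((TensorProduct.dualDistrib k G G).flip y)
      (leftOp D.OmegaL ((φ ⊗ₜ[k] ψ) ⊗ₜ[k] m))) =
      pair₂ H.biact φ ψ (H.twistH * y) (D.toLeft.Phi⁻¹.val) * m := by
  rw [OmegaL]
  change _ = pair₂ H.biact φ ψ (H.twistH * y) (gather₂ k G M D.Psi⁻¹.val) * m
  generalize D.Psi⁻¹.val = z
  generalize H.twistH = h
  induction z using tensor_induction₅ with
  | tmul a b n c d =>
    induction h using tensor_induction₂ with
    | tmul e f =>
      induction y using tensor_induction₂ with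
      | tmul r s => simp [leftOp, nest_tmul, mul_assoc]
      | add x y hx hy =>
        simp only [map_add, LinearMap.add_apply, mul_add, add_mul, LinearMap.rTensor_add, hx, hy]
    | add x y hx hy =>
      simp only [map_add, LinearMap.add_apply, mul_add, add_mul, TensorProduct.tmul_add, hx, hy]
  | add x y hx hy => simp only [map_add, LinearMap.add_apply, add_mul, hx, hy]

theorem rightOp_OmegaR_eval (φ ψ : Module.Dual k G) (m : M) (y : G ⊗[k] G) :
    TensorProduct.lid k M (LinearMap.rTensor M ((TensorProduct.dualDistrib k G G).flip y)
      (TensorProduct.comm k M _ (rightOp D.OmegaR (m ⊗ₜ[k] (φ ⊗ₜ[k] ψ))))) =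
      m * pair₂ H.biact φ ψ (y * H.twistHInv) (H.double.flipLegs M D.toLeft.Phi.val) := by
  rw [OmegaR]
  change _ = m * pair₂ H.biact φ ψ (y * H.twistHInv)
    (H.double.flipLegs M (gather₂ k G M D.Psi.val))
  generalize D.Psi.val = z
  generalize H.twistHInv = h
  have hs : ∀ b, H.Sinv (H.copCore.Sinv b) = b := H.Sinv_S
  have hs' : ∀ a, H.toCore.Sinv a = H.Sinv a := fun _ => rfl
  induction z using tensor_induction₅ with
  | tmul a b n c d =>
    induction h using tensor_induction₂ with
    | tmul e f =>
      induction y using tensor_induction₂ with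
      | tmul r s => simp [rightOp, nest_tmul, mul_assoc, hs, hs']
      | add x y hx hy =>
        simp only [map_add, LinearMap.add_apply, mul_add, add_mul, LinearMap.rTensor_add, hx, hy]
    | add x y hx hy =>
      simp only [map_add, LinearMap.add_apply, mul_add, add_mul, TensorProduct.add_tmul, hx, hy]
  | add x y hx hy => simp only [map_add, LinearMap.add_apply, mul_add, hx, hy]

theorem isLeftSmash_leftMul [FiniteDimensional k G] (hα : H.counit H.alpha = 1) :
    D.toLeft.IsLeftSmash (H.twistedCoalgebra hα) D.leftMul := by
  intro φ m ψ n x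
  have h1 : ∀ s : (G ⊗[k] G) ⊗[k] M, (mul' k M).lTensor (Module.Dual k G)
      (TensorProduct.assoc k (Module.Dual k G) M M (spreadLeft H.biact ψ s ⊗ₜ[k] n)) =
      spreadLeft H.biact ψ (s * (1 ⊗ₜ[k] n)) := by
    intro s
    induction s using tensor_induction₂ with
    | tmul s l => simp
    | add x y hx hy => simp only [map_add, TensorProduct.add_tmul, add_mul, hx, hy]
  have h2 : D.leftMul (φ ⊗ₜ[k] m) (ψ ⊗ₜ[k] n) = (dualMul H.toQuasiBialgebra).rTensor M
      (leftOp D.OmegaL ((TensorProduct.assoc k (Module.Dual k G) (Module.Dual k G) M).symm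
        (φ ⊗ₜ[k] spreadLeft H.biact ψ (gather k G M (D.delta m) * (1 ⊗ₜ[k] n))))) := by
    rw [← h1, ← leftCross_eq]
    rfl
  rw [h2, dualTensorHom_dualMul]
  change _ = pair₂ H.biact φ ψ (H.twistH * H.comul x)
    (D.toLeft.Phi⁻¹.val * (1 ⊗ₜ[k] (gather k G M (D.delta m) * (1 ⊗ₜ[k] n))))
  generalize gather k G M (D.delta m) * (1 ⊗ₜ[k] n) = s
  induction s using tensor_induction₂ with
  | tmul s l =>
    have hc := pair₂_comp (M := M) H.biact (fun a b => H.biact_mul a b) φ ψ 1 s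
    rw [H.biact_one, Module.End.one_eq_id, LinearMap.comp_id] at hc
    rw [spreadLeft_tmul, TensorProduct.assoc_symm_tmul, leftOp_OmegaL_eval, pair₂_mul, hc,
      mul_assoc, Algebra.TensorProduct.tmul_mul_tmul, Algebra.TensorProduct.tmul_mul_tmul, one_mul,
      one_mul, mul_one]
  | add x y hx hy => simp only [map_add, mul_add, TensorProduct.tmul_add, hx, hy]

theorem isRightSmash_rightMul [FiniteDimensional k G] (hα : H.counit H.alpha = 1) :
    D.toLeft.IsRightSmash (H.twistedCoalgebra hα) H.comulTwistInv D.rightMul := by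
  intro m φ n ψ x
  have h2 : D.rightMul (m ⊗ₜ[k] φ) (n ⊗ₜ[k] ψ) = (dualMul H.toQuasiBialgebra).lTensor M
      (rightOp D.OmegaR ((mul' k M).rTensor (Module.Dual k G ⊗[k] Module.Dual k G)
        ((TensorProduct.assoc k M M (Module.Dual k G ⊗[k] Module.Dual k G)).symm
          (m ⊗ₜ[k] TensorProduct.assoc k M (Module.Dual k G) (Module.Dual k G)
            (D.rightCross (φ ⊗ₜ[k] n) ⊗ₜ[k] ψ))))) := rfl
  have h3 : ∀ z : M ⊗[k] (Module.Dual k G ⊗[k] Module.Dual k G),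
      TensorProduct.comm k M (Module.Dual k G) ((dualMul H.toQuasiBialgebra).lTensor M z) =
      (dualMul H.toQuasiBialgebra).rTensor M (TensorProduct.comm k M _ z) := by
    intro z
    induction z using tensor_induction₂ with
    | tmul s l => simp
    | add x y hx hy => simp only [map_add, hx, hy]
  rw [h2, h3, dualTensorHom_dualMul, rightCross_eq]
  change _ = m * pair₂ H.biact φ ψ (H.comul x * H.twistHInv)
    (H.double.flipLegs M ((1 ⊗ₜ[k] gather k G M (D.delta n)) * D.toLeft.Phi.val))
  generalize gather k G M (D.delta n) = s
  induction s using tensor_induction₂ with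
  | tmul s l =>
    have hc := pair₂_comp (M := M) H.biact (fun a b => H.biact_mul a b) φ ψ (H.double.Sinv s) 1
    rw [H.biact_one, Module.End.one_eq_id, LinearMap.comp_id] at hc
    rw [LinearMap.rTensor_tmul, LeftCoaction.spreadRight_tmul, TensorProduct.assoc_tmul,
      TensorProduct.assoc_symm_tmul, LinearMap.rTensor_tmul, LinearMap.mul'_apply,
      rightOp_OmegaR_eval, hc, mul_assoc, mul_pair₂, H.double.flipLegs_tmul_mul,
      H.double.Sinv_one, mul_assoc]
  | add x y hx hy =>
    simp only [map_add, mul_add, add_mul, TensorProduct.tmul_add, TensorProduct.add_tmul, hx, hy]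

theorem dropTail_twistHInv [FiniteDimensional k G] (hα : H.counit H.alpha = 1) :
    dropTail G H.counit H.twistHInv = 1 := by
  have h := congrArg (dropTail G H.counit) H.twistH_mul_inv
  rwa [map_mul, H.dropTail_twistH hα, one_mul, map_one] at h

theorem double_counit_Sinv (hα : H.counit H.alpha = 1) (a : G ⊗[k] G) :
    H.double.counit (H.double.Sinv a) = H.double.counit a := by
  induction a using tensor_induction₂ with
  | tmul a b =>
    have h1 : H.counit (H.toCore.Sinv a) = H.counit a := H.counit_Sinv hα a
    have h2 : H.counit (H.copCore.Sinv b) = H.counit b := H.counit_S hα b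
    simp [h1, h2]
  | add x y hx hy => simp only [map_add, hx, hy]

theorem double_counit_S (hα : H.counit H.alpha = 1) (a : G ⊗[k] G) :
    H.double.counit (H.double.S a) = H.double.counit a := by
  rw [← double_counit_Sinv hα, H.double.Sinv_S]

theorem double_counit_alpha (hα : H.counit H.alpha = 1) :
    H.double.counit H.double.alpha = 1 := by
  change H.double.counit (H.alpha ⊗ₜ[k] H.Sinv H.alpha) = 1
  rw [double_counit_tmul, H.counit_Sinv hα, hα, one_mul]

theorem isSmashEquiv_leftToRight [FiniteDimensional k G] (hα : H.counit H.alpha = 1) :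
    D.toLeft.IsSmashEquiv (H.twistedCoalgebra hα) D.leftToRight := by
  intro φ m x
  have h := (D.isRightSmash_rightMul hα).spreadRight_mul_counit (double_counit_Sinv hα)
    (fun x => by
      change dropTail G H.counit (H.comul x * H.twistHInv) = x
      rw [map_mul, dropTail_twistHInv hα, mul_one, H.counit_right]) φ D.toLeft.q m x
  rw [← h]
  have e : LeftCoaction.spreadRight H.biact φ (H.double.Sinv.rTensor M D.toLeft.q) =
      spread (H.Sinv.rTensor (M ⊗[k] G) D.qElt) φ := by
    rw [spread_eq (H := H), ← gather_qElt]
    congr 1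
    generalize D.qElt = z
    induction z using tensor_induction₃ with
    | tmul a m b => rfl
    | add x y hx hy => simp only [map_add, hx, hy]
  change _ = dualTensorHom k G M (TensorProduct.comm k M (Module.Dual k G)
      (D.rightMul (LeftCoaction.spreadRight H.biact φ (H.double.Sinv.rTensor M D.toLeft.q))
        (m ⊗ₜ[k] dualOne H.toQuasiBialgebra))) x
  rw [e]
  rfl

theorem isSmashEquivSymm_rightToLeft [FiniteDimensional k G] (hα : H.counit H.alpha = 1) :
    D.toLeft.IsSmashEquivSymm (H.twistedCoalgebra hα) D.rightToLeft := by
  intro m φ x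
  have h := (D.isLeftSmash_leftMul hα).counit_mul_spreadLeft m φ D.toLeft.p x
  rw [← h]
  have e : spreadLeft H.biact φ D.toLeft.p = TensorProduct.comm k M (Module.Dual k G)
      (spread ((H.Sinv.lTensor M).lTensor G D.pElt) φ) := by
    rw [spread_eq (H := H), gather_pElt]
    generalize D.toLeft.p = z
    induction z using tensor_induction₂ with
    | tmul s m =>
      induction s using tensor_induction₂ with
      | tmul a b => simp
      | add x y hx hy => simp only [map_add, TensorProduct.add_tmul, hx, hy]
    | add x y hx hy => simp only [map_add, hx, hy]
  change _ = dualTensorHom k G M (D.leftMul (dualOne H.toQuasiBialgebra ⊗ₜ[k] m)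
      (spreadLeft H.biact φ D.toLeft.p)) x
  rw [e]
  rfl

end TwoSidedCoaction

end QuasiHopf

end

/-! ### Assembly of the theorem. -/

/-- Diagonal crossed products by a two-sided coaction of a finite dimensional quasi-Hopf algebra
(with the normalization `ε(α) = 1`). -/
theorem theorem10p2 {G M : Type*} [Ring G] [Algebra ℂ G] [FiniteDimensional ℂ G]
    [Ring M] [Algebra ℂ M] (H : QuasiHopf.QuasiHopfAlgebra ℂ G)
    (hα : H.counit H.alpha = 1)
    (D : QuasiHopf.TwoSidedCoaction H.toQuasiBialgebra M) :
    -- (i) both products are associative, with units `1_Ĝ ⋈ 1_M` and `1_M ⋈ 1_Ĝ`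
    (QuasiHopf.IsUnitalAssocAlgebra D.leftMul
        (QuasiHopf.dualOne H.toQuasiBialgebra ⊗ₜ[ℂ] (1 : M)) ∧
      QuasiHopf.IsUnitalAssocAlgebra D.rightMul
        ((1 : M) ⊗ₜ[ℂ] QuasiHopf.dualOne H.toQuasiBialgebra)) ∧
    -- (ii) `M` is a unital subalgebra of both
    ((QuasiHopf.IsUnitalAlgebraMap (LinearMap.mul ℂ M) 1 D.leftMul
          (QuasiHopf.dualOne H.toQuasiBialgebra ⊗ₜ[ℂ] (1 : M)) D.leftIncl ∧
        Function.Injective D.leftIncl) ∧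
      (QuasiHopf.IsUnitalAlgebraMap (LinearMap.mul ℂ M) 1 D.rightMul
          ((1 : M) ⊗ₜ[ℂ] QuasiHopf.dualOne H.toQuasiBialgebra) D.rightIncl ∧
        Function.Injective D.rightIncl)) ∧
    -- (iii) the extensions of `M` are equivalent, through the two mutually inverse explicit maps
    (QuasiHopf.IsUnitalAlgebraMap D.leftMul
        (QuasiHopf.dualOne H.toQuasiBialgebra ⊗ₜ[ℂ] (1 : M)) D.rightMul
        ((1 : M) ⊗ₜ[ℂ] QuasiHopf.dualOne H.toQuasiBialgebra) D.leftToRight ∧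
      (∀ m : M, D.leftToRight (D.leftIncl m) = D.rightIncl m) ∧
      D.rightToLeft ∘ₗ D.leftToRight = LinearMap.id ∧
      D.leftToRight ∘ₗ D.rightToLeft = LinearMap.id) := by
  have hL := D.isLeftSmash_leftMul hα
  have hR := D.isRightSmash_rightMul hα
  have hf := D.isSmashEquiv_leftToRight hα
  have hg := D.isSmashEquivSymm_rightToLeft hα
  have hgf : D.rightToLeft ∘ₗ D.leftToRight = LinearMap.id := hg.comp_eq_id hf
  have hfg : D.leftToRight ∘ₗ D.rightToLeft = LinearMap.id := hf.comp_eq_id hg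
  have hincl : ∀ m, D.leftToRight (D.leftIncl m) = D.rightIncl m := fun m =>
    hf.apply_counit_tmul (QuasiHopf.TwoSidedCoaction.double_counit_S hα)
      (QuasiHopf.TwoSidedCoaction.double_counit_alpha hα) m
  have hmap : ∀ x y, D.leftToRight (D.leftMul x y) =
      D.rightMul (D.leftToRight x) (D.leftToRight y) :=
    hf.map_mul H.isTwist_doubleTwist (fun x => H.tensorAct_flipSinv_doubleTwist x) hL hR
  have hleft : QuasiHopf.IsUnitalAssocAlgebra D.leftMul
      (QuasiHopf.dualOne H.toQuasiBialgebra ⊗ₜ[ℂ] (1 : M)) :=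
    ⟨hL.assoc, hL.one_mul, fun x => by
      induction x using TensorProduct.induction_on with
      | zero => simp
      | tmul φ m => exact (hL.mul_counit φ m 1).trans (by rw [mul_one])
      | add x y hx hy => rw [map_add, LinearMap.add_apply, hx, hy]⟩
  have hiso : QuasiHopf.IsUnitalAlgebraMap D.leftMul
      (QuasiHopf.dualOne H.toQuasiBialgebra ⊗ₜ[ℂ] (1 : M)) D.rightMul
      ((1 : M) ⊗ₜ[ℂ] QuasiHopf.dualOne H.toQuasiBialgebra) D.leftToRight := ⟨hmap, hincl 1⟩
  have hinclMul : ∀ m n, D.leftIncl (m * n) = D.leftMul (D.leftIncl m) (D.leftIncl n) :=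
    fun m n => (hL.mul_counit _ m n).symm
  have hinj : Function.Injective D.leftIncl := by
    -- Evaluating the functional leg at `1` recovers `m`, because `ε(1) = 1`.
    apply Function.LeftInverse.injective
      (g := fun z => dualTensorHom ℂ G M z 1)
    intro m
    change H.counit 1 • m = m
    rw [map_one, one_smul]
  -- Associativity and unit laws of the right product, and the properties of the inclusion of `M`
  -- into it, are all carried over from the left one by the comparison map.
  refine ⟨⟨hleft, hleft.of_surjective hiso fun y => ⟨D.rightToLeft y, LinearMap.congr_fun hfg y⟩⟩,
    ⟨⟨⟨hinclMul, rfl⟩, hinj⟩, ⟨⟨fun m n => ?_, rfl⟩, fun m n h => hinj ?_⟩⟩,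
    hiso, hincl, hgf, hfg⟩
  · rw [LinearMap.mul_apply_apply, ← hincl, hinclMul, hmap, hincl, hincl]
  · rw [← hincl, ← hincl] at h
    exact Function.LeftInverse.injective (g := D.rightToLeft) (LinearMap.congr_fun hgf) h
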